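/- Let $k$ be a field of characteristic zero (for example $\mathbb{C}$), let $n,m\ge 0$, let $a_0=1,a_1,\dots,a_m$ be positive integers such that the weighted projective space $\mathbb{P}(1,a_1,\dots,a_m)$ is well-formed, i.e. $\gcd(a_j : j\neq i)=1$ for every $0\le i\le m$ (with $\gcd(\varnothing)=0$, so that $m\geq 1$), and let $\omega_0,\dots,\omega_m$ be non-negative integers. The weighted bundle $\mathcal{F}=\mathcal{F}_{\mathbb{P}}(\omega_0,\dots,\omega_m)$ over $\mathbb{P}^n$ is the geometric quotient of $\mathbb{A}^{n+m+2}_k\setminus V(I)$, with coordinates $x_0,\dots,x_n,y_0,\dots,y_m$ and $I=(x_0,\dots,x_n)\cap(y_0,\dots,y_m)$, by the action of $\mathbb{G}_m^2$ with weight matrix \[A=\begin{pmatrix}1&\cdots&1&-\omega_0&-\omega_1&\cdots&-\omega_m\\0&\cdots&0&1&a_1&\cdots&a_m\end{pmatrix},\] i.e. $(\mu,\lambda)\cdot(x_j,y_i)=(\mu x_j,\ \mu^{-\omega_i}\lambda^{a_i}y_i)$. Let $\beta_1,\dots,\beta_m,\alpha_1,\dots,\alpha_n$ be the standard basis of $N=\mathbb{Z}^{n+m}$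 and put \[\beta_0=-\sum_{i=1}^m a_i\beta_i,\qquad \alpha_0=-\sum_{j=1}^n\alpha_j+\sum_{i=0}^m\omega_i\beta_i .\] For $0\le r\le m$ and $0\le s\le n$ let $\sigma_{rs}\subset N_{\mathbb{R}}$ be the cone generated by all $\beta_i$ with $i\ne r$ and all $\alpha_j$ with $j\neq s$, and let $\Sigma$ be the set of all faces of the cones $\sigma_{rs}$. Then: 1. $\Sigma$ is a fan in $N_{\mathbb{R}}$, and its maximal cones are exactly the $\sigma_{rs}$. 2. If $n\ge 1$, the primitive generators of the rays of $\Sigma$ are exactly $\alpha_0,\dots,\alpha_n,\beta_0,\dots,\beta_m$. 3. $\mathcal{F}\cong T(\Sigma)$ over $k$, where $T(\Sigma)$ is the toric variety of $\Sigma$. More precisely, there is a $k$-morphism $q:\mathbb{A}^{n+m+2}_k\setminus V(I)\to T(\Sigma)$ that is a geometric quotient for this action, and for every geometric quotient $\pi:\mathbb{A}^{n+m+2}_k\setminus V(I)\to\mathcal{F}$ over $k$ there is a $k$-isomorphism $e:\mathcal{F}\to T(\Sigma)$ with $e\circ\pi=q$. -/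

import Mathlib

open CategoryTheory CategoryTheory.Limits AlgebraicGeometry

universe u

noncomputable section

namespace WeightedBundle

section Cones

variable {ι : Type} [Fintype ι]

/-- Rational polyhedral cones live in `N_ℝ = ℝ^ι`, where `N = ℤ^ι`. -/
abbrev Cone (ι : Type) := PointedCone ℝ (ι → ℝ)

/-- The pairing `⟨u, v⟩` of `u ∈ M = Hom(N, ℤ) = ℤ^ι` with `v ∈ N_ℝ`. -/
def pairing (u : ι → ℤ) (v : ι → ℝ) : ℝ := ∑ i, (u i : ℝ) * v i

/-- The inclusion `N → N_ℝ`. -/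
def latticeVec (v : ι → ℤ) : ι → ℝ := fun i => (v i : ℝ)

/-- The cone in `N_ℝ` generated by a set of lattice vectors. -/
def coneOf (S : Set (ι → ℤ)) : Cone ι := PointedCone.hull ℝ (latticeVec '' S)

/-- Rational polyhedral cones: those generated by finitely many lattice vectors. -/
def IsRationalPolyhedral (σ : Cone ι) : Prop :=
  ∃ S : Set (ι → ℤ), S.Finite ∧ σ = coneOf S

/-- The semigroup `S_σ = σ^∨ ∩ M`. -/
def dualMonoid (σ : Cone ι) : AddSubmonoid (ι → ℤ) where
  carrier := {u | ∀ v ∈ σ, 0 ≤ pairing u v}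
  zero_mem' := fun v _ => by simp [pairing]
  add_mem' := fun {a b} ha hb v hv => by
    have : pairing (a + b) v = pairing a v + pairing b v := by
      simp [pairing, add_mul, Finset.sum_add_distrib]
    rw [this]
    exact add_nonneg (ha v hv) (hb v hv)

/-- `τ` is a face of the (rational polyhedral) cone `σ`: `τ = σ ∩ u^⊥` for some
`u ∈ σ^∨ ∩ M`. -/
def IsFace (τ σ : Cone ι) : Prop :=
  ∃ u ∈ dualMonoid σ, ∀ v, v ∈ τ ↔ v ∈ σ ∧ pairing u v = 0

/-- A fan in `N_ℝ`: a finite set of strongly convex rational polyhedral cones, closed under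
taking faces, in which any two cones meet in a common face. -/
structure IsFan (F : Set (Cone ι)) : Prop where
  finite : F.Finite
  rational : ∀ σ ∈ F, IsRationalPolyhedral σ
  stronglyConvex : ∀ σ ∈ F, ∀ v ∈ σ, -v ∈ σ → v = 0
  face_mem : ∀ σ ∈ F, ∀ τ, IsFace τ σ → τ ∈ F
  inter_face : ∀ σ ∈ F, ∀ τ ∈ F, IsFace (σ ⊓ τ) σ ∧ IsFace (σ ⊓ τ) τ

/-- A primitive lattice vector: it is nonzero and not a proper multiple of a lattice vector. -/
def IsPrimitive (v : ι → ℤ) : Prop := v ≠ 0 ∧ ∀ (d : ℤ) (w : ι → ℤ), v = d • w → IsUnit d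

lemma pairing_add (a b : ι → ℤ) (v : ι → ℝ) : pairing (a + b) v = pairing a v + pairing b v := by
  simp [pairing, add_mul, Finset.sum_add_distrib]

lemma pairing_nsmul (N : ℕ) (a : ι → ℤ) (v : ι → ℝ) : pairing (N • a) v = N * pairing a v := by
  simp [pairing, Finset.mul_sum, mul_assoc]

lemma pairing_neg (a : ι → ℤ) (v : ι → ℝ) : pairing (-a) v = - pairing a v := by
  simp [pairing]

lemma dualMonoid_anti {τ σ : Cone ι} (h : τ ≤ σ) : dualMonoid σ ≤ dualMonoid τ :=
  fun _ hu v hv => hu v (h hv)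

lemma mem_dualMonoid_coneOf {S : Set (ι → ℤ)} {u : ι → ℤ} :
    u ∈ dualMonoid (coneOf S) ↔ ∀ s ∈ S, 0 ≤ pairing u (latticeVec s) := by
  constructor
  · intro h s hs
    exact h _ (Submodule.subset_span ⟨s, hs, rfl⟩)
  · intro h v hv
    induction hv using Submodule.span_induction with
    | mem x hx => obtain ⟨s, hs, rfl⟩ := hx; exact h s hs
    | zero => simp [pairing]
    | add x y _ _ hx hy =>
      have : pairing u (x + y) = pairing u x + pairing u y := by
        simp [pairing, mul_add, Finset.sum_add_distrib]
      rw [this]; exact add_nonneg hx hy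
    | smul c x _ hx =>
      have : pairing u (c • x) = (c : ℝ) * pairing u x := by
        simp only [pairing, Finset.mul_sum]
        refine Finset.sum_congr rfl fun i _ => ?_
        change (u i : ℝ) * ((c : ℝ) * x i) = _
        ring
      rw [this]; exact mul_nonneg c.2 hx

lemma pairing_latticeVec (u s : ι → ℤ) :
    pairing u (latticeVec s) = ((∑ i, u i * s i : ℤ) : ℝ) := by
  simp [pairing, latticeVec]

/-- If `τ = σ ∩ u^⊥`, then `S_τ = S_σ + ℕ·(-u)`. -/
lemma exists_nsmul_add_mem {τ σ : Cone ι} (hσ : IsRationalPolyhedral σ) {u : ι → ℤ}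
    (hu : u ∈ dualMonoid σ) (hτ : ∀ v, v ∈ τ ↔ v ∈ σ ∧ pairing u v = 0)
    {w : ι → ℤ} (hw : w ∈ dualMonoid τ) : ∃ N : ℕ, ∀ N' ≥ N, N' • u + w ∈ dualMonoid σ := by
  obtain ⟨S, hS, rfl⟩ := hσ
  have key : ∀ s ∈ S, ∃ N : ℕ, ∀ N' ≥ N, 0 ≤ pairing (N' • u + w) (latticeVec s) := by
    intro s hs
    have hsσ : latticeVec s ∈ coneOf S := Submodule.subset_span ⟨s, hs, rfl⟩
    by_cases h0 : pairing u (latticeVec s) = 0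
    · refine ⟨0, fun N' _ => ?_⟩
      rw [pairing_add, pairing_nsmul, h0, mul_zero, zero_add]
      exact hw _ ((hτ _).2 ⟨hsσ, h0⟩)
    · have hpos : 0 < pairing u (latticeVec s) := lt_of_le_of_ne (hu _ hsσ) (Ne.symm h0)
      obtain ⟨N, hN⟩ := Archimedean.arch (-pairing w (latticeVec s)) hpos
      refine ⟨N, fun N' hN' => ?_⟩
      rw [pairing_add, pairing_nsmul]
      have h1 : (N : ℝ) * pairing u (latticeVec s) ≤ N' * pairing u (latticeVec s) :=
        mul_le_mul_of_nonneg_right (by exact_mod_cast hN') hpos.le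
      rw [nsmul_eq_mul] at hN
      linarith
  choose! f hf using key
  refine ⟨hS.toFinset.sup f, fun N' hN' => mem_dualMonoid_coneOf.2 fun s hs => hf s hs N' ?_⟩
  exact (Finset.le_sup (hS.mem_toFinset.2 hs)).trans hN'

end Cones

section ToricVariety

variable (k : Type u) [Field k] {ι : Type} [Fintype ι]

/-- The semigroup algebra `k[S_σ]`. -/
abbrev coneAlgebra (σ : Cone ι) : Type u := AddMonoidAlgebra k (dualMonoid σ)

/-- The inclusion `k[S_σ] → k[S_τ]` for `τ ⊆ σ`. -/
def coneAlgebraMap {τ σ : Cone ι} (h : τ ≤ σ) : coneAlgebra k σ →ₐ[k] coneAlgebra k τ :=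
  AddMonoidAlgebra.mapDomainAlgHom k k (AddSubmonoid.inclusion (dualMonoid_anti h))

lemma coneAlgebraMap_single {τ σ : Cone ι} (h : τ ≤ σ) (w : dualMonoid σ) (c : k) :
    coneAlgebraMap k h (AddMonoidAlgebra.single w c) =
      AddMonoidAlgebra.single (⟨w.1, dualMonoid_anti h w.2⟩ : dualMonoid τ) c := by
  simp [coneAlgebraMap]
  rfl

lemma coneAlgebraMap_injective {τ σ : Cone ι} (h : τ ≤ σ) :
    Function.Injective (coneAlgebraMap k h) :=
  AddMonoidAlgebra.mapDomain_injective (AddSubmonoid.inclusion_injective (dualMonoid_anti h))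

lemma coneAlgebraMap_refl (σ : Cone ι) :
    coneAlgebraMap k (le_refl σ) = AlgHom.id k (coneAlgebra k σ) := by
  refine AlgHom.ext fun x => ?_
  induction x using AddMonoidAlgebra.induction_linear with
  | zero => simp
  | add f g hf hg => rw [map_add, map_add, hf, hg]
  | single w c => exact coneAlgebraMap_single k le_rfl w c

lemma coneAlgebraMap_trans {ρ τ σ : Cone ι} (h : ρ ≤ τ) (h' : τ ≤ σ) :
    coneAlgebraMap k (h.trans h') = (coneAlgebraMap k h).comp (coneAlgebraMap k h') := by
  refine AlgHom.ext fun x => ?_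
  induction x using AddMonoidAlgebra.induction_linear with
  | zero => simp
  | add f g hf hg => rw [map_add, map_add, hf, hg]
  | single w c => simp only [AlgHom.comp_apply, coneAlgebraMap_single]

/-- For a face `τ = σ ∩ u^⊥`, the algebra `k[S_τ]` is the localization of `k[S_σ]` at `χ^u`. -/
lemma isLocalization_coneAlgebraMap {τ σ : Cone ι} (h : τ ≤ σ) (hσ : IsRationalPolyhedral σ)
    {u : ι → ℤ} (hu : u ∈ dualMonoid σ) (hτ : ∀ v, v ∈ τ ↔ v ∈ σ ∧ pairing u v = 0) :
    letI := (coneAlgebraMap k h).toRingHom.toAlgebra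
    IsLocalization.Away (AddMonoidAlgebra.single (⟨u, hu⟩ : dualMonoid σ) (1 : k))
      (coneAlgebra k τ) := by
  let := (coneAlgebraMap k h).toRingHom.toAlgebra
  have hmap : ∀ x, algebraMap (coneAlgebra k σ) (coneAlgebra k τ) x = coneAlgebraMap k h x :=
    fun _ => rfl
  have hnu : -u ∈ dualMonoid τ := fun v hv => by
    rw [pairing_neg, ((hτ v).1 hv).2, neg_zero]
  have hpow : ∀ N : ℕ, algebraMap (coneAlgebra k σ) (coneAlgebra k τ)
      (AddMonoidAlgebra.single (⟨u, hu⟩ : dualMonoid σ) (1 : k) ^ N) =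
      AddMonoidAlgebra.single (N • ⟨u, dualMonoid_anti h hu⟩ : dualMonoid τ) (1 : k) := by
    intro N
    rw [map_pow, hmap, coneAlgebraMap_single, AddMonoidAlgebra.single_pow, one_pow]
  have hunit : IsUnit (algebraMap (coneAlgebra k σ) (coneAlgebra k τ)
      (AddMonoidAlgebra.single (⟨u, hu⟩ : dualMonoid σ) (1 : k))) := by
    rw [hmap, coneAlgebraMap_single]
    refine IsUnit.of_mul_eq_one (AddMonoidAlgebra.single (⟨-u, hnu⟩ : dualMonoid τ) (1 : k)) ?_
    rw [AddMonoidAlgebra.single_mul_single, one_mul, AddMonoidAlgebra.one_def]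
    congr 1
    exact Subtype.ext (add_neg_cancel u)
  refine ⟨⟨?_, ?_, ?_⟩⟩
  · rintro ⟨_, N, rfl⟩
    rw [map_pow]
    exact hunit.pow N
  · intro z
    have hz : ∃ N : ℕ, ∀ N' ≥ N, ∃ x, z * algebraMap (coneAlgebra k σ) (coneAlgebra k τ)
        (AddMonoidAlgebra.single (⟨u, hu⟩ : dualMonoid σ) (1 : k) ^ N') =
        algebraMap (coneAlgebra k σ) (coneAlgebra k τ) x := by
      induction z using AddMonoidAlgebra.induction_linear with
      | zero => exact ⟨0, fun _ _ => ⟨0, by simp⟩⟩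
      | add f g hf hg =>
        obtain ⟨N₁, h₁⟩ := hf
        obtain ⟨N₂, h₂⟩ := hg
        refine ⟨max N₁ N₂, fun N' hN' => ?_⟩
        obtain ⟨x, hx⟩ := h₁ N' (le_of_max_le_left hN')
        obtain ⟨y, hy⟩ := h₂ N' (le_of_max_le_right hN')
        exact ⟨x + y, by rw [add_mul, hx, hy, map_add]⟩
      | single w c =>
        obtain ⟨N, hN⟩ := exists_nsmul_add_mem hσ hu hτ w.2
        refine ⟨N, fun N' hN' => ⟨AddMonoidAlgebra.single ⟨_, hN N' hN'⟩ c, ?_⟩⟩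
        rw [hpow, hmap, coneAlgebraMap_single, AddMonoidAlgebra.single_mul_single, mul_one]
        congr 1
        exact Subtype.ext (add_comm _ _)
    obtain ⟨N, hN⟩ := hz
    obtain ⟨x, hx⟩ := hN N le_rfl
    exact ⟨⟨x, ⟨_, N, rfl⟩⟩, hx⟩
  · intro x y hxy
    exact ⟨1, by rw [coneAlgebraMap_injective k h hxy]⟩

variable {F : Set (Cone ι)}

/-- The affine toric varieties `U_σ = Spec k[S_σ]`, for `σ` in a fan ordered by inclusion, with
the morphisms `U_τ → U_σ` for `τ ⊆ σ`. -/
def toricDiagram (F : Set (Cone ι)) : F ⥤ Scheme.{u} where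
  obj σ := Spec (.of (coneAlgebra k σ.1))
  map {τ σ} h := Spec.map (CommRingCat.ofHom (coneAlgebraMap k (leOfHom h)).toRingHom)
  map_id σ := by
    rw [← Spec.map_id]
    exact congrArg (fun f => Spec.map (CommRingCat.ofHom f))
      (congrArg AlgHom.toRingHom (coneAlgebraMap_refl k σ.1))
  map_comp {ρ τ σ} f g := by
    rw [← Spec.map_comp]
    exact congrArg (fun f => Spec.map (CommRingCat.ofHom f))
      (congrArg AlgHom.toRingHom (coneAlgebraMap_trans k (leOfHom f) (leOfHom g)))

lemma IsFan.isFace_of_le (hF : IsFan F) {τ σ : Cone ι} (hτ : τ ∈ F) (hσ : σ ∈ F) (h : τ ≤ σ) :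
    IsFace τ σ := by
  have := (hF.inter_face τ hτ σ hσ).2
  rwa [inf_eq_left.2 h] at this

lemma IsFan.isOpenImmersion (hF : IsFan F) {τ σ : F} (h : τ ⟶ σ) :
    IsOpenImmersion ((toricDiagram k F).map h) := by
  obtain ⟨u, hu, hτ⟩ := hF.isFace_of_le τ.2 σ.2 (leOfHom h)
  let := (coneAlgebraMap k (leOfHom h)).toRingHom.toAlgebra
  have := isLocalization_coneAlgebraMap k (leOfHom h) (hF.rational _ σ.2) hu hτ
  exact IsOpenImmersion.of_isLocalization
    (AddMonoidAlgebra.single (⟨u, hu⟩ : dualMonoid σ.1) (1 : k))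

lemma range_toricDiagram_map {τ σ : F} (h : τ ⟶ σ) (hσ : IsRationalPolyhedral σ.1)
    {u : ι → ℤ} (hu : u ∈ dualMonoid σ.1)
    (hτ : ∀ v, v ∈ τ.1 ↔ v ∈ σ.1 ∧ pairing u v = 0) :
    Set.range ((toricDiagram k F).map h) =
      ((PrimeSpectrum.basicOpen
        (AddMonoidAlgebra.single (⟨u, hu⟩ : dualMonoid σ.1) (1 : k)) :
        TopologicalSpace.Opens (PrimeSpectrum (coneAlgebra k σ.1))) :
        Set (PrimeSpectrum (coneAlgebra k σ.1))) := by
  let := (coneAlgebraMap k (leOfHom h)).toRingHom.toAlgebra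
  have := isLocalization_coneAlgebraMap k (leOfHom h) hσ hu hτ
  exact PrimeSpectrum.localization_away_comap_range (coneAlgebra k τ.1)
    (AddMonoidAlgebra.single (⟨u, hu⟩ : dualMonoid σ.1) (1 : k))

lemma IsFan.isLocallyDirected (hF : IsFan F) :
    (toricDiagram k F ⋙ Scheme.forget).IsLocallyDirected where
  cond {σ τ ρ} f g x y hxy := by
    have hxy' : (toricDiagram k F).map f x = (toricDiagram k F).map g y := hxy
    obtain ⟨u, hu, hσ⟩ := hF.isFace_of_le σ.2 ρ.2 (leOfHom f)
    obtain ⟨w, hw, hτ⟩ := hF.isFace_of_le τ.2 ρ.2 (leOfHom g)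
    have hmem : σ.1 ⊓ τ.1 ∈ F := hF.face_mem _ σ.2 _ (hF.inter_face _ σ.2 _ τ.2).1
    let l : F := ⟨σ.1 ⊓ τ.1, hmem⟩
    let a : l ⟶ σ := homOfLE (inf_le_left : σ.1 ⊓ τ.1 ≤ σ.1)
    let b : l ⟶ τ := homOfLE (inf_le_right : σ.1 ⊓ τ.1 ≤ τ.1)
    have huw : u + w ∈ dualMonoid ρ.1 := add_mem hu hw
    have hl : ∀ v, v ∈ l.1 ↔ v ∈ ρ.1 ∧ pairing (u + w) v = 0 := by
      intro v
      change v ∈ σ.1 ∧ v ∈ τ.1 ↔ _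
      rw [hσ, hτ, pairing_add]
      constructor
      · rintro ⟨⟨h1, h2⟩, -, h3⟩
        exact ⟨h1, by rw [h2, h3, add_zero]⟩
      · rintro ⟨h1, h2⟩
        have h3 := hu v h1
        have h4 := hw v h1
        exact ⟨⟨h1, by linarith⟩, h1, by linarith⟩
    have hx : (toricDiagram k F).map f x ∈ Set.range ((toricDiagram k F).map f) := ⟨x, rfl⟩
    have hy : (toricDiagram k F).map f x ∈ Set.range ((toricDiagram k F).map g) :=
      ⟨y, hxy'.symm⟩
    rw [range_toricDiagram_map k f (hF.rational _ ρ.2) hu hσ] at hx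
    rw [range_toricDiagram_map k g (hF.rational _ ρ.2) hw hτ] at hy
    have hz : (toricDiagram k F).map f x ∈ Set.range ((toricDiagram k F).map (a ≫ f)) := by
      rw [range_toricDiagram_map k (a ≫ f) (hF.rational _ ρ.2) huw hl]
      have e : AddMonoidAlgebra.single (⟨u + w, huw⟩ : dualMonoid ρ.1) (1 : k) =
          AddMonoidAlgebra.single (⟨u, hu⟩ : dualMonoid ρ.1) (1 : k) *
            AddMonoidAlgebra.single (⟨w, hw⟩ : dualMonoid ρ.1) (1 : k) := by
        rw [AddMonoidAlgebra.single_mul_single, one_mul]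
        rfl
      rw [e, PrimeSpectrum.basicOpen_mul]
      exact ⟨hx, hy⟩
    obtain ⟨z, hz⟩ := hz
    have := hF.isOpenImmersion k f
    have := hF.isOpenImmersion k g
    refine ⟨l, a, b, z, ?_, ?_⟩
    · change (toricDiagram k F).map a z = x
      apply ((toricDiagram k F).map f).isOpenEmbedding.injective
      rw [← Scheme.Hom.comp_apply, ← Functor.map_comp, hz]
    · change (toricDiagram k F).map b z = y
      apply ((toricDiagram k F).map g).isOpenEmbedding.injective
      rw [← Scheme.Hom.comp_apply, ← Functor.map_comp, ← hxy', ← hz]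
      rfl

lemma IsFan.hasColimit (hF : IsFan F) : HasColimit (toricDiagram k F) := by
  have : ∀ {i j : F} (f : i ⟶ j), IsOpenImmersion ((toricDiagram k F).map f) :=
    fun f => hF.isOpenImmersion k f
  have := hF.isLocallyDirected k
  infer_instance

/-- The structure morphisms `U_σ → Spec k`. -/
def toricCocone (F : Set (Cone ι)) : Cocone (toricDiagram k F) where
  pt := Spec (.of k)
  ι :=
    { app := fun σ => Spec.map (CommRingCat.ofHom (algebraMap k (coneAlgebra k σ.1)))
      naturality := fun τ σ h => by
        change Spec.map _ ≫ Spec.map _ = _ ≫ 𝟙 _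
        rw [Category.comp_id, ← Spec.map_comp]
        exact congrArg (fun f => Spec.map (CommRingCat.ofHom f))
          (coneAlgebraMap k (leOfHom h)).comp_algebraMap }

/-- The toric variety `T(Σ)` over `k` of a fan `Σ`: the affine schemes `U_σ`, `σ ∈ Σ`, glued
along the open immersions `U_τ → U_σ` for `τ ⊆ σ`. -/
def toricVariety {F : Set (Cone ι)} (hF : IsFan F) : Over (Spec (.of k)) :=
  haveI := hF.hasColimit k
  Over.mk (colimit.desc (toricDiagram k F) (toricCocone k F))

end ToricVariety

section Quotients

/-- A section `f` of `O_X` over `V` is invariant for a groupoid (such as an action)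
`pr, act : R ⇉ X` if its two pullbacks to `R` agree. -/
def IsInvariant {R X : Scheme.{u}} (pr act : R ⟶ X) (V : X.Opens) (f : Γ(X, V)) : Prop :=
  pr.appLE V (pr ⁻¹ᵁ V ⊓ act ⁻¹ᵁ V) inf_le_left f =
    act.appLE V (pr ⁻¹ᵁ V ⊓ act ⁻¹ᵁ V) inf_le_right f

/-- `π : X → Y` is a geometric quotient (in the sense of Mumford) for the action of a group `G`
on `X` with `R = G × X`, second projection `pr : G × X → X` and action map
`act : G × X → X`. -/
structure IsGeometricQuotient {R X Y : Scheme.{u}} (pr act : R ⟶ X) (π : X ⟶ Y) : Prop where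
  /-- `π` is constant on orbits -/
  invariant : pr ≫ π = act ≫ π
  /-- `π` is surjective, and a subset of `Y` is open iff its preimage is -/
  isQuotientMap : Topology.IsQuotientMap π
  /-- two geometric points of `X` with the same image in `Y` lie in one orbit -/
  orbit : ∀ (K : Type u) [Field K] [IsAlgClosed K] (x y : Spec (.of K) ⟶ X),
    x ≫ π = y ≫ π → ∃ g : Spec (.of K) ⟶ R, g ≫ pr = x ∧ g ≫ act = y
  /-- functions on `Y` are the invariant functions on `X` -/
  functions : ∀ V : Y.Opens, Function.Injective (π.app V) ∧
    ∀ f : Γ(X, π ⁻¹ᵁ V), IsInvariant pr act (π ⁻¹ᵁ V) f → ∃ g : Γ(Y, V), π.app V g = f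

variable (k : Type u) [Field k] {r : ℕ} {ν : Type}

/-- The coordinate ring `k[x_j][t_1^±, …, t_r^±]` of `𝔾_m^r × 𝔸^ν`. -/
abbrev TorusTimesAffine (r : ℕ) (ν : Type) : Type u :=
  AddMonoidAlgebra (MvPolynomial ν k) (Fin r → ℤ)

/-- The comorphism `x_j ↦ x_j` of the projection `𝔾_m^r × 𝔸^ν → 𝔸^ν`. -/
def prHom (r : ℕ) (ν : Type) : MvPolynomial ν k →+* TorusTimesAffine k r ν :=
  AddMonoidAlgebra.singleZeroRingHom

/-- The comorphism `x_j ↦ ∏ᵢ tᵢ ^ (A i j) * x_j` of the action of `𝔾_m^r` on `𝔸^ν` with weight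
matrix `A`. -/
def actHom (A : Matrix (Fin r) ν ℤ) : MvPolynomial ν k →ₐ[k] TorusTimesAffine k r ν :=
  MvPolynomial.aeval fun j => AddMonoidAlgebra.single (fun i => A i j) (MvPolynomial.X j)

/-- The projection `𝔾_m^r × 𝔸^ν → 𝔸^ν`. -/
def affinePr (r : ℕ) (ν : Type) :
    Spec (.of (TorusTimesAffine k r ν)) ⟶ Spec (.of (MvPolynomial ν k)) :=
  Spec.map (CommRingCat.ofHom (prHom k r ν))

/-- The action `𝔾_m^r × 𝔸^ν → 𝔸^ν`,
`(t, x) ↦ (∏ᵢ tᵢ ^ (A i j) * x_j)_j`, with weight matrix `A`. -/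
def affineAct (A : Matrix (Fin r) ν ℤ) :
    Spec (.of (TorusTimesAffine k r ν)) ⟶ Spec (.of (MvPolynomial ν k)) :=
  Spec.map (CommRingCat.ofHom (actHom k A).toRingHom)

variable {k}

/-- The open subscheme `𝔸^ν ∖ V(I)`. -/
def complement (I : Ideal (MvPolynomial ν k)) : (Spec (.of (MvPolynomial ν k))).Opens :=
  ⟨(PrimeSpectrum.zeroLocus (I : Set (MvPolynomial ν k)))ᶜ,
    (PrimeSpectrum.isClosed_zeroLocus _).isOpen_compl⟩

/-- `𝔸^ν ∖ V(I)` as a scheme over `k`. -/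
def complementOver (I : Ideal (MvPolynomial ν k)) : Over (Spec (.of k)) :=
  Over.mk ((complement I).ι ≫
    Spec.map (CommRingCat.ofHom (algebraMap k (MvPolynomial ν k))))

/-- `𝔸^ν ∖ V(I)` is stable under the action of `𝔾_m^r` with weights `A`. -/
def IsStable (A : Matrix (Fin r) ν ℤ) (I : Ideal (MvPolynomial ν k)) : Prop :=
  affinePr k r ν ⁻¹ᵁ complement I ≤ affineAct k A ⁻¹ᵁ complement I

/-- The projection `𝔾_m^r × (𝔸^ν ∖ V(I)) → 𝔸^ν ∖ V(I)`. -/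
def complementPr (r : ℕ) (I : Ideal (MvPolynomial ν k)) :
    (affinePr k r ν ⁻¹ᵁ complement I).toScheme ⟶ (complement I).toScheme :=
  affinePr k r ν ∣_ complement I

/-- The action `𝔾_m^r × (𝔸^ν ∖ V(I)) → 𝔸^ν ∖ V(I)` with weights `A`. -/
def complementAct {A : Matrix (Fin r) ν ℤ} {I : Ideal (MvPolynomial ν k)} (h : IsStable A I) :
    (affinePr k r ν ⁻¹ᵁ complement I).toScheme ⟶ (complement I).toScheme :=
  (affineAct k A).resLE _ _ h

/-- `(X, π)` is the variety `(A, I)`: the geometric quotient over `k` of `𝔸^ν ∖ V(I)` by the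
action of `𝔾_m^r` with weights `A`. -/
def IsQuotientVariety {A : Matrix (Fin r) ν ℤ} {I : Ideal (MvPolynomial ν k)} (h : IsStable A I)
    (X : Over (Spec (.of k))) (π : complementOver I ⟶ X) : Prop :=
  IsGeometricQuotient (complementPr r I) (complementAct h) π.left

end Quotients

section Bundle

/-- `P(a_0, …, a_m)` is a well-formed weighted projective space: the weights are positive, and
any `m` of the `m + 1` weights have highest common factor `1`. -/
def IsWellFormed {m : ℕ} (a : Fin (m + 1) → ℕ) : Prop :=
  (∀ i, 0 < a i) ∧ ∀ i, (Finset.univ.erase i).gcd a = 1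

/-- The weight matrix with columns `(1, 0)` (for `x_0, …, x_n`) and `(-ω_i, a_i)`
(for `y_0, …, y_m`). -/
def weights (n : ℕ) {m : ℕ} (a ω : Fin (m + 1) → ℕ) :
    Matrix (Fin 2) (Fin (n + 1) ⊕ Fin (m + 1)) ℤ :=
  Matrix.of ![Sum.elim (fun _ => 1) (fun i => -(ω i : ℤ)), Sum.elim (fun _ => 0) (fun i => (a i : ℤ))]

/-- The irrelevant ideal `(x_0, …, x_n) ∩ (y_0, …, y_m)`. -/
def irrelevantIdeal (k : Type u) [Field k] (n m : ℕ) :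
    Ideal (MvPolynomial (Fin (n + 1) ⊕ Fin (m + 1)) k) :=
  Ideal.span (Set.range fun j : Fin (n + 1) => MvPolynomial.X (Sum.inl j)) ⊓
    Ideal.span (Set.range fun i : Fin (m + 1) => MvPolynomial.X (Sum.inr i))

lemma mem_complement_irrelevantIdeal {k : Type u} [Field k] {n m : ℕ}
    (P : PrimeSpectrum (MvPolynomial (Fin (n + 1) ⊕ Fin (m + 1)) k)) :
    P ∈ complement (irrelevantIdeal k n m) ↔
      (∃ j, MvPolynomial.X (Sum.inl j) ∉ P.asIdeal) ∧
        ∃ i, MvPolynomial.X (Sum.inr i) ∉ P.asIdeal := by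
  change P ∉ PrimeSpectrum.zeroLocus _ ↔ _
  rw [irrelevantIdeal, PrimeSpectrum.zeroLocus_inf, Set.mem_union, not_or]
  simp only [PrimeSpectrum.mem_zeroLocus, SetLike.coe_subset_coe, Ideal.span_le,
    Set.range_subset_iff, not_forall, SetLike.mem_coe]

lemma isStable (k : Type u) [Field k] (n : ℕ) {m : ℕ} (a ω : Fin (m + 1) → ℕ) :
    IsStable (weights n a ω) (irrelevantIdeal k n m) := by
  have key : ∀ (P : PrimeSpectrum (TorusTimesAffine k 2 (Fin (n + 1) ⊕ Fin (m + 1)))) j,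
      prHom k 2 _ (MvPolynomial.X j) ∉ P.asIdeal →
        actHom k (weights n a ω) (MvPolynomial.X j) ∉ P.asIdeal := by
    intro P j hj h
    apply hj
    have := P.asIdeal.mul_mem_left
      (AddMonoidAlgebra.single (-fun i => weights n a ω i j) 1) h
    rwa [actHom, MvPolynomial.aeval_X, AddMonoidAlgebra.single_mul_single, one_mul,
      neg_add_cancel] at this
  intro P hP
  have hP' := (mem_complement_irrelevantIdeal (affinePr k 2 _ P)).1 hP
  obtain ⟨⟨j, hj⟩, i, hi⟩ := hP'
  exact (mem_complement_irrelevantIdeal (affineAct k (weights n a ω) P)).2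
    ⟨⟨j, key P _ hj⟩, i, key P _ hi⟩

/-- The vectors `β_0, …, β_m` of `ℤ^{m+n}`: `β_1, …, β_m` are standard basis vectors and
`β_0 = -∑_{i=1}^m a_i β_i`. -/
def beta (n : ℕ) {m : ℕ} (a : Fin (m + 1) → ℕ) : Fin (m + 1) → (Fin m ⊕ Fin n → ℤ) :=
  Fin.cons (-∑ i : Fin m, a i.succ • Pi.single (Sum.inl i) 1) fun i => Pi.single (Sum.inl i) 1

/-- The vectors `α_0, …, α_n` of `ℤ^{m+n}`: `α_1, …, α_n` are standard basis vectors and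
`α_0 = -∑_{j=1}^n α_j + ∑_{i=0}^m ω_i β_i`. -/
def alpha (n : ℕ) {m : ℕ} (a ω : Fin (m + 1) → ℕ) : Fin (n + 1) → (Fin m ⊕ Fin n → ℤ) :=
  Fin.cons (-∑ j : Fin n, Pi.single (Sum.inr j) 1 + ∑ i : Fin (m + 1), ω i • beta n a i)
    fun j => Pi.single (Sum.inr j) 1

/-- The cone `σ_{rs}` generated by all `β_i`, `i ≠ r`, and all `α_j`, `j ≠ s`. -/
def sigma (n : ℕ) {m : ℕ} (a ω : Fin (m + 1) → ℕ) (r : Fin (m + 1)) (s : Fin (n + 1)) :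
    Cone (Fin m ⊕ Fin n) :=
  coneOf (beta n a '' {i | i ≠ r} ∪ alpha n a ω '' {j | j ≠ s})

/-- The set `Σ` of all faces of the cones `σ_{rs}`. -/
def bundleFan (n : ℕ) {m : ℕ} (a ω : Fin (m + 1) → ℕ) : Set (Cone (Fin m ⊕ Fin n)) :=
  {τ | ∃ r s, IsFace τ (sigma n a ω r s)}

end Bundle

end WeightedBundle

end

open WeightedBundle

/-! The quotient is Cox's construction. The rays satisfy `∑ a_i β_i = 0` and `∑ α_j = ∑ ω_i β_i`,
and these two relations span all others. Pairing a character with the rays therefore gives an exact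
sequence `0 → M → ℤ^{n+m+2} → ℤ²` whose last map is the weight matrix (`expo_injective`,
`weightOf_expo`, `exists_expo_eq_of_weightOf_eq_zero`): the Laurent monomials of weight zero are
exactly the characters of the torus of `T(Σ)`.

For the fan, call a set of rays admissible if it misses some `α_s` and some `β_r`. Because the
relations have such a simple shape and the `a_i` are positive, a vector has at most one expression
with non-negative coefficients on admissible sets (`rayComb_injective`). Hence cones on admissible
sets meet in the cone on the intersection, and since characters can be prescribed on the generators
of `σ_{rs}` up to the factor `a_r`, every subset of an admissible set spans a face
(`isFace_rayCone`). So `Σ` is the set of cones on admissible sets. Well-formedness makes `β_0`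
primitive and forces `m ≥ 1`.

For the quotient, on the chart `x_s y_r ≠ 0` the weight-zero monomials are the elements of
`S_{σ_rs}`, so `k[S_{σ_rs}]` is the ring of invariants of the coordinate ring (`isGradedChart`).
Projection to weight zero gives surjectivity on spectra; units of weight a multiple of any given
weight give openness. Geometric fibres are orbits because `Kˣ` is divisible, so a torus element can
be found from its values on monomials (`exists_torus_of_coxHom_eq`). The chart maps glue to
`coxMap`, and the preimage of `U_{σ_rs}` is exactly `x_s y_r ≠ 0`
(`mem_range_spaceChart_of_coxMap_mem`), so the local statements give a geometric quotient.

Finally, a geometric quotient is a categorical quotient (`IsGeometricQuotient.exists_desc`), so any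
two are isomorphic compatibly with the maps from the total space. -/

namespace WeightedBundle

/-! ### Geometric quotients are categorical quotients. -/

namespace IsGeometricQuotient

variable {R X Y Z : Scheme.{u}} {pr act : R ⟶ X} {π : X ⟶ Y}

/-- A morphism that is constant on orbits is set-theoretically constant on the fibres of `π`. -/
lemma apply_eq (h : IsGeometricQuotient pr act π) {ψ : X ⟶ Z} (hψ : pr ≫ ψ = act ≫ ψ)
    {x x' : X} (hx : π x = π x') : ψ x = ψ x' := by
  -- The orbit axiom only speaks of geometric points, so `x` and `x'` are joined by a point of `X
  -- ×_Y X`, and the algebraic closure of its residue field supplies two geometric points with equal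
  -- image in `Y`.
  obtain ⟨z, hz, hz'⟩ := Scheme.Pullback.exists_preimage_pullback x x' hx
  let K := AlgebraicClosure ((pullback π π).residueField z)
  let p : Spec (.of K) ⟶ pullback π π :=
    Spec.map (CommRingCat.ofHom (algebraMap ((pullback π π).residueField z) K)) ≫
      (pullback π π).fromSpecResidueField z
  let y : Spec (.of K) := (default : PrimeSpectrum K)
  have hp : p y = z := by
    simp only [p, Scheme.Hom.comp_apply]
    exact Scheme.fromSpecResidueField_apply z _
  obtain ⟨g, hg, hg'⟩ := h.orbit K (p ≫ pullback.fst π π) (p ≫ pullback.snd π π)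
    (by simp only [Category.assoc, pullback.condition])
  have e : (p ≫ pullback.fst π π) ≫ ψ = (p ≫ pullback.snd π π) ≫ ψ := by
    rw [← hg, ← hg', Category.assoc, Category.assoc, hψ]
  have := congrArg (fun f : Spec (.of K) ⟶ Z => f y) e
  simpa only [Scheme.Hom.comp_apply, hp, hz, hz'] using this

lemma surjective (h : IsGeometricQuotient pr act π) : Function.Surjective π :=
  h.isQuotientMap.surjective

/-- Surjectivity determines a morphism out of `Y` on points, and injectivity of `O_Y → π_* O_X`
determines it on functions. -/
lemma epi (h : IsGeometricQuotient pr act π) : Epi π where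
  left_cancellation {Z} f g hfg := by
    have hbase : f.base = g.base := by
      ext y
      obtain ⟨x, rfl⟩ := h.surjective y
      simpa using congrArg (fun f : X ⟶ Z => f x) hfg
    refine Scheme.Hom.ext hbase fun U => ?_
    have : Mono (π.app (g ⁻¹ᵁ U)) :=
      ConcreteCategory.mono_of_injective _ (h.functions (g ⁻¹ᵁ U)).1
    rw [← cancel_mono (π.app (g ⁻¹ᵁ U)), Scheme.Hom.app_eq_appLE π, Category.assoc,
      Scheme.Hom.map_appLE, Scheme.Hom.app_eq_appLE f, Scheme.Hom.appLE_comp_appLE,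
      Scheme.Hom.app_eq_appLE g, Scheme.Hom.appLE_comp_appLE]
    congr 1

/-- The descended map on points. -/
lemma exists_base (h : IsGeometricQuotient pr act π) {ψ : X ⟶ Z} (hψ : pr ≫ ψ = act ≫ ψ) :
    ∃ b : C(Y, Z), ∀ x, b (π x) = ψ x := by
  let f : C(X, Y) := ⟨π, π.continuous⟩
  have hf : Topology.IsQuotientMap f := h.isQuotientMap
  let g : C(X, Z) := ⟨ψ, ψ.continuous⟩
  have hg : Function.FactorsThrough g f := fun x x' hx => h.apply_eq hψ hx
  exact ⟨hf.lift g hg, fun x => congrArg (fun k : C(X, Z) => k x) (hf.lift_comp g hg)⟩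

lemma isInvariant_appLE {ψ : X ⟶ Z} (hψ : pr ≫ ψ = act ≫ ψ) (V : Z.Opens)
    (U : X.Opens) (e : U ≤ ψ ⁻¹ᵁ V) (s : Γ(Z, V)) : IsInvariant pr act U (ψ.appLE V U e s) := by
  have h : ψ.appLE V U e ≫ pr.appLE U (pr ⁻¹ᵁ U ⊓ act ⁻¹ᵁ U) inf_le_left =
      ψ.appLE V U e ≫ act.appLE U (pr ⁻¹ᵁ U ⊓ act ⁻¹ᵁ U) inf_le_right := by
    simp only [Scheme.Hom.appLE_comp_appLE, hψ]
  exact congrArg (fun k => k.hom s) h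

/-- A geometric quotient is a categorical quotient. -/
lemma exists_desc (h : IsGeometricQuotient pr act π) {ψ : X ⟶ Z} (hψ : pr ≫ ψ = act ≫ ψ) :
    ∃ g : Y ⟶ Z, π ≫ g = ψ := by
  obtain ⟨b, hb⟩ := h.exists_base hψ
  let W (V : Z.Opens) : Y.Opens := V.comap b
  have hW : ∀ V, π ⁻¹ᵁ W V ≤ ψ ⁻¹ᵁ V := fun V x hx => by
    change ψ x ∈ V
    rw [← hb]
    exact hx
  -- The pullback of a function along `ψ` is invariant, hence comes from `Y`. Injectivity of `π.app`
  -- makes this descent unique, and so a ring homomorphism compatible with restriction.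
  have key : ∀ V (s : Γ(Z, V)), ∃ t, π.app (W V) t = ψ.appLE V (π ⁻¹ᵁ W V) (hW V) s :=
    fun V s => (h.functions (W V)).2 _ (isInvariant_appLE hψ V _ (hW V) s)
  choose t ht using key
  have inj : ∀ V, Function.Injective (π.app V) := fun V => (h.functions V).1
  let T (V : Z.Opens) : Γ(Z, V) ⟶ Γ(Y, W V) := CommRingCat.ofHom
    { toFun := t V
      map_one' := inj _ (by rw [ht, map_one, map_one])
      map_zero' := inj _ (by rw [ht, map_zero, map_zero])
      map_add' := fun x y => inj _ (by rw [ht, map_add, map_add, ht, ht])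
      map_mul' := fun x y => inj _ (by rw [ht, map_mul, map_mul, ht, ht]) }
  have hT : ∀ V, T V ≫ π.app (W V) = ψ.appLE V (π ⁻¹ᵁ W V) (hW V) := fun V => by
    ext s
    exact ht V s
  have mono : ∀ V, Mono (π.app V) := fun V =>
    ConcreteCategory.mono_of_injective _ (inj V)
  let g₀ : Y.toPresheafedSpace.Hom Z.toPresheafedSpace :=
    { base := TopCat.ofHom b
      c :=
        { app := fun V => T V.unop
          naturality := fun V V' i => by
            change Z.presheaf.map i ≫ T V'.unop = T V.unop ≫
              Y.presheaf.map (homOfLE (fun y hy => i.unop.le hy) : W V'.unop ⟶ W V.unop).op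
            rw [← cancel_mono (π.app (W V'.unop)), Category.assoc, hT, Category.assoc,
              Scheme.Hom.naturality, ← Category.assoc, hT, Scheme.Hom.map_appLE,
              Scheme.Hom.appLE_map] } }
  -- Locality is tested upstairs: if the descended function is invertible at `π x`, then its
  -- pullback, which is also the pullback of `s` along `ψ`, is invertible at `x`, and `ψ` is already
  -- a morphism of schemes.
  have loc : ∀ y, IsLocalHom (g₀.stalkMap y).hom := by
    intro y
    obtain ⟨x, rfl⟩ := h.surjective y
    refine ⟨fun a ha => ?_⟩
    obtain ⟨V, hV, s, rfl⟩ := TopCat.Presheaf.exists_germ_eq Z.presheaf a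
    rw [PresheafedSpace.stalkMap_germ_apply g₀ V (π x) hV] at ha
    have h₁ : π x ∈ Y.basicOpen (T V s) := (Y.mem_basicOpen _ _ _).2 ha
    have h₂ : x ∈ X.basicOpen (ψ.appLE V (π ⁻¹ᵁ W V) (hW V) s) := by
      rw [← hT, CommRingCat.comp_apply, ← Scheme.preimage_basicOpen]
      exact h₁
    rw [Scheme.basicOpen_appLE] at h₂
    have h₃ : ψ x ∈ Z.basicOpen s := h₂.2
    rw [← hb] at h₃
    exact (Z.mem_basicOpen _ _ _).1 h₃
  let g : Y ⟶ Z := ⟨⟨g₀, loc⟩⟩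
  have hg : ∀ V, g.app V = T V := fun V => rfl
  refine ⟨g, ?_⟩
  have hbase : (π ≫ g).base = ψ.base := by
    ext x
    exact hb x
  refine Scheme.Hom.ext hbase fun V => ?_
  have e : (π ≫ g).app V = ψ.appLE V (π ⁻¹ᵁ W V) (hW V) := hT V
  exact (congrArg (· ≫ X.presheaf.map (eqToHom _).op) e).trans
    ((Scheme.Hom.appLE_map ψ (hW V) _).trans (Scheme.Hom.app_eq_appLE ψ).symm)

end IsGeometricQuotient

/-- Geometric quotients of `X` over `S` are unique up to unique isomorphism. -/
lemma exists_iso_of_isGeometricQuotient {S R : Scheme.{u}} {X Y Z : Over S}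
    {pr act : R ⟶ X.left} {π : X ⟶ Y} {ρ : X ⟶ Z} (h : IsGeometricQuotient pr act π.left)
    (h' : IsGeometricQuotient pr act ρ.left) : ∃ e : Y ≅ Z, π ≫ e.hom = ρ := by
  obtain ⟨f, hf⟩ := h.exists_desc h'.invariant
  obtain ⟨g, hg⟩ := h'.exists_desc h.invariant
  have := h.epi
  have := h'.epi
  have hfg : f ≫ g = 𝟙 _ := by rw [← cancel_epi π.left, reassoc_of% hf, hg, Category.comp_id]
  have hgf : g ≫ f = 𝟙 _ := by rw [← cancel_epi ρ.left, reassoc_of% hg, hf, Category.comp_id]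
  have hw : f ≫ Z.hom = Y.hom := by
    rw [← cancel_epi π.left, reassoc_of% hf, Over.w, Over.w]
  refine ⟨Over.isoMk ⟨f, g, hfg, hgf⟩ hw, ?_⟩
  ext1
  exact hf

end WeightedBundle

/-! ### Spectra of rings of invariants for a diagonalizable coaction. -/

namespace WeightedBundle

/-- The coaction `act : B → B[G]` has ring of invariants `A`, embedded by `i`, it has a
decomposition into weight spaces, and for every weight some positive multiple is the weight of
a unit. -/
structure IsGradedChart {A B G : Type*} [CommRing A] [CommRing B] [AddCommGroup G]
    (i : A →+* B) (act : B →+* AddMonoidAlgebra B G) : Prop where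
  injective : Function.Injective i
  act_apply : ∀ a, act (i a) = AddMonoidAlgebra.single 0 (i a)
  coeff_zero_mem : ∀ b, (act b).coeff 0 ∈ i.range
  act_coeff : ∀ b χ, act ((act b).coeff χ) = AddMonoidAlgebra.single χ ((act b).coeff χ)
  sum_coeff : ∀ b, ((act b).coeff.sum fun _ c => c) = b
  exists_unit : ∀ χ : G, ∃ N : ℕ, N ≠ 0 ∧ ∃ w : Bˣ,
    act w = AddMonoidAlgebra.single (-(N • χ)) (w : B)

namespace IsGradedChart

variable {A B G : Type*} [CommRing A] [CommRing B] [AddCommGroup G]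
  {i : A →+* B} {act : B →+* AddMonoidAlgebra B G}

lemma mem_range (h : IsGradedChart i act) {b : B} (hb : act b = AddMonoidAlgebra.single 0 b) :
    b ∈ i.range := by
  have := h.coeff_zero_mem b
  rwa [hb, AddMonoidAlgebra.coeff_single, Finsupp.single_eq_same] at this

lemma coeff_zero_mul (h : IsGradedChart i act) (a : A) (b : B) :
    (act (i a * b)).coeff 0 = i a * (act b).coeff 0 := by
  rw [map_mul, h.act_apply, AddMonoidAlgebra.coeff_single_zero_mul]

/-- Taking the weight-zero component is an `A`-linear retraction `E : B → A` of `i` (a Reynolds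
operator), and `E` maps the extension of `I` back into `I`. -/
lemma comap_map (h : IsGradedChart i act) (I : Ideal A) : (I.map i).comap i = I := by
  refine le_antisymm ?_ Ideal.le_comap_map
  choose E hE using h.coeff_zero_mem
  have hE₀ : E 0 = 0 := h.injective (by rw [hE, map_zero act, map_zero i,
    AddMonoidAlgebra.coeff_zero, Finsupp.zero_apply])
  have hEadd : ∀ x y, E (x + y) = E x + E y := fun x y => h.injective (by
    rw [hE, map_add, map_add, hE, hE, AddMonoidAlgebra.coeff_add, Finsupp.add_apply])
  have hEmul : ∀ a x, E (i a * x) = a * E x := fun a x => h.injective (by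
    rw [map_mul, hE, hE, h.coeff_zero_mul])
  have hEi : ∀ a, E (i a) = a := fun a => h.injective (by
    rw [hE, h.act_apply, AddMonoidAlgebra.coeff_single, Finsupp.single_eq_same])
  have key : ∀ b ∈ I.map i, ∀ c, E (c * b) ∈ I := by
    intro b hb
    induction hb using Submodule.span_induction with
    | mem x hx =>
      obtain ⟨a, ha, rfl⟩ := hx
      intro c
      rw [mul_comm, hEmul]
      exact I.mul_mem_right _ ha
    | zero => intro c; rw [mul_zero, hE₀]; exact I.zero_mem
    | add x y _ _ hx hy => intro c; rw [mul_add, hEadd]; exact I.add_mem (hx c) (hy c)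
    | smul d x _ hx => intro c; rw [smul_eq_mul, ← mul_assoc]; exact hx _
  intro a ha
  have := key _ ha 1
  rwa [one_mul, hEi] at this

lemma comap_surjective (h : IsGradedChart i act) :
    Function.Surjective (PrimeSpectrum.comap i) := fun p =>
  (PrimeSpectrum.mem_range_comap_iff i).2 (h.comap_map p.asIdeal)

/-- The image of the locus where a homogeneous element does not vanish is open. -/
lemma isOpen_image_basicOpen_coeff (h : IsGradedChart i act) (b : B) (χ : G) :
    IsOpen (PrimeSpectrum.comap i ''
      (PrimeSpectrum.basicOpen ((act b).coeff χ) : Set (PrimeSpectrum B))) := by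
  set c := (act b).coeff χ with hc
  obtain ⟨N, hN, w, hw⟩ := h.exists_unit χ
  -- The unit `w` cancels the weight of `c ^ N`, so the product is an invariant `a`. Thus `D(c)` is
  -- the preimage of `D(a)`, and surjectivity makes `D(a)` its image.
  obtain ⟨a, ha⟩ : c ^ N * w ∈ i.range := h.mem_range (by
    rw [map_mul, map_pow, h.act_coeff, hw, AddMonoidAlgebra.single_pow,
      AddMonoidAlgebra.single_mul_single, add_neg_cancel])
  have e : (PrimeSpectrum.basicOpen c : Set (PrimeSpectrum B)) =
      PrimeSpectrum.comap i ⁻¹' (PrimeSpectrum.basicOpen a) := by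
    ext P
    change c ∉ P.asIdeal ↔ i a ∉ P.asIdeal
    rw [ha, not_iff_not, Ideal.mul_unit_mem_iff_mem _ w.isUnit]
    exact ⟨fun h => P.asIdeal.pow_mem_of_mem h _ (Nat.pos_of_ne_zero hN),
      fun h => P.2.mem_of_pow_mem _ h⟩
  rw [e, Set.image_preimage_eq _ h.comap_surjective]
  exact (PrimeSpectrum.basicOpen a).isOpen

/-- The image of `D(b)` is the union of the images of `D(b_χ)` over the homogeneous components `b_χ`
of `b`, which reduces openness to homogeneous elements. -/
lemma isOpenMap_comap [UniqueSums G] (h : IsGradedChart i act) :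
    IsOpenMap (PrimeSpectrum.comap i) := by
  rw [PrimeSpectrum.isTopologicalBasis_basic_opens.isOpenMap_iff]
  rintro _ ⟨b, rfl⟩
  have e : PrimeSpectrum.comap i '' (PrimeSpectrum.basicOpen b : Set (PrimeSpectrum B)) =
      ⋃ χ, PrimeSpectrum.comap i ''
        (PrimeSpectrum.basicOpen ((act b).coeff χ) : Set (PrimeSpectrum B)) := by
    refine subset_antisymm ?_ (Set.iUnion_subset fun χ => ?_)
    · rintro _ ⟨P, hP, rfl⟩
      have : ∃ χ, (act b).coeff χ ∉ P.asIdeal := by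
        by_contra! hcon
        refine hP ?_
        rw [← h.sum_coeff b]
        exact Submodule.sum_mem _ fun χ _ => hcon χ
      obtain ⟨χ, hχ⟩ := this
      exact Set.mem_iUnion.2 ⟨χ, P, hχ, rfl⟩
    · rintro _ ⟨P, hP, rfl⟩
      -- The kernel `Q` of `f` consists of the elements all of whose components lie in `P`. It is
      -- prime since `UniqueSums` makes `(B ⧸ P)[G]` a domain. It lies over the same prime of `A` as
      -- `P`, and it does not contain `b` as soon as one component of `b` is outside `P`.
      let f : B →+* AddMonoidAlgebra (B ⧸ P.asIdeal) G :=
        (AddMonoidAlgebra.mapRingHom G (Ideal.Quotient.mk P.asIdeal)).comp act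
      let Q : PrimeSpectrum B := ⟨RingHom.ker f, RingHom.ker_isPrime f⟩
      refine ⟨Q, fun hQ => hP ?_, ?_⟩
      · have hQ' : f b = 0 := hQ
        have := congrArg (fun x => AddMonoidAlgebra.coeff x χ) hQ'
        exact Ideal.Quotient.eq_zero_iff_mem.1 (by simpa [f] using this)
      · ext a
        change f (i a) = 0 ↔ i a ∈ P.asIdeal
        rw [RingHom.comp_apply, h.act_apply, AddMonoidAlgebra.mapRingHom_single,
          AddMonoidAlgebra.single_eq_zero, Ideal.Quotient.eq_zero_iff_mem]
  rw [e]
  exact isOpen_iUnion fun χ => h.isOpen_image_basicOpen_coeff b χ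

/-- Taking invariants commutes with localization at an invariant element. -/
lemma exists_act_localization (h : IsGradedChart i act)
    (f : A) (B' : Type*) [CommRing B'] [Algebra B B'] [IsLocalization.Away (i f) B'] :
    ∃ act' : B' →+* AddMonoidAlgebra B' G, ∀ b, act' (algebraMap B B' b) =
      AddMonoidAlgebra.mapRingHom G (algebraMap B B') (act b) := by
  have hact : IsUnit ((AddMonoidAlgebra.mapRingHom G (algebraMap B B')).comp act (i f)) := by
    rw [RingHom.comp_apply, h.act_apply, AddMonoidAlgebra.mapRingHom_single]
    exact (IsLocalization.Away.algebraMap_isUnit (S := B') (i f)).map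
      (AddMonoidAlgebra.singleZeroRingHom : B' →+* AddMonoidAlgebra B' G)
  exact ⟨IsLocalization.Away.lift (i f) hact, fun b => IsLocalization.Away.lift_eq (i f) hact b⟩

/-- Clear the denominator of `x` by a power of `f`. The numerator need not be invariant in `B`, but
it may be replaced by its weight-zero component, which has the same image in `B'`. -/
lemma exists_of_localization (h : IsGradedChart i act) (f : A) {A' B' : Type*} [CommRing A']
    [CommRing B'] [Algebra A A'] [Algebra B B'] [IsLocalization.Away f A']
    [IsLocalization.Away (i f) B'] {i' : A' →+* B'} {act' : B' →+* AddMonoidAlgebra B' G}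
    (hi' : ∀ a, i' (algebraMap A A' a) = algebraMap B B' (i a))
    (hact' : ∀ b, act' (algebraMap B B' b) =
      AddMonoidAlgebra.mapRingHom G (algebraMap B B') (act b))
    {x : B'} (hx : act' x = AddMonoidAlgebra.single 0 x) : x ∈ i'.range := by
  obtain ⟨N, b, hb⟩ := IsLocalization.Away.surj (i f) x
  obtain ⟨a, ha⟩ := h.coeff_zero_mem b
  have e : algebraMap B B' (i a) = algebraMap B B' b := by
    have h₁ := congrArg (fun y => AddMonoidAlgebra.coeff (act' y) 0) hb
    simp only [map_mul, map_pow, hx, hact', h.act_apply, AddMonoidAlgebra.mapRingHom_single,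
      AddMonoidAlgebra.single_pow, AddMonoidAlgebra.single_mul_single, smul_zero, add_zero,
      AddMonoidAlgebra.coeff_mapRingHom] at h₁
    rw [ha]
    rw [← hb]
    simpa using h₁.symm
  have hu : IsUnit (algebraMap A A' f) := IsLocalization.Away.algebraMap_isUnit f
  obtain ⟨u, hu⟩ := hu.pow N
  refine ⟨algebraMap A A' a * ↑u⁻¹, ?_⟩
  have hu' : i' (u : A') = algebraMap B B' (i f) ^ N := by rw [hu, map_pow, hi']
  rw [map_mul, hi', e, ← hb, ← hu', mul_assoc, ← map_mul, Units.mul_inv, map_one, mul_one]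

end IsGradedChart

end WeightedBundle

/-! ### Local criteria for functions on `Y` to be the invariant functions on `X`. -/

namespace WeightedBundle

section Functions

variable {R X Y : Scheme.{u}} {pr act : R ⟶ X} {π : X ⟶ Y}

lemma IsInvariant.restrict {U U' : X.Opens} (h : U' ≤ U) {f : Γ(X, U)}
    (hf : IsInvariant pr act U f) :
    IsInvariant pr act U' (X.presheaf.map (homOfLE h).op f) := by
  have hle : pr ⁻¹ᵁ U' ⊓ act ⁻¹ᵁ U' ≤ pr ⁻¹ᵁ U ⊓ act ⁻¹ᵁ U :=
    inf_le_inf (fun _ hx => h hx) (fun _ hx => h hx)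
  have := congrArg (R.presheaf.map (homOfLE hle).op) hf
  rw [← CommRingCat.comp_apply, ← CommRingCat.comp_apply, Scheme.Hom.appLE_map,
    Scheme.Hom.appLE_map] at this
  rw [IsInvariant, ← CommRingCat.comp_apply, ← CommRingCat.comp_apply, Scheme.Hom.map_appLE,
    Scheme.Hom.map_appLE]
  exact this

/-- This makes invariance usable: it can be evaluated along any test morphism `J` into the groupoid.
-/
lemma IsInvariant.appLE_eq {Z : Scheme.{u}} {U : X.Opens} {f : Γ(X, U)}
    (hf : IsInvariant pr act U f) (J : Z ⟶ R) (V : Z.Opens) (h : V ≤ (J ≫ pr) ⁻¹ᵁ U)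
    (h' : V ≤ (J ≫ act) ⁻¹ᵁ U) : (J ≫ pr).appLE U V h f = (J ≫ act).appLE U V h' f := by
  have hV : V ≤ J ⁻¹ᵁ (pr ⁻¹ᵁ U ⊓ act ⁻¹ᵁ U) := le_inf h h'
  have := congrArg (J.appLE _ V hV) hf
  rwa [← CommRingCat.comp_apply, ← CommRingCat.comp_apply, Scheme.Hom.appLE_comp_appLE,
    Scheme.Hom.appLE_comp_appLE] at this

variable (pr act π) in
/-- The sections of `O_Y` over `V` are the invariant sections of `O_X` over `π⁻¹ V`. -/
def SectionsAreInvariants (V : Y.Opens) : Prop :=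
  Function.Injective (π.app V) ∧
    ∀ f : Γ(X, π ⁻¹ᵁ V), IsInvariant pr act (π ⁻¹ᵁ V) f → ∃ g : Γ(Y, V), π.app V g = f

/-- That functions on `Y` are the invariant functions on `X` can be checked on a basis. -/
lemma sectionsAreInvariants_of_basis
    (h : ∀ (V : Y.Opens), ∀ y ∈ V, ∃ W ≤ V, y ∈ W ∧ SectionsAreInvariants pr act π W)
    (V : Y.Opens) : SectionsAreInvariants pr act π V := by
  have inj : ∀ V : Y.Opens, Function.Injective (π.app V) := by
    intro V s t hst
    choose W hWV hyW hW using fun y : V => h V y y.2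
    refine Y.sheaf.eq_of_locally_eq' W V (fun y => homOfLE (hWV y))
      (fun y hy => TopologicalSpace.Opens.mem_iSup.2 ⟨⟨y, hy⟩, hyW _⟩) s t fun y => (hW y).1 ?_
    change π.app (W y) (Y.presheaf.map (homOfLE (hWV y)).op s) =
      π.app (W y) (Y.presheaf.map (homOfLE (hWV y)).op t)
    rw [← CommRingCat.comp_apply, ← CommRingCat.comp_apply, Scheme.Hom.naturality,
      CommRingCat.comp_apply, CommRingCat.comp_apply, hst]
  refine ⟨inj V, fun f hf => ?_⟩
  choose W hWV hyW hW using fun y : V => h V y y.2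
  have hle : ∀ y, π ⁻¹ᵁ W y ≤ π ⁻¹ᵁ V := fun y x hx => hWV y hx
  have ex : ∀ y, ∃ g : Γ(Y, W y), π.app (W y) g = X.presheaf.map (homOfLE (hle y)).op f :=
    fun y => (hW y).2 _ (hf.restrict (hle y))
  choose g hg using ex
  have hcover : V ≤ iSup W := fun y hy => TopologicalSpace.Opens.mem_iSup.2 ⟨⟨y, hy⟩, hyW _⟩
  -- The local descents agree on overlaps because their pullbacks to `X` do and `π.app` is
  -- injective.
  obtain ⟨(s : Γ(Y, V)), (hs : ∀ y, Y.presheaf.map (homOfLE (hWV y)).op s = g y), -⟩ :=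
    Y.sheaf.existsUnique_gluing' W V (fun y => homOfLE (hWV y)) hcover g
    (fun y z => inj _ (by
      change π.app _ (Y.presheaf.map _ (g y)) = π.app _ (Y.presheaf.map _ (g z))
      rw [← CommRingCat.comp_apply, ← CommRingCat.comp_apply, Scheme.Hom.naturality,
        Scheme.Hom.naturality, CommRingCat.comp_apply, CommRingCat.comp_apply, hg, hg,
        ← CommRingCat.comp_apply, ← CommRingCat.comp_apply, ← Functor.map_comp,
        ← Functor.map_comp]
      rfl))
  refine ⟨s, X.sheaf.eq_of_locally_eq' (fun y => π ⁻¹ᵁ W y) (π ⁻¹ᵁ V)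
    (fun y => homOfLE (hle y)) (fun x hx => ?_) _ _ fun y => ?_⟩
  · exact TopologicalSpace.Opens.mem_iSup.2 ⟨⟨π x, hx⟩, hyW ⟨π x, hx⟩⟩
  · refine Eq.trans ?_ (hg y)
    rw [← hs y]
    change X.presheaf.map _ (π.app V s) = π.app (W y) (Y.presheaf.map _ s)
    rw [← CommRingCat.comp_apply, ← CommRingCat.comp_apply, Scheme.Hom.naturality]
    rfl

lemma bijective_appLE_top {Z : Scheme.{u}} (j : Z ⟶ X) [IsOpenImmersion j] (U : X.Opens)
    (hU : U ≤ j.opensRange) (e : ⊤ ≤ j ⁻¹ᵁ U) : Function.Bijective (j.appLE U ⊤ e) := by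
  have := j.isIso_app U hU
  have h : j ⁻¹ᵁ U = ⊤ := top_le_iff.1 e
  have : IsIso (j.appLE U ⊤ e) := by
    have e' : ((homOfLE e).op : Opposite.op (j ⁻¹ᵁ U) ⟶ Opposite.op ⊤) = (eqToHom h.symm).op := rfl
    rw [Scheme.Hom.appLE, e']
    infer_instance
  exact ConcreteCategory.bijective_of_isIso _

lemma appLE_comp_appTop {Z : Scheme.{u}} (g : Z ⟶ X) (f : X ⟶ Y) (U : Y.Opens) (e : ⊤ ≤ f ⁻¹ᵁ U)
    (e' : ⊤ ≤ (g ≫ f) ⁻¹ᵁ U) : f.appLE U ⊤ e ≫ g.appTop = (g ≫ f).appLE U ⊤ e' := by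
  have h : ⊤ ≤ g ⁻¹ᵁ ⊤ := le_rfl
  have : g.appTop = g.appLE ⊤ ⊤ h := Scheme.Hom.app_eq_appLE g
  rw [this, Scheme.Hom.appLE_comp_appLE]

lemma ΓSpecIso_hom_apply_appTop {A B : Type u} [CommRing A] [CommRing B] (φ : A →+* B)
    (s : Γ(Spec (.of A), ⊤)) :
    (Scheme.ΓSpecIso (.of B)).hom ((Spec.map (CommRingCat.ofHom φ)).appTop s) =
      φ ((Scheme.ΓSpecIso (.of A)).hom s) :=
  congrArg (fun k => k.hom s) (Scheme.ΓSpecIso_naturality (CommRingCat.ofHom φ))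

/-- Functions over an affine chart `Spec A → Y` whose preimage is the affine chart
`Spec B → X`. -/
lemma sectionsAreInvariants_of_chart {A B C : Type u} [CommRing A] [CommRing B] [CommRing C]
    (i : Spec (.of A) ⟶ Y) (j : Spec (.of B) ⟶ X) [IsOpenImmersion i] [IsOpenImmersion j]
    (φ : A →+* B) (hφ : Function.Injective φ)
    (hij : j ≫ π = Spec.map (CommRingCat.ofHom φ) ≫ i)
    (hrange : π ⁻¹ᵁ i.opensRange ≤ j.opensRange)
    (p α : B →+* C) (J : Spec (.of C) ⟶ R)
    (hp : J ≫ pr = Spec.map (CommRingCat.ofHom p) ≫ j)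
    (hα : J ≫ act = Spec.map (CommRingCat.ofHom α) ≫ j)
    (hinv : ∀ x, p x = α x → x ∈ φ.range) :
    SectionsAreInvariants pr act π i.opensRange := by
  have hj : j ⁻¹ᵁ π ⁻¹ᵁ i.opensRange = ⊤ := by
    rw [← Scheme.Hom.comp_preimage, hij, Scheme.Hom.comp_preimage, Scheme.Hom.preimage_opensRange]
    rfl
  have hi : i ⁻¹ᵁ i.opensRange = ⊤ := i.preimage_opensRange
  have bi := bijective_appLE_top i i.opensRange le_rfl hi.ge
  have bj := bijective_appLE_top j (π ⁻¹ᵁ i.opensRange) hrange hj.ge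
  have comm : π.app i.opensRange ≫ j.appLE _ ⊤ hj.ge =
      i.appLE i.opensRange ⊤ hi.ge ≫ (Spec.map (CommRingCat.ofHom φ)).appTop := by
    have hij' : (j ≫ π) ⁻¹ᵁ i.opensRange = ⊤ := hj
    rw [← Scheme.Hom.comp_appLE _ _ _ _ hij'.ge, appLE_comp_appTop _ _ _ _ (hij ▸ hij'.ge)]
    congr 1
  have comm' : ∀ s, j.appLE _ ⊤ hj.ge (π.app i.opensRange s) =
      (Spec.map (CommRingCat.ofHom φ)).appTop (i.appLE i.opensRange ⊤ hi.ge s) :=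
    fun s => congrArg (fun k => k.hom s) comm
  have bA := ConcreteCategory.bijective_of_isIso (Scheme.ΓSpecIso (.of A)).hom
  have bB := ConcreteCategory.bijective_of_isIso (Scheme.ΓSpecIso (.of B)).hom
  refine ⟨fun s t hst => ?_, fun f hf => ?_⟩
  · apply bi.1
    apply bA.1
    apply hφ
    rw [← ΓSpecIso_hom_apply_appTop, ← ΓSpecIso_hom_apply_appTop, ← comm', ← comm', hst]
  · have e : ∀ (k : B →+* C) (h), (Spec.map (CommRingCat.ofHom k) ≫ j).appLE
        (π ⁻¹ᵁ i.opensRange) ⊤ h = j.appLE _ ⊤ hj.ge ≫ (Spec.map (CommRingCat.ofHom k)).appTop := by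
      intro k h
      rw [appLE_comp_appTop]
    have hle : ∀ k : B →+* C, ⊤ ≤ (Spec.map (CommRingCat.ofHom k) ≫ j) ⁻¹ᵁ π ⁻¹ᵁ i.opensRange := by
      intro k
      rw [Scheme.Hom.comp_preimage, hj]
      exact le_rfl
    -- Invariance is only evaluated along `J`, so `J` need not be an isomorphism onto its target;
    -- `hinv` then says that this single test suffices.
    have h₁ := hf.appLE_eq J ⊤ (by rw [hp]; exact hle p) (by rw [hα]; exact hle α)
    have h₂ : (Spec.map (CommRingCat.ofHom p) ≫ j).appLE _ ⊤ (hle p) f =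
        (Spec.map (CommRingCat.ofHom α) ≫ j).appLE _ ⊤ (hle α) f := by
      simpa only [hp, hα] using h₁
    rw [e, e, CommRingCat.comp_apply, CommRingCat.comp_apply] at h₂
    obtain ⟨a, ha⟩ := hinv ((Scheme.ΓSpecIso (.of B)).hom (j.appLE _ ⊤ hj.ge f)) (by
      rw [← ΓSpecIso_hom_apply_appTop, ← ΓSpecIso_hom_apply_appTop, h₂])
    obtain ⟨a', rfl⟩ := bA.2 a
    obtain ⟨s, rfl⟩ := bi.2 a'
    refine ⟨s, bj.1 (bB.1 ?_)⟩
    rw [comm', ΓSpecIso_hom_apply_appTop, ← ha]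

end Functions

end WeightedBundle

/-! ### Pairing characters with the rays. -/

namespace WeightedBundle

section Rays

variable (n : ℕ) {m : ℕ} (a ω : Fin (m + 1) → ℕ)

/-- The rays `α_j`, `β_i`, indexed by the coordinates `x_j`, `y_i` of the affine space. -/
def ray : Fin (n + 1) ⊕ Fin (m + 1) → (Fin m ⊕ Fin n → ℤ) := Sum.elim (alpha n a ω) (beta n a)

/-- The exponent `⟨u, ρ_v⟩` of the variable `v` in the Cox monomial of the character `u`. -/
def expo (u : Fin m ⊕ Fin n → ℤ) (v : Fin (n + 1) ⊕ Fin (m + 1)) : ℤ := ∑ l, u l * ray n a ω v l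

@[simp] lemma ray_inr_zero_inl (i : Fin m) : ray n a ω (Sum.inr 0) (Sum.inl i) = -a i.succ := by
  simp [ray, beta, Finset.sum_apply, Pi.single_apply]

@[simp] lemma ray_inr_zero_inr (j : Fin n) : ray n a ω (Sum.inr 0) (Sum.inr j) = 0 := by
  simp [ray, beta, Finset.sum_apply]

@[simp] lemma ray_inr_succ (i : Fin m) :
    ray n a ω (Sum.inr i.succ) = Pi.single (Sum.inl i) 1 := by
  simp [ray, beta]

@[simp] lemma ray_inl_succ (j : Fin n) :
    ray n a ω (Sum.inl j.succ) = Pi.single (Sum.inr j) 1 := by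
  simp [ray, alpha]

@[simp] lemma ray_inl_zero_inl (i : Fin m) :
    ray n a ω (Sum.inl 0) (Sum.inl i) = ω i.succ - ω 0 * a i.succ := by
  simp [ray, alpha, beta, Finset.sum_apply, Pi.single_apply, Fin.sum_univ_succ]
  ring

@[simp] lemma ray_inl_zero_inr (j : Fin n) : ray n a ω (Sum.inl 0) (Sum.inr j) = -1 := by
  simp [ray, alpha, beta, Finset.sum_apply, Pi.single_apply, Fin.sum_univ_succ]

variable {n a ω}

@[simp] lemma expo_inr_succ (u : Fin m ⊕ Fin n → ℤ) (i : Fin m) :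
    expo n a ω u (Sum.inr i.succ) = u (Sum.inl i) := by
  simp [expo, Pi.single_apply]

@[simp] lemma expo_inl_succ (u : Fin m ⊕ Fin n → ℤ) (j : Fin n) :
    expo n a ω u (Sum.inl j.succ) = u (Sum.inr j) := by
  simp [expo, Pi.single_apply]

lemma expo_inr_zero (u : Fin m ⊕ Fin n → ℤ) :
    expo n a ω u (Sum.inr 0) = -∑ i : Fin m, a i.succ * u (Sum.inl i) := by
  simp [expo, mul_comm]

lemma expo_inl_zero (u : Fin m ⊕ Fin n → ℤ) :
    expo n a ω u (Sum.inl 0) =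
      -∑ j : Fin n, u (Sum.inr j) + ∑ i, ω i * expo n a ω u (Sum.inr i) := by
  simp only [expo, Fintype.sum_sum_type, ray_inl_zero_inl, ray_inl_zero_inr, Fin.sum_univ_succ,
    ray_inr_zero_inl, ray_inr_zero_inr, ray_inr_succ, Pi.single_apply]
  simp [mul_sub, Finset.sum_sub_distrib, Finset.mul_sum]
  rw [add_comm, sub_eq_neg_add]
  congr 2
  · congr 1
    refine Finset.sum_congr rfl fun i _ => ?_
    ring
  · refine Finset.sum_congr rfl fun i _ => ?_
    ring

lemma expo_add (u u' : Fin m ⊕ Fin n → ℤ) (v) :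
    expo n a ω (u + u') v = expo n a ω u v + expo n a ω u' v := by
  simp [expo, add_mul, Finset.sum_add_distrib]

lemma expo_zero (v) : expo n a ω 0 v = 0 := by simp [expo]

lemma sum_mul_expo (ha0 : a 0 = 1) (u : Fin m ⊕ Fin n → ℤ) :
    ∑ i, (a i : ℤ) * expo n a ω u (Sum.inr i) = 0 := by
  rw [Fin.sum_univ_succ, expo_inr_zero, ha0]
  simp

lemma sum_expo (u : Fin m ⊕ Fin n → ℤ) :
    ∑ j, expo n a ω u (Sum.inl j) = ∑ i, (ω i : ℤ) * expo n a ω u (Sum.inr i) := by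
  rw [Fin.sum_univ_succ, expo_inl_zero]
  simp

/-- Every exponent of weight zero comes from a character. -/
lemma exists_expo_eq (ha0 : a 0 = 1) (e : Fin (n + 1) ⊕ Fin (m + 1) → ℤ)
    (h₁ : ∑ i, (a i : ℤ) * e (Sum.inr i) = 0)
    (h₂ : ∑ j, e (Sum.inl j) = ∑ i, (ω i : ℤ) * e (Sum.inr i)) :
    ∃ u, ∀ v, expo n a ω u v = e v := by
  -- The rays with non-zero index form the standard basis, so they dictate `u`. The two weight
  -- equations then recover the exponents of `y_0` and `x_0`, without division since `a 0 = 1`.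
  let u : Fin m ⊕ Fin n → ℤ := Sum.elim (fun i => e (Sum.inr i.succ)) (fun j => e (Sum.inl j.succ))
  have hr : ∀ i, expo n a ω u (Sum.inr i) = e (Sum.inr i) := by
    intro i
    refine Fin.cases ?_ (fun i => ?_) i
    · rw [Fin.sum_univ_succ, ha0] at h₁
      rw [expo_inr_zero]
      simp only [u, Sum.elim_inl]
      push_cast at h₁
      linarith
    · rw [expo_inr_succ]; rfl
  refine ⟨u, Sum.rec (fun j => ?_) hr⟩
  refine Fin.cases ?_ (fun j => ?_) j
  · rw [expo_inl_zero]
    simp only [hr, ← h₂, Fin.sum_univ_succ (fun j => e (Sum.inl j))]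
    simp [u]
  · rw [expo_inl_succ]; rfl

/-- On the generators of `σ_{rs}` a character can be prescribed, up to the factor `a_r`. -/
lemma exists_expo_prescribed (ha0 : a 0 = 1) (r : Fin (m + 1)) (s : Fin (n + 1))
    (f : Fin (n + 1) ⊕ Fin (m + 1) → ℤ) :
    ∃ u, (∀ j, j ≠ s → expo n a ω u (Sum.inl j) = f (Sum.inl j)) ∧
      ∀ i, i ≠ r → expo n a ω u (Sum.inr i) = a r * f (Sum.inr i) := by
  -- The relation `∑ a_i d_i = 0` must be solved for `d_r`; scaling the other entries by `a r` makes
  -- the solution integral. Then `c_s` is fixed by the second relation, where its coefficient is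
  -- `1`.
  let d : Fin (m + 1) → ℤ := fun i =>
    if i = r then -∑ i ∈ Finset.univ.erase r, a i * f (Sum.inr i) else a r * f (Sum.inr i)
  let c : Fin (n + 1) → ℤ := fun j =>
    if j = s then ∑ i, ω i * d i - ∑ j ∈ Finset.univ.erase s, f (Sum.inl j) else f (Sum.inl j)
  obtain ⟨u, hu⟩ := exists_expo_eq (n := n) (ω := ω) ha0 (Sum.elim c d) (by
    rw [← Finset.add_sum_erase _ _ (Finset.mem_univ r)]
    have : ∑ i ∈ Finset.univ.erase r, (a i : ℤ) * d i =
        a r * ∑ i ∈ Finset.univ.erase r, a i * f (Sum.inr i) := by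
      rw [Finset.mul_sum]
      refine Finset.sum_congr rfl fun i hi => ?_
      simp only [d, if_neg (Finset.ne_of_mem_erase hi)]
      ring
    have hr : d r = -∑ i ∈ Finset.univ.erase r, a i * f (Sum.inr i) := if_pos rfl
    simp only [Sum.elim_inr, this, hr]
    ring) (by
    rw [← Finset.add_sum_erase _ _ (Finset.mem_univ s)]
    have : ∑ j ∈ Finset.univ.erase s, c j = ∑ j ∈ Finset.univ.erase s, f (Sum.inl j) :=
      Finset.sum_congr rfl fun j hj => by simp only [c, if_neg (Finset.ne_of_mem_erase hj)]
    simp only [Sum.elim_inl, Sum.elim_inr, this]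
    simp [c])
  refine ⟨u, fun j hj => ?_, fun i hi => ?_⟩
  · simp [hu, c, hj]
  · simp [hu, d, hi]

end Rays

/-! ### Cones spanned by admissible sets of rays. -/

section RayCones

variable {n m : ℕ} {a ω : Fin (m + 1) → ℕ}

variable (n a ω) in
/-- The cone generated by the rays in `S`. -/
def rayCone (S : Set (Fin (n + 1) ⊕ Fin (m + 1))) : Cone (Fin m ⊕ Fin n) :=
  coneOf (ray n a ω '' S)

variable (n a ω) in
/-- The linear combination of the rays with coefficients `b`. -/
def rayComb (b : Fin (n + 1) ⊕ Fin (m + 1) → ℝ) : Fin m ⊕ Fin n → ℝ :=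
  ∑ v, b v • latticeVec (ray n a ω v)

/-- A set of rays missing some `α_s` and some `β_r`. -/
def IsAdmissible (S : Set (Fin (n + 1) ⊕ Fin (m + 1))) : Prop :=
  (∃ s, Sum.inl s ∉ S) ∧ ∃ r, Sum.inr r ∉ S

lemma IsAdmissible.mono {S T : Set (Fin (n + 1) ⊕ Fin (m + 1))} (hT : IsAdmissible T)
    (h : S ⊆ T) : IsAdmissible S :=
  ⟨hT.1.imp fun _ hs hs' => hs (h hs'), hT.2.imp fun _ hr hr' => hr (h hr')⟩

lemma rayComb_add (b c : Fin (n + 1) ⊕ Fin (m + 1) → ℝ) :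
    rayComb n a ω (b + c) = rayComb n a ω b + rayComb n a ω c := by
  simp [rayComb, add_smul, Finset.sum_add_distrib]

lemma rayComb_single (v : Fin (n + 1) ⊕ Fin (m + 1)) :
    rayComb n a ω (Pi.single v 1) = latticeVec (ray n a ω v) := by
  rw [rayComb, Finset.sum_eq_single v]
  · simp
  · intro w _ hw; simp [hw]
  · simp

lemma rayComb_zero : rayComb n a ω 0 = 0 := by simp [rayComb]

lemma rayComb_smul (c : ℝ) (b : Fin (n + 1) ⊕ Fin (m + 1) → ℝ) :
    rayComb n a ω (c • b) = c • rayComb n a ω b := by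
  simp [rayComb, mul_smul, Finset.smul_sum]

lemma pairing_rayComb (u : Fin m ⊕ Fin n → ℤ) (b : Fin (n + 1) ⊕ Fin (m + 1) → ℝ) :
    pairing u (rayComb n a ω b) = ∑ v, b v * expo n a ω u v := by
  simp only [pairing, rayComb, Finset.sum_apply, Pi.smul_apply, smul_eq_mul, latticeVec, expo,
    Int.cast_sum, Int.cast_mul, Finset.mul_sum]
  rw [Finset.sum_comm]
  exact Finset.sum_congr rfl fun _ _ => Finset.sum_congr rfl fun _ _ => by ring

lemma pairing_ray (u : Fin m ⊕ Fin n → ℤ) (v) :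
    pairing u (latticeVec (ray n a ω v)) = expo n a ω u v := pairing_latticeVec _ _

lemma mem_rayCone {S : Set (Fin (n + 1) ⊕ Fin (m + 1))} {w : Fin m ⊕ Fin n → ℝ} :
    w ∈ rayCone n a ω S ↔
      ∃ b : Fin (n + 1) ⊕ Fin (m + 1) → ℝ, 0 ≤ b ∧ (∀ v ∉ S, b v = 0) ∧ rayComb n a ω b = w := by
  constructor
  · intro h
    induction h using Submodule.span_induction with
    | mem x hx =>
      obtain ⟨_, ⟨v, hv, rfl⟩, rfl⟩ := hx
      refine ⟨Pi.single v 1, Pi.single_nonneg.2 zero_le_one, fun w hw => ?_, rayComb_single v⟩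
      rw [Pi.single_apply, if_neg]
      rintro rfl
      exact hw hv
    | zero => exact ⟨0, le_rfl, fun _ _ => rfl, rayComb_zero⟩
    | add x y _ _ hx hy =>
      obtain ⟨b, hb, hbS, rfl⟩ := hx
      obtain ⟨c, hc, hcS, rfl⟩ := hy
      exact ⟨b + c, add_nonneg hb hc, fun v hv => by simp [hbS v hv, hcS v hv], rayComb_add b c⟩
    | smul c x _ hx =>
      obtain ⟨b, hb, hbS, rfl⟩ := hx
      exact ⟨(c : ℝ) • b, smul_nonneg c.2 hb, fun v hv => by simp [hbS v hv], rayComb_smul _ b⟩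
  · rintro ⟨b, hb, hbS, rfl⟩
    refine Submodule.sum_mem _ fun v _ => ?_
    by_cases hv : v ∈ S
    · exact Submodule.smul_mem (rayCone n a ω S) (⟨b v, hb v⟩ : {c : ℝ // 0 ≤ c})
        (Submodule.subset_span ⟨_, ⟨v, hv, rfl⟩, rfl⟩)
    · rw [hbS v hv, zero_smul]
      exact Submodule.zero_mem _

lemma latticeVec_ray_mem {S : Set (Fin (n + 1) ⊕ Fin (m + 1))} {v} (hv : v ∈ S) :
    latticeVec (ray n a ω v) ∈ rayCone n a ω S :=
  Submodule.subset_span ⟨_, ⟨v, hv, rfl⟩, rfl⟩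

lemma rayCone_mono {S T : Set (Fin (n + 1) ⊕ Fin (m + 1))} (h : S ⊆ T) :
    rayCone n a ω S ≤ rayCone n a ω T :=
  Submodule.span_mono (Set.image_mono (Set.image_mono h))

lemma mem_dualMonoid_rayCone {S : Set (Fin (n + 1) ⊕ Fin (m + 1))} {u : Fin m ⊕ Fin n → ℤ} :
    u ∈ dualMonoid (rayCone n a ω S) ↔ ∀ v ∈ S, 0 ≤ expo n a ω u v := by
  rw [rayCone, mem_dualMonoid_coneOf, Set.forall_mem_image]
  refine forall₂_congr fun v _ => ?_
  rw [pairing_ray]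
  exact Int.cast_nonneg_iff

/-- The relations between the rays are spanned by `∑ a_i β_i = 0` and
`∑ α_j = ∑ ω_i β_i`. -/
lemma eq_of_rayComb_eq_zero (ha0 : a 0 = 1) {c : Fin (n + 1) ⊕ Fin (m + 1) → ℝ}
    (h : rayComb n a ω c = 0) :
    ∃ p q : ℝ, (∀ j, c (Sum.inl j) = p) ∧ ∀ i, c (Sum.inr i) = a i * q - p * ω i := by
  -- The values of `p` and `q` are forced by the indices `j = 0` and `i = 0`; the coordinates of the
  -- vector equation then give the remaining indices.
  refine ⟨c (Sum.inl 0), c (Sum.inr 0) + c (Sum.inl 0) * ω 0, fun j => ?_, fun i => ?_⟩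
  · refine Fin.cases rfl (fun j => ?_) j
    have := congrFun h (Sum.inr j)
    simp [rayComb, latticeVec, Fin.sum_univ_succ, Pi.single_apply] at this
    linarith
  · refine Fin.cases ?_ (fun i => ?_) i
    · rw [ha0]; push_cast; ring
    · have := congrFun h (Sum.inl i)
      simp [rayComb, latticeVec, Fin.sum_univ_succ, Pi.single_apply] at this
      linarith

/-- A vector has at most one expression as a non-negative combination of an admissible set of
rays. -/
lemma rayComb_injective (ha0 : a 0 = 1) (hpos : ∀ i, 0 < a i)
    {S T : Set (Fin (n + 1) ⊕ Fin (m + 1))} (hS : IsAdmissible S) (hT : IsAdmissible T)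
    {b c : Fin (n + 1) ⊕ Fin (m + 1) → ℝ} (hb : 0 ≤ b) (hc : 0 ≤ c) (hbS : ∀ v ∉ S, b v = 0)
    (hcT : ∀ v ∉ T, c v = 0) (h : rayComb n a ω b = rayComb n a ω c) : b = c := by
  have h' : rayComb n a ω (b - c) = 0 := by
    rw [sub_eq_add_neg, ← neg_one_smul ℝ c, rayComb_add, rayComb_smul, h]
    simp
  obtain ⟨p, q, hp, hq⟩ := eq_of_rayComb_eq_zero ha0 h'
  obtain ⟨⟨s, hs⟩, r, hr⟩ := hS
  obtain ⟨⟨s', hs'⟩, r', hr'⟩ := hT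
  have e₁ := hp s
  have e₂ := hp s'
  have e₃ := hq r
  have e₄ := hq r'
  simp only [Pi.sub_apply, hbS _ hs, hcT _ hs', hbS _ hr, hcT _ hr'] at e₁ e₂ e₃ e₄
  -- At the index `s` missing from `S` the difference `b - c` is `≤ 0`, and at the index `s'`
  -- missing from `T` it is `≥ 0`; both values equal `p`. The same comparison at `r` and `r'`
  -- settles `q`, because the `a_i` are positive.
  have hp0 : p = 0 := by
    have := hc (Sum.inl s)
    have := hb (Sum.inl s')
    simp only [Pi.zero_apply] at *
    linarith
  have hq0 : q = 0 := by
    have h₁ := hc (Sum.inr r)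
    have h₂ := hb (Sum.inr r')
    have h₃ : (0 : ℝ) < a r := by exact_mod_cast hpos r
    have h₄ : (0 : ℝ) < a r' := by exact_mod_cast hpos r'
    simp only [Pi.zero_apply, hp0, zero_mul, sub_zero] at *
    refine le_antisymm ?_ ?_
    · by_contra! hq'
      have := mul_pos h₃ hq'
      linarith
    · by_contra! hq'
      have := mul_neg_of_pos_of_neg h₄ hq'
      linarith
  ext v
  rcases v with j | i
  · have := hp j
    simp only [Pi.sub_apply, hp0] at this
    linarith
  · have := hq i
    simp only [Pi.sub_apply, hp0, hq0] at this
    linarith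

lemma rayCone_inf (ha0 : a 0 = 1) (hpos : ∀ i, 0 < a i)
    {S T : Set (Fin (n + 1) ⊕ Fin (m + 1))} (hS : IsAdmissible S) (hT : IsAdmissible T) :
    rayCone n a ω S ⊓ rayCone n a ω T = rayCone n a ω (S ∩ T) := by
  refine le_antisymm ?_ (le_inf (rayCone_mono Set.inter_subset_left)
    (rayCone_mono Set.inter_subset_right))
  rintro w ⟨h₁, h₂⟩
  obtain ⟨b, hb, hbS, rfl⟩ := mem_rayCone.1 h₁
  obtain ⟨c, hc, hcT, h⟩ := mem_rayCone.1 h₂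
  obtain rfl := rayComb_injective ha0 hpos hT hS hc hb hcT hbS h
  refine mem_rayCone.2 ⟨c, hc, fun v hv => ?_, rfl⟩
  by_cases hvS : v ∈ S
  · exact hcT v fun hvT => hv ⟨hvS, hvT⟩
  · exact hbS v hvS

lemma mem_of_latticeVec_ray_mem (ha0 : a 0 = 1) (hpos : ∀ i, 0 < a i)
    {S T : Set (Fin (n + 1) ⊕ Fin (m + 1))} (hS : IsAdmissible S) (hT : IsAdmissible T) {v}
    (hv : v ∈ S) (h : latticeVec (ray n a ω v) ∈ rayCone n a ω T) : v ∈ T := by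
  obtain ⟨c, hc, hcT, h⟩ := mem_rayCone.1 h
  rw [← rayComb_single] at h
  have := rayComb_injective ha0 hpos hT hS hc (Pi.single_nonneg.2 zero_le_one) hcT
    (fun w hw => by
      rw [Pi.single_apply, if_neg]
      rintro rfl
      exact hw hv) h
  by_contra hvT
  have h0 := hcT v hvT
  rw [this, Pi.single_eq_same] at h0
  exact one_ne_zero h0

lemma subset_of_rayCone_le (ha0 : a 0 = 1) (hpos : ∀ i, 0 < a i)
    {S T : Set (Fin (n + 1) ⊕ Fin (m + 1))} (hS : IsAdmissible S) (hT : IsAdmissible T)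
    (h : rayCone n a ω S ≤ rayCone n a ω T) : S ⊆ T := fun _ hv =>
  mem_of_latticeVec_ray_mem ha0 hpos hS hT hv (h (latticeVec_ray_mem hv))

/-- A sum of non-negative terms vanishes only termwise, so `u` kills a combination only if the rays
with non-zero coefficient lie on `u^⊥`. -/
lemma mem_rayCone_sep {S : Set (Fin (n + 1) ⊕ Fin (m + 1))} {u : Fin m ⊕ Fin n → ℤ}
    (hu : ∀ v ∈ S, 0 ≤ expo n a ω u v) (w : Fin m ⊕ Fin n → ℝ) :
    w ∈ rayCone n a ω {v ∈ S | expo n a ω u v = 0} ↔ w ∈ rayCone n a ω S ∧ pairing u w = 0 := by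
  constructor
  · intro hw
    refine ⟨rayCone_mono (Set.sep_subset _ _) hw, ?_⟩
    obtain ⟨b, hb, hbS, rfl⟩ := mem_rayCone.1 hw
    rw [pairing_rayComb]
    refine Finset.sum_eq_zero fun v _ => ?_
    by_cases hv : v ∈ {v ∈ S | expo n a ω u v = 0}
    · rw [hv.2, Int.cast_zero, mul_zero]
    · rw [hbS v hv, zero_mul]
  · rintro ⟨hw, h0⟩
    obtain ⟨b, hb, hbS, rfl⟩ := mem_rayCone.1 hw
    rw [pairing_rayComb, Finset.sum_eq_zero_iff_of_nonneg] at h0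
    · refine mem_rayCone.2 ⟨b, hb, fun v hv => ?_, rfl⟩
      by_cases hvS : v ∈ S
      · refine (mul_eq_zero.1 (h0 v (Finset.mem_univ v))).resolve_right fun h => hv ⟨hvS, ?_⟩
        exact_mod_cast h
      · exact hbS v hvS
    · intro v _
      by_cases hvS : v ∈ S
      · exact mul_nonneg (hb v) (by exact_mod_cast hu v hvS)
      · rw [hbS v hvS, zero_mul]

lemma exists_eq_rayCone_of_isFace {S : Set (Fin (n + 1) ⊕ Fin (m + 1))}
    {τ : Cone (Fin m ⊕ Fin n)} (h : IsFace τ (rayCone n a ω S)) :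
    ∃ T ⊆ S, τ = rayCone n a ω T := by
  obtain ⟨u, hu, hτ⟩ := h
  refine ⟨{v ∈ S | expo n a ω u v = 0}, Set.sep_subset _ _, ?_⟩
  ext w
  rw [hτ, mem_rayCone_sep (mem_dualMonoid_rayCone.1 hu)]

/-- A character that vanishes on `S` and is positive on `T \ S` cuts out the face; it exists because
values on the generators of some `σ_{rs}` can be prescribed up to positive factors. -/
lemma isFace_rayCone (ha0 : a 0 = 1) (hpos : ∀ i, 0 < a i)
    {S T : Set (Fin (n + 1) ⊕ Fin (m + 1))} (hT : IsAdmissible T) (h : S ⊆ T) :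
    IsFace (rayCone n a ω S) (rayCone n a ω T) := by
  classical
  obtain ⟨⟨s, hs⟩, r, hr⟩ := hT
  obtain ⟨u, hu, hu'⟩ := exists_expo_prescribed (n := n) (ω := ω) ha0 r s
    (fun v => if v ∈ S then 0 else 1)
  have key : ∀ v ∈ T, 0 ≤ expo n a ω u v ∧ (expo n a ω u v = 0 ↔ v ∈ S) := by
    rintro (j | i) hv
    · rw [hu j (by rintro rfl; exact hs hv)]
      split_ifs with hS <;> simp [hS]
    · rw [hu' i (by rintro rfl; exact hr hv)]
      split_ifs with hS <;> simp [hS, (hpos r).ne']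
  refine ⟨u, mem_dualMonoid_rayCone.2 fun v hv => (key v hv).1, fun w => ?_⟩
  rw [← mem_rayCone_sep fun v hv => (key v hv).1]
  have : {v ∈ T | expo n a ω u v = 0} = S := by
    ext v
    exact ⟨fun hv => (key v hv.1).2.1 hv.2, fun hv => ⟨h hv, (key v (h hv)).2.2 hv⟩⟩
  rw [this]

end RayCones

/-! ### The fan `Σ` and its maximal cones. -/

section Fan

variable {n m : ℕ} {a ω : Fin (m + 1) → ℕ}

variable (n m) in
/-- The generators of `σ_{rs}`. -/
def gens (r : Fin (m + 1)) (s : Fin (n + 1)) : Set (Fin (n + 1) ⊕ Fin (m + 1)) :=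
  {Sum.inl s, Sum.inr r}ᶜ

lemma isAdmissible_gens (r : Fin (m + 1)) (s : Fin (n + 1)) : IsAdmissible (gens n m r s) :=
  ⟨⟨s, by simp [gens]⟩, r, by simp [gens]⟩

lemma IsAdmissible.exists_subset_gens {S : Set (Fin (n + 1) ⊕ Fin (m + 1))}
    (hS : IsAdmissible S) : ∃ r s, S ⊆ gens n m r s := by
  obtain ⟨⟨s, hs⟩, r, hr⟩ := hS
  refine ⟨r, s, fun v hv => ?_⟩
  rintro (rfl | rfl)
  · exact hs hv
  · exact hr hv

lemma sigma_eq_rayCone (r : Fin (m + 1)) (s : Fin (n + 1)) :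
    sigma n a ω r s = rayCone n a ω (gens n m r s) := by
  rw [sigma, rayCone]
  congr 1
  ext v
  constructor
  · rintro (⟨i, hi, rfl⟩ | ⟨j, hj, rfl⟩)
    · exact ⟨Sum.inr i, by simpa [gens] using hi, rfl⟩
    · exact ⟨Sum.inl j, by simpa [gens] using hj, rfl⟩
  · rintro ⟨j | i, hv, rfl⟩
    · exact Or.inr ⟨j, by simpa [gens] using hv, rfl⟩
    · exact Or.inl ⟨i, by simpa [gens] using hv, rfl⟩

/-- This combinatorial description of `Σ` reduces the fan axioms to operations on subsets of the
rays. -/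
lemma mem_bundleFan (ha0 : a 0 = 1) (hpos : ∀ i, 0 < a i) {τ : Cone (Fin m ⊕ Fin n)} :
    τ ∈ bundleFan n a ω ↔ ∃ S, IsAdmissible S ∧ τ = rayCone n a ω S := by
  constructor
  · rintro ⟨r, s, h⟩
    rw [sigma_eq_rayCone] at h
    obtain ⟨T, hT, rfl⟩ := exists_eq_rayCone_of_isFace h
    exact ⟨T, (isAdmissible_gens r s).mono hT, rfl⟩
  · rintro ⟨S, hS, rfl⟩
    obtain ⟨r, s, h⟩ := hS.exists_subset_gens
    refine ⟨r, s, ?_⟩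
    rw [sigma_eq_rayCone]
    exact isFace_rayCone ha0 hpos (isAdmissible_gens r s) h

lemma isFan_bundleFan (ha0 : a 0 = 1) (hpos : ∀ i, 0 < a i) : IsFan (bundleFan n a ω) where
  finite := by
    refine (Set.finite_range (rayCone n a ω)).subset fun τ hτ => ?_
    obtain ⟨S, -, rfl⟩ := (mem_bundleFan ha0 hpos).1 hτ
    exact ⟨S, rfl⟩
  rational σ hσ := by
    obtain ⟨S, -, rfl⟩ := (mem_bundleFan ha0 hpos).1 hσ
    exact ⟨_, S.toFinite.image _, rfl⟩
  stronglyConvex σ hσ v hv hv' := by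
    obtain ⟨S, hS, rfl⟩ := (mem_bundleFan ha0 hpos).1 hσ
    obtain ⟨b, hb, hbS, rfl⟩ := mem_rayCone.1 hv
    obtain ⟨c, hc, hcS, h⟩ := mem_rayCone.1 hv'
    have h0 := rayComb_injective (b := b + c) (c := 0) ha0 hpos hS hS (add_nonneg hb hc) le_rfl
      (fun v hv => by simp [hbS v hv, hcS v hv]) (fun _ _ => rfl)
      (by rw [rayComb_add, h, rayComb_zero, add_neg_cancel])
    rw [← rayComb_zero (n := n) (a := a) (ω := ω)]
    congr 1
    ext v
    have h₁ := congrFun h0 v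
    have h₂ := hb v
    have h₃ := hc v
    simp only [Pi.add_apply, Pi.zero_apply] at *
    linarith
  face_mem σ hσ τ h := by
    obtain ⟨S, hS, rfl⟩ := (mem_bundleFan ha0 hpos).1 hσ
    obtain ⟨T, hT, rfl⟩ := exists_eq_rayCone_of_isFace h
    exact (mem_bundleFan ha0 hpos).2 ⟨T, hS.mono hT, rfl⟩
  inter_face σ hσ τ hτ := by
    obtain ⟨S, hS, rfl⟩ := (mem_bundleFan ha0 hpos).1 hσ
    obtain ⟨T, hT, rfl⟩ := (mem_bundleFan ha0 hpos).1 hτ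
    rw [rayCone_inf ha0 hpos hS hT]
    exact ⟨isFace_rayCone ha0 hpos hS Set.inter_subset_left,
      isFace_rayCone ha0 hpos hT Set.inter_subset_right⟩

lemma maximal_bundleFan_iff (ha0 : a 0 = 1) (hpos : ∀ i, 0 < a i) (σ : Cone (Fin m ⊕ Fin n)) :
    Maximal (· ∈ bundleFan n a ω) σ ↔ ∃ r s, σ = sigma n a ω r s := by
  have hmem : ∀ r s, rayCone n a ω (gens n m r s) ∈ bundleFan n a ω := fun r s =>
    (mem_bundleFan ha0 hpos).2 ⟨_, isAdmissible_gens r s, rfl⟩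
  constructor
  · intro h
    obtain ⟨S, hS, rfl⟩ := (mem_bundleFan ha0 hpos).1 h.prop
    obtain ⟨r, s, hrs⟩ := hS.exists_subset_gens
    refine ⟨r, s, ?_⟩
    rw [sigma_eq_rayCone]
    exact h.eq_of_le (hmem r s) (rayCone_mono hrs)
  · rintro ⟨r, s, rfl⟩
    rw [sigma_eq_rayCone]
    refine ⟨hmem r s, fun τ hτ hle => ?_⟩
    obtain ⟨S, hS, rfl⟩ := (mem_bundleFan ha0 hpos).1 hτ
    -- An admissible set containing all rays but `α_s` and `β_r` must miss exactly these two.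
    have hsub := subset_of_rayCone_le ha0 hpos (isAdmissible_gens r s) hS hle
    refine rayCone_mono fun v hv hv' => ?_
    obtain ⟨⟨s', hs'⟩, r', hr'⟩ := hS
    have hs : s' = s := by
      by_contra hne
      exact hs' (hsub (by simp [gens, hne]))
    have hr : r' = r := by
      by_contra hne
      exact hr' (hsub (by simp [gens, hne]))
    subst hs hr
    rcases hv' with rfl | rfl
    · exact hs' hv
    · exact hr' hv

end Fan

end WeightedBundle

/-! ### Primitive generators of the rays. -/

namespace WeightedBundle

section Primitive

variable {n m : ℕ} {a ω : Fin (m + 1) → ℕ}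

lemma isPrimitive_of_isUnit {ι : Type} {v : ι → ℤ} (l : ι) (h : IsUnit (v l)) :
    IsPrimitive v := by
  refine ⟨fun h0 => ?_, fun d w hd => ?_⟩
  · rw [h0] at h
    exact not_isUnit_zero h
  · rw [hd] at h
    exact isUnit_of_mul_isUnit_left (show IsUnit (d * w l) from h)

/-- Every ray but `β_0` has a coordinate `±1`; for `α_0` this needs a coordinate in the second
block, so `n ≥ 1`. For `β_0` the entries are `-a_1, …, -a_m`, whose gcd is `1` by well-formedness at
index `0`. -/
lemma isPrimitive_ray (hn : n ≠ 0) (ha : IsWellFormed a)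
    (v : Fin (n + 1) ⊕ Fin (m + 1)) : IsPrimitive (ray n a ω v) := by
  obtain ⟨n, rfl⟩ := Nat.exists_eq_succ_of_ne_zero hn
  rcases v with j | i
  · refine Fin.cases ?_ (fun j => ?_) j
    · exact isPrimitive_of_isUnit (Sum.inr 0) (by simp)
    · exact isPrimitive_of_isUnit (Sum.inr j) (by simp)
  · refine Fin.cases ?_ (fun i => ?_) i
    · refine ⟨fun h0 => ?_, fun d w hd => ?_⟩
      · have h₁ : (Finset.univ.erase (0 : Fin (m + 1))).gcd a = 0 := by
          rw [Finset.gcd_eq_zero_iff]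
          intro i hi
          obtain ⟨i, rfl⟩ := Fin.exists_succ_eq.2 (Finset.ne_of_mem_erase hi)
          have := congrFun h0 (Sum.inl i)
          simpa using this
        rw [ha.2 0] at h₁
        exact one_ne_zero h₁
      · have h₁ : d.natAbs ∣ (Finset.univ.erase (0 : Fin (m + 1))).gcd a := by
          refine Finset.dvd_gcd fun i hi => ?_
          obtain ⟨i, rfl⟩ := Fin.exists_succ_eq.2 (Finset.ne_of_mem_erase hi)
          have := congrFun hd (Sum.inl i)
          rw [ray_inr_zero_inl, Pi.smul_apply, smul_eq_mul] at this
          rw [← Int.natCast_dvd_natCast, Int.natAbs_dvd, ← dvd_neg, this]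
          exact dvd_mul_right _ _
        rw [ha.2 0, Nat.dvd_one] at h₁
        exact Int.isUnit_iff_natAbs_eq.2 h₁
    · exact isPrimitive_of_isUnit (Sum.inl i) (by simp)

/-- Primitive lattice vectors on the same ray are equal. -/
lemma IsPrimitive.eq_of_smul_eq {ι : Type} {v w : ι → ℤ} (hv : IsPrimitive v)
    (hw : IsPrimitive w) {c : ℝ} (hc : 0 ≤ c) (h : c • latticeVec v = latticeVec w) : v = w := by
  obtain ⟨l, hl⟩ := Function.ne_iff.1 hv.1
  have h' : ∀ i, c * v i = w i := fun i => congrFun h i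
  have hl' : (v l : ℝ) ≠ 0 := by exact_mod_cast hl
  have hrel : ∀ i, w l * v i = v l * w i := by
    intro i
    have : (w l * v i : ℝ) = v l * w i := by rw [← h', ← h']; ring
    exact_mod_cast this
  -- Dividing `w l` and `v l` by their gcd gives `p v = q w` with `p`, `q` coprime. Then `q` divides
  -- `v` and `p` divides `w`, so both are units by primitivity, and `0 ≤ c` makes their signs equal.
  set g : ℤ := gcd (w l) (v l) with hg
  have hg0 : g ≠ 0 := fun h0 => hl ((gcd_eq_zero_iff _ _).1 h0).2
  obtain ⟨p, hp⟩ : g ∣ w l := gcd_dvd_left _ _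
  obtain ⟨q, hq⟩ : g ∣ v l := gcd_dvd_right _ _
  have hpq : IsCoprime p q := by
    obtain ⟨x, y, hxy⟩ := exists_gcd_eq_mul_add_mul (w l) (v l)
    refine ⟨x, y, mul_left_cancel₀ hg0 ?_⟩
    have : g = w l * x + v l * y := hxy
    rw [hp, hq] at this
    linear_combination -this
  have hrel' : ∀ i, p * v i = q * w i := fun i => mul_left_cancel₀ hg0 (by
    have := hrel i
    rw [hp, hq] at this
    linear_combination this)
  have hqv : ∀ i, ∃ x, v i = q * x := fun i =>
    hpq.symm.dvd_of_dvd_mul_left ⟨w i, hrel' i⟩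
  have hpw : ∀ i, ∃ x, w i = p * x := fun i =>
    hpq.dvd_of_dvd_mul_left ⟨v i, (hrel' i).symm⟩
  choose x hx using hqv
  choose y hy using hpw
  have uq := hv.2 q x (funext hx)
  have up := hw.2 p y (funext hy)
  have hsign : 0 ≤ p * q := by
    have h₁ : (0 : ℝ) ≤ w l * v l := by
      rw [← h' l, mul_assoc]
      exact mul_nonneg hc (mul_self_nonneg _)
    have h₂ : 0 ≤ w l * v l := by exact_mod_cast h₁
    rw [hp, hq] at h₂
    have h₃ : 0 < g * g := mul_self_pos.2 hg0
    by_contra! h₄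
    have := mul_neg_of_pos_of_neg h₃ h₄
    have e : g * p * (g * q) = g * g * (p * q) := by ring
    rw [e] at h₂
    exact absurd h₂ this.not_ge
  have hpq' : p = q := by
    rcases Int.isUnit_iff.1 up with rfl | rfl <;> rcases Int.isUnit_iff.1 uq with rfl | rfl <;>
      first | rfl | (exfalso; revert hsign; norm_num)
  subst hpq'
  exact funext fun i => mul_left_cancel₀ up.ne_zero (hrel' i)

/-- If the half-line of `v` is the cone on `S`, then `S` is non-empty since `v ≠ 0`, and any ray in
`S` lies on that half-line, so it equals `v` by primitivity. -/
lemma rays_bundleFan (hn : n ≠ 0) (ha0 : a 0 = 1) (ha : IsWellFormed a) :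
    {v | IsPrimitive v ∧ coneOf {v} ∈ bundleFan n a ω} =
      Set.range (alpha n a ω) ∪ Set.range (beta n a) := by
  -- For `m = 0` the gcd in the well-formedness condition is over the empty set, hence `0` and not
  -- `1`.
  have hm : m ≠ 0 := by
    rintro rfl
    have := ha.2 0
    simp at this
  have hrange : Set.range (alpha n a ω) ∪ Set.range (beta n a) = Set.range (ray n a ω) := by
    rw [ray, Set.Sum.elim_range]
  rw [hrange]
  ext v
  constructor
  · rintro ⟨hv, hv'⟩
    obtain ⟨S, -, hS⟩ := (mem_bundleFan ha0 ha.1).1 hv'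
    have hvS : latticeVec v ∈ rayCone n a ω S := by
      rw [← hS]
      exact Submodule.subset_span ⟨v, rfl, rfl⟩
    have hne : S.Nonempty := by
      by_contra! hS'
      obtain ⟨b, -, hb, hbv⟩ := mem_rayCone.1 hvS
      have hb0 : b = 0 := funext fun w => hb w (by simp [hS'])
      rw [hb0, rayComb_zero] at hbv
      refine hv.1 (funext fun i => ?_)
      have := congrFun hbv i
      simp only [Pi.zero_apply, latticeVec] at this
      exact_mod_cast this.symm
    obtain ⟨w, hw⟩ := hne
    have hwv : latticeVec (ray n a ω w) ∈ coneOf {v} := by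
      rw [hS]
      exact latticeVec_ray_mem hw
    rw [coneOf, Set.image_singleton] at hwv
    obtain ⟨c, hc⟩ := Submodule.mem_span_singleton.1 hwv
    exact ⟨w, (hv.eq_of_smul_eq (isPrimitive_ray hn ha w) c.2 hc).symm⟩
  · rintro ⟨w, rfl⟩
    refine ⟨isPrimitive_ray hn ha w, (mem_bundleFan ha0 ha.1).2 ⟨{w}, ?_, ?_⟩⟩
    -- A single ray is an admissible set only if another ray of the same kind exists; this is where
    -- `n ≥ 1` and `m ≥ 1` are needed.
    · have : Nontrivial (Fin (n + 1)) := Fin.nontrivial_iff_two_le.2 (by omega)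
      have : Nontrivial (Fin (m + 1)) := Fin.nontrivial_iff_two_le.2 (by omega)
      rcases w with j | i
      · obtain ⟨s, hs⟩ := exists_ne j
        exact ⟨⟨s, by simpa using hs⟩, 0, by simp⟩
      · obtain ⟨r, hr⟩ := exists_ne i
        exact ⟨⟨0, by simp⟩, r, by simpa using hr⟩
    · rw [rayCone, Set.image_singleton]

end Primitive

end WeightedBundle

/-! ### Laurent monomials and the homomorphisms `k[S_τ] → C` given by Cox coordinates. -/

namespace WeightedBundle

section LaurentPow

variable {C D : Type*} [CommRing C] [CommRing D]

open Classical in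
/-- `c ^ z` for an integer `z`, meaningful if `c` is a unit or `z` is non-negative. -/
noncomputable def laurentPow (c : C) (z : ℤ) : C :=
  if h : IsUnit c then ((h.unit ^ z : Cˣ) : C) else c ^ z.toNat

lemma laurentPow_unit (c : Cˣ) (z : ℤ) : laurentPow (c : C) z = ((c ^ z : Cˣ) : C) := by
  rw [laurentPow, dif_pos c.isUnit, IsUnit.unit_of_val_units]

lemma laurentPow_natCast (c : C) (N : ℕ) : laurentPow c N = c ^ N := by
  by_cases h : IsUnit c
  · obtain ⟨c, rfl⟩ := h
    rw [laurentPow_unit, zpow_natCast, Units.val_pow_eq_pow_val]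
  · rw [laurentPow, dif_neg h, Int.toNat_natCast]

@[simp] lemma laurentPow_zero (c : C) : laurentPow c 0 = 1 := by
  simpa using laurentPow_natCast c 0

lemma laurentPow_add {c : C} {z w : ℤ} (h : IsUnit c ∨ 0 ≤ z ∧ 0 ≤ w) :
    laurentPow c (z + w) = laurentPow c z * laurentPow c w := by
  rcases h with ⟨c, rfl⟩ | ⟨hz, hw⟩
  · rw [laurentPow_unit, laurentPow_unit, laurentPow_unit, zpow_add, Units.val_mul]
  · lift z to ℕ using hz
    lift w to ℕ using hw
    rw [← Nat.cast_add, laurentPow_natCast, laurentPow_natCast, laurentPow_natCast, pow_add]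

lemma map_laurentPow (f : C →+* D) {c : C} {z : ℤ} (h : IsUnit c ∨ 0 ≤ z) :
    f (laurentPow c z) = laurentPow (f c) z := by
  rcases h with ⟨c, rfl⟩ | hz
  · have : f (c : C) = ((Units.map f.toMonoidHom c : Dˣ) : D) := rfl
    rw [laurentPow_unit, this, laurentPow_unit, ← map_zpow]
    rfl
  · lift z to ℕ using hz
    rw [laurentPow_natCast, laurentPow_natCast, map_pow]

lemma laurentPow_units_mul (t : Cˣ) {c : C} {z : ℤ} (h : IsUnit c ∨ 0 ≤ z) :
    laurentPow (t * c) z = ((t ^ z : Cˣ) : C) * laurentPow c z := by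
  rcases h with ⟨c, rfl⟩ | hz
  · rw [← Units.val_mul, laurentPow_unit, laurentPow_unit, mul_zpow, Units.val_mul]
  · lift z to ℕ using hz
    rw [laurentPow_natCast, laurentPow_natCast, mul_pow, zpow_natCast, Units.val_pow_eq_pow_val]

variable {ν : Type*} [Fintype ν]

/-- The Laurent monomial `∏ c_v ^ e_v`. -/
noncomputable def laurentMonomial (c : ν → C) (e : ν → ℤ) : C := ∏ v, laurentPow (c v) (e v)

@[simp] lemma laurentMonomial_zero (c : ν → C) : laurentMonomial c 0 = 1 := by
  simp [laurentMonomial]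

lemma laurentMonomial_add {c : ν → C} {e f : ν → ℤ}
    (h : ∀ v, IsUnit (c v) ∨ 0 ≤ e v ∧ 0 ≤ f v) :
    laurentMonomial c (e + f) = laurentMonomial c e * laurentMonomial c f := by
  simp only [laurentMonomial, ← Finset.prod_mul_distrib]
  exact Finset.prod_congr rfl fun v _ => laurentPow_add (h v)

lemma map_laurentMonomial (f : C →+* D) {c : ν → C} {e : ν → ℤ}
    (h : ∀ v, IsUnit (c v) ∨ 0 ≤ e v) :
    f (laurentMonomial c e) = laurentMonomial (fun v => f (c v)) e := by
  rw [laurentMonomial, map_prod]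
  exact Finset.prod_congr rfl fun v _ => map_laurentPow f (h v)

lemma laurentMonomial_units_mul (t : ν → Cˣ) {c : ν → C} {e : ν → ℤ}
    (h : ∀ v, IsUnit (c v) ∨ 0 ≤ e v) :
    laurentMonomial (fun v => t v * c v) e =
      ((∏ v, t v ^ e v : Cˣ) : C) * laurentMonomial c e := by
  rw [laurentMonomial, laurentMonomial, Units.coe_prod, ← Finset.prod_mul_distrib]
  exact Finset.prod_congr rfl fun v _ => laurentPow_units_mul (t v) (h v)

lemma laurentMonomial_single [DecidableEq ν] (c : ν → C) (v : ν) (z : ℤ) :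
    laurentMonomial c (Pi.single v z) = laurentPow (c v) z := by
  rw [laurentMonomial, Finset.prod_eq_single v]
  · rw [Pi.single_eq_same]
  · intro w _ hw
    rw [Pi.single_eq_of_ne hw, laurentPow_zero]
  · simp

lemma laurentMonomial_natCast (c : ν → C) (e : ν → ℕ) :
    laurentMonomial c (fun v => (e v : ℤ)) = ∏ v, c v ^ e v :=
  Finset.prod_congr rfl fun _ _ => laurentPow_natCast _ _

end LaurentPow

section Cox

variable {k : Type*} [Field k] {n m : ℕ} {a ω : Fin (m + 1) → ℕ}
  {C D : Type*} [CommRing C] [CommRing D]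

/-- Every variable is invertible for `φ`, or the corresponding ray belongs to `τ`. -/
def CoxCompatible (a ω : Fin (m + 1) → ℕ) (τ : Cone (Fin m ⊕ Fin n))
    (φ : MvPolynomial (Fin (n + 1) ⊕ Fin (m + 1)) k →+* C) : Prop :=
  ∀ v, IsUnit (φ (MvPolynomial.X v)) ∨ latticeVec (ray n a ω v) ∈ τ

lemma CoxCompatible.mono {τ σ : Cone (Fin m ⊕ Fin n)}
    {φ : MvPolynomial (Fin (n + 1) ⊕ Fin (m + 1)) k →+* C} (h : CoxCompatible a ω τ φ)
    (hle : τ ≤ σ) : CoxCompatible a ω σ φ := fun v => (h v).imp_right fun hv => hle hv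

lemma CoxCompatible.comp {τ : Cone (Fin m ⊕ Fin n)}
    {φ : MvPolynomial (Fin (n + 1) ⊕ Fin (m + 1)) k →+* C} (h : CoxCompatible a ω τ φ)
    (f : C →+* D) : CoxCompatible a ω τ (f.comp φ) := fun v => (h v).imp_left fun hv => hv.map f

lemma expo_nonneg {τ : Cone (Fin m ⊕ Fin n)} {u : Fin m ⊕ Fin n → ℤ} (hu : u ∈ dualMonoid τ)
    {v} (hv : latticeVec (ray n a ω v) ∈ τ) : 0 ≤ expo n a ω u v := by
  have := hu _ hv
  rw [pairing_ray] at this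
  exact_mod_cast this

lemma CoxCompatible.expo {τ : Cone (Fin m ⊕ Fin n)}
    {φ : MvPolynomial (Fin (n + 1) ⊕ Fin (m + 1)) k →+* C} (h : CoxCompatible a ω τ φ)
    {u : Fin m ⊕ Fin n → ℤ} (hu : u ∈ dualMonoid τ) (v) :
    IsUnit (φ (MvPolynomial.X v)) ∨ 0 ≤ expo n a ω u v :=
  (h v).imp_right fun hv => expo_nonneg hu hv

/-- The homomorphism `k[S_τ] → C` sending `χ^u` to the Laurent monomial `∏ φ(x_v)^⟨u, ρ_v⟩`. -/
noncomputable def coxHom {τ : Cone (Fin m ⊕ Fin n)}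
    (φ : MvPolynomial (Fin (n + 1) ⊕ Fin (m + 1)) k →+* C) (h : CoxCompatible a ω τ φ) :
    coneAlgebra k τ →+* C :=
  AddMonoidAlgebra.liftNCRingHom (φ.comp MvPolynomial.C)
    { toFun := fun u => laurentMonomial (fun v => φ (MvPolynomial.X v)) (expo n a ω u.toAdd.1)
      map_one' := by
        have : expo n a ω 0 = 0 := funext expo_zero
        simp only [toAdd_one, ZeroMemClass.coe_zero, this, laurentMonomial_zero]
      map_mul' := fun u w => by
        have : expo n a ω (u.toAdd.1 + w.toAdd.1) = expo n a ω u.toAdd.1 + expo n a ω w.toAdd.1 :=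
          funext (expo_add _ _)
        rw [← laurentMonomial_add, ← this]
        · rfl
        · intro v
          exact (h v).imp_right fun hv => ⟨expo_nonneg u.toAdd.2 hv, expo_nonneg w.toAdd.2 hv⟩ }
    fun _ _ => mul_comm _ _

lemma coxHom_single {τ : Cone (Fin m ⊕ Fin n)}
    (φ : MvPolynomial (Fin (n + 1) ⊕ Fin (m + 1)) k →+* C) (h : CoxCompatible a ω τ φ)
    (u : dualMonoid τ) (c : k) :
    coxHom φ h (AddMonoidAlgebra.single u c) =
      φ (MvPolynomial.C c) * laurentMonomial (fun v => φ (MvPolynomial.X v)) (expo n a ω u.1) :=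
  AddMonoidAlgebra.liftNCRingHom_single _ _ _ _ _

lemma coneAlgebra_ringHom_ext {ι : Type} [Fintype ι] {τ : Cone ι} {f g : coneAlgebra k τ →+* C}
    (h : ∀ (u : dualMonoid τ) (c : k),
      f (AddMonoidAlgebra.single u c) = g (AddMonoidAlgebra.single u c)) : f = g := by
  refine RingHom.ext fun x => ?_
  induction x using AddMonoidAlgebra.induction_linear with
  | zero => rw [map_zero, map_zero]
  | add x y hx hy => rw [map_add, map_add, hx, hy]
  | single u c => exact h u c

lemma comp_coxHom {τ : Cone (Fin m ⊕ Fin n)}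
    (φ : MvPolynomial (Fin (n + 1) ⊕ Fin (m + 1)) k →+* C) (h : CoxCompatible a ω τ φ)
    (f : C →+* D) : f.comp (coxHom φ h) = coxHom (f.comp φ) (h.comp f) :=
  coneAlgebra_ringHom_ext fun u c => by
    rw [RingHom.comp_apply, coxHom_single, coxHom_single, map_mul,
      map_laurentMonomial f (h.expo u.2)]
    rfl

lemma coxHom_comp_coneAlgebraMap {τ σ : Cone (Fin m ⊕ Fin n)}
    (φ : MvPolynomial (Fin (n + 1) ⊕ Fin (m + 1)) k →+* C) (h : CoxCompatible a ω τ φ)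
    (hle : τ ≤ σ) :
    (coxHom φ h).comp (coneAlgebraMap k hle).toRingHom = coxHom φ (h.mono hle) :=
  coneAlgebra_ringHom_ext fun u c => by
    rw [coxHom_single]
    refine (congrArg (coxHom φ h) (coneAlgebraMap_single k hle u c)).trans ?_
    rw [coxHom_single]

lemma coxHom_congr {τ : Cone (Fin m ⊕ Fin n)}
    {φ ψ : MvPolynomial (Fin (n + 1) ⊕ Fin (m + 1)) k →+* C} (e : φ = ψ)
    (h : CoxCompatible a ω τ φ) (h' : CoxCompatible a ω τ ψ) : coxHom φ h = coxHom ψ h' := by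
  subst e
  rfl

lemma coxHom_comp_algebraMap {τ : Cone (Fin m ⊕ Fin n)}
    (φ : MvPolynomial (Fin (n + 1) ⊕ Fin (m + 1)) k →+* C) (h : CoxCompatible a ω τ φ) :
    (coxHom φ h).comp (algebraMap k (coneAlgebra k τ)) = φ.comp MvPolynomial.C := by
  refine RingHom.ext fun c => ?_
  have : expo n a ω 0 = 0 := funext expo_zero
  change coxHom φ h (AddMonoidAlgebra.single 0 c) = φ (MvPolynomial.C c)
  rw [coxHom_single, ZeroMemClass.coe_zero, this, laurentMonomial_zero, mul_one]

/-- The value of the weights on an exponent. -/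
def weightOf (a ω : Fin (m + 1) → ℕ) (e : Fin (n + 1) ⊕ Fin (m + 1) → ℤ) : Fin 2 → ℤ :=
  ∑ v, e v • fun l => weights n a ω l v

lemma weightOf_zero_apply (e : Fin (n + 1) ⊕ Fin (m + 1) → ℤ) :
    weightOf a ω e 0 = ∑ j, e (Sum.inl j) - ∑ i, (ω i : ℤ) * e (Sum.inr i) := by
  simp [weightOf, weights, Fintype.sum_sum_type, sub_eq_add_neg, mul_comm]

lemma weightOf_one_apply (e : Fin (n + 1) ⊕ Fin (m + 1) → ℤ) :
    weightOf a ω e 1 = ∑ i, (a i : ℤ) * e (Sum.inr i) := by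
  simp [weightOf, weights, Fintype.sum_sum_type, mul_comm]

/-- The rows of the weight matrix are the relations between the rays, so Cox monomials of characters
are torus-invariant. -/
lemma weightOf_expo (ha0 : a 0 = 1) (u : Fin m ⊕ Fin n → ℤ) :
    weightOf a ω (expo n a ω u) = 0 := by
  ext l
  fin_cases l
  · exact (weightOf_zero_apply _).trans (by rw [sum_expo, sub_self]; rfl)
  · exact (weightOf_one_apply _).trans (sum_mul_expo ha0 u)

/-- The other half of exactness in the middle of `M → ℤ^{n+m+2} → ℤ²`. -/
lemma exists_expo_eq_of_weightOf_eq_zero (ha0 : a 0 = 1) {e : Fin (n + 1) ⊕ Fin (m + 1) → ℤ}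
    (h : weightOf a ω e = 0) : ∃ u, expo n a ω u = e := by
  obtain ⟨u, hu⟩ := exists_expo_eq (n := n) (ω := ω) ha0 e
    ((weightOf_one_apply (ω := ω) e).symm.trans (congrFun h 1))
    (sub_eq_zero.1 ((weightOf_zero_apply (a := a) e).symm.trans (congrFun h 0)))
  exact ⟨u, funext hu⟩

/-- A point of the torus, as a homomorphism on characters. -/
noncomputable def torusUnit (T : Multiplicative (Fin 2 → ℤ) →* C) (χ : Fin 2 → ℤ) : Cˣ :=
  T.toHomUnits (Multiplicative.ofAdd χ)

lemma prod_torusUnit (T : Multiplicative (Fin 2 → ℤ) →* C)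
    (e : Fin (n + 1) ⊕ Fin (m + 1) → ℤ) :
    ∏ v, torusUnit T (fun l => weights n a ω l v) ^ e v = torusUnit T (weightOf a ω e) := by
  simp only [torusUnit, weightOf, ofAdd_sum, ofAdd_zsmul, map_prod, map_zpow]

/-- `coxHom` is invariant under the torus action. -/
lemma coxHom_eq_of_torus (ha0 : a 0 = 1) {τ : Cone (Fin m ⊕ Fin n)}
    {φ ψ : MvPolynomial (Fin (n + 1) ⊕ Fin (m + 1)) k →+* C}
    (T : Multiplicative (Fin 2 → ℤ) →* C)
    (hC : ∀ c, ψ (MvPolynomial.C c) = φ (MvPolynomial.C c))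
    (hX : ∀ v, ψ (MvPolynomial.X v) =
      torusUnit T (fun l => weights n a ω l v) * φ (MvPolynomial.X v))
    (h : CoxCompatible a ω τ φ) (h' : CoxCompatible a ω τ ψ) : coxHom φ h = coxHom ψ h' :=
  coneAlgebra_ringHom_ext fun u c => by
    rw [coxHom_single, coxHom_single, hC]
    simp only [hX]
    rw [laurentMonomial_units_mul _ (h.expo u.2), prod_torusUnit, weightOf_expo ha0]
    simp [torusUnit]

end Cox

end WeightedBundle

/-! ### The chart `x_s y_r ≠ 0`: its coordinate ring, coaction and invariants. -/

namespace WeightedBundle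

section CharacterUnit

variable (k : Type*) [Field k] {ν : Type*} [Fintype ν] [DecidableEq ν]

/-- The coordinate functions on the torus `Spec k[ℤ^ν]`. -/
noncomputable def characterUnit (v : ν) : (AddMonoidAlgebra k (ν → ℤ))ˣ :=
  (AddMonoidAlgebra.of k (ν → ℤ)).toHomUnits (Multiplicative.ofAdd (Pi.single v 1))

lemma laurentMonomial_characterUnit (e : ν → ℤ) :
    laurentMonomial (fun v => (characterUnit k v : AddMonoidAlgebra k (ν → ℤ))) e =
      AddMonoidAlgebra.single e 1 := by
  have h₁ : laurentMonomial (fun v => (characterUnit k v : AddMonoidAlgebra k (ν → ℤ))) e =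
      ((∏ v, characterUnit k v ^ e v : (AddMonoidAlgebra k (ν → ℤ))ˣ) :
        AddMonoidAlgebra k (ν → ℤ)) := by
    rw [laurentMonomial, Units.coe_prod]
    exact Finset.prod_congr rfl fun v _ => laurentPow_unit _ _
  have h₂ : ∏ v, characterUnit k v ^ e v =
      (AddMonoidAlgebra.of k (ν → ℤ)).toHomUnits (Multiplicative.ofAdd e) := by
    have h₃ : e = ∑ v, e v • Pi.single v (1 : ℤ) := by
      ext w
      simp [Finset.sum_apply, Pi.single_apply]
    conv_rhs => rw [h₃]
    simp only [characterUnit, ofAdd_sum, ofAdd_zsmul, map_prod, map_zpow]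
  rw [h₁, h₂]
  rfl

end CharacterUnit

section Chart

variable {k : Type*} [Field k] {n m : ℕ} {a ω : Fin (m + 1) → ℕ}
  {C : Type*} [CommRing C]

variable (k n m) in
/-- The Cox ring `k[x_0, …, x_n, y_0, …, y_m]`. -/
abbrev CoxRing := MvPolynomial (Fin (n + 1) ⊕ Fin (m + 1)) k

variable (k n m) in
/-- The monomial `x_s y_r`. -/
noncomputable def chartVar (r : Fin (m + 1)) (s : Fin (n + 1)) :
    CoxRing k n m :=
  MvPolynomial.X (Sum.inl s) * MvPolynomial.X (Sum.inr r)

lemma isUnit_or_mem_gens {φ : CoxRing k n m →+* C} {r s}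
    (h : IsUnit (φ (chartVar k n m r s))) (v) :
    IsUnit (φ (MvPolynomial.X v)) ∨ v ∈ gens n m r s := by
  rw [chartVar, map_mul] at h
  by_cases hv : v ∈ gens n m r s
  · exact Or.inr hv
  · rw [gens, Set.notMem_compl_iff] at hv
    rcases hv with rfl | rfl
    · exact Or.inl (isUnit_of_mul_isUnit_left h)
    · exact Or.inl (isUnit_of_mul_isUnit_right h)

/-- The only rays that are not generators of `σ_{rs}` are `α_s` and `β_r`, and their variables are
the factors of `x_s y_r`. -/
lemma coxCompatible_sigma {φ : CoxRing k n m →+* C} {r s}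
    (h : IsUnit (φ (chartVar k n m r s))) : CoxCompatible a ω (sigma n a ω r s) φ := fun v =>
  (isUnit_or_mem_gens h v).imp_right fun hv => by
    rw [sigma_eq_rayCone]
    exact latticeVec_ray_mem hv

lemma mem_dualMonoid_sigma {u : Fin m ⊕ Fin n → ℤ} {r s} :
    u ∈ dualMonoid (sigma n a ω r s) ↔ ∀ v ∈ gens n m r s, 0 ≤ expo n a ω u v := by
  rw [sigma_eq_rayCone, mem_dualMonoid_rayCone]

variable (a ω) in
/-- The coaction `x_v ↦ t^(A v) φ(x_v)`. -/
noncomputable def coaction (φ : CoxRing k n m →+* C) :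
    CoxRing k n m →+* AddMonoidAlgebra C (Fin 2 → ℤ) :=
  (AddMonoidAlgebra.mapRingHom _ φ).comp (actHom k (weights n a ω)).toRingHom

lemma coaction_C (φ : CoxRing k n m →+* C) (c : k) :
    coaction a ω φ (MvPolynomial.C c) = AddMonoidAlgebra.single 0 (φ (MvPolynomial.C c)) := by
  have : actHom k (weights n a ω) (MvPolynomial.C c) =
      AddMonoidAlgebra.single 0 (MvPolynomial.C c) := by
    rw [actHom, MvPolynomial.aeval_C]
    rfl
  refine (congrArg (AddMonoidAlgebra.mapRingHom _ φ) this).trans ?_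
  rw [AddMonoidAlgebra.mapRingHom_single]

lemma coaction_X (φ : CoxRing k n m →+* C) (v) :
    coaction a ω φ (MvPolynomial.X v) =
      AddMonoidAlgebra.single (fun l => weights n a ω l v) (φ (MvPolynomial.X v)) := by
  have : actHom k (weights n a ω) (MvPolynomial.X v) =
      AddMonoidAlgebra.single (fun l => weights n a ω l v) (MvPolynomial.X v) := by
    rw [actHom, MvPolynomial.aeval_X]
  refine (congrArg (AddMonoidAlgebra.mapRingHom _ φ) this).trans ?_
  rw [AddMonoidAlgebra.mapRingHom_single]

lemma torusUnit_of (χ : Fin 2 → ℤ) :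
    (torusUnit (AddMonoidAlgebra.of C (Fin 2 → ℤ)) χ : AddMonoidAlgebra C (Fin 2 → ℤ)) =
      AddMonoidAlgebra.single χ 1 := rfl

lemma coaction_X_eq_torusUnit (φ : CoxRing k n m →+* C) (v) :
    coaction a ω φ (MvPolynomial.X v) =
      torusUnit (AddMonoidAlgebra.of C (Fin 2 → ℤ)) (fun l => weights n a ω l v) *
        (AddMonoidAlgebra.singleZeroRingHom (φ (MvPolynomial.X v)) :
          AddMonoidAlgebra C (Fin 2 → ℤ)) := by
  rw [coaction_X, torusUnit_of]
  change _ = _ * AddMonoidAlgebra.single 0 _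
  rw [AddMonoidAlgebra.single_mul_single, add_zero, one_mul]

lemma isUnit_coaction_chartVar {φ : CoxRing k n m →+* C} {r s}
    (h : IsUnit (φ (chartVar k n m r s))) : IsUnit (coaction a ω φ (chartVar k n m r s)) := by
  rw [chartVar, map_mul] at h
  rw [chartVar, map_mul, coaction_X_eq_torusUnit, coaction_X_eq_torusUnit]
  exact ((Units.isUnit _).mul ((isUnit_of_mul_isUnit_left h).map _)).mul
    ((Units.isUnit _).mul ((isUnit_of_mul_isUnit_right h).map _))

variable {B : Type*} [CommRing B] [Algebra (CoxRing k n m) B]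
  (r : Fin (m + 1)) (s : Fin (n + 1)) [hB : IsLocalization.Away (chartVar k n m r s) B]

variable (k B) in
/-- The images of the variables in the coordinate ring of a chart. -/
noncomputable def chartCoord (v : Fin (n + 1) ⊕ Fin (m + 1)) : B :=
  algebraMap (CoxRing k n m) B (MvPolynomial.X v)

variable (k B) in
/-- The Laurent monomials in the coordinate ring of a chart. -/
noncomputable def chartMonomial (c : k) (e : Fin (n + 1) ⊕ Fin (m + 1) → ℤ) : B :=
  algebraMap (CoxRing k n m) B (MvPolynomial.C c) *
    laurentMonomial (chartCoord k B) e

include hB in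
lemma isUnit_chartCoord_or (v : Fin (n + 1) ⊕ Fin (m + 1)) :
    IsUnit (chartCoord k B v) ∨ v ∈ gens n m r s :=
  isUnit_or_mem_gens (φ := algebraMap (CoxRing k n m) B)
    (IsLocalization.Away.algebraMap_isUnit (chartVar k n m r s)) v

include hB in
/-- The coordinate ring of a chart is spanned by Laurent monomials. -/
lemma chart_induction {P : B → Prop} (add : ∀ x y, P x → P y → P (x + y))
    (monomial : ∀ (c : k) e, (∀ v ∈ gens n m r s, 0 ≤ e v) → P (chartMonomial k B c e)) (b : B) :
    P b := by
  obtain ⟨N, p, hp⟩ := IsLocalization.Away.surj (chartVar k n m r s) b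
  -- The exponent of the denominator `(x_s y_r) ^ N`. It vanishes on `gens n m r s`, so dividing by
  -- it leaves the exponents there non-negative.
  let δ : Fin (n + 1) ⊕ Fin (m + 1) → ℤ := Pi.single (Sum.inl s) (N : ℤ) + Pi.single (Sum.inr r) N
  have hδ0 : ∀ v ∈ gens n m r s, δ v = 0 := by
    intro v hv
    have h₁ : v ≠ Sum.inl s := fun h => hv (Or.inl h)
    have h₂ : v ≠ Sum.inr r := fun h => hv (Or.inr h)
    simp [δ, h₁, h₂]
  have hu := isUnit_chartCoord_or (k := k) (B := B) r s
  have hδ : algebraMap (CoxRing k n m) B (chartVar k n m r s) ^ N =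
      laurentMonomial (chartCoord k B) δ := by
    rw [laurentMonomial_add, laurentMonomial_single, laurentMonomial_single, laurentPow_natCast,
      laurentPow_natCast, chartVar, map_mul, mul_pow]
    · rfl
    · exact fun v => Or.inr ⟨by simp only [Pi.single_apply]; split_ifs <;> positivity,
        by simp only [Pi.single_apply]; split_ifs <;> positivity⟩
  have hinv : laurentMonomial (chartCoord k B) δ * laurentMonomial (chartCoord k B) (-δ) = 1 := by
    rw [← laurentMonomial_add, add_neg_cancel, laurentMonomial_zero]
    exact fun v => (hu v).imp_right fun hv => by simp [hδ0 v hv]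
  have hb : b = algebraMap (CoxRing k n m) B p * laurentMonomial (chartCoord k B) (-δ) := by
    rw [← hp, hδ, mul_assoc, hinv, mul_one]
  rw [hb]
  clear hp hb
  induction p using MvPolynomial.induction_on' with
  | monomial e c =>
    have : algebraMap (CoxRing k n m) B (MvPolynomial.monomial e c) *
        laurentMonomial (chartCoord k B) (-δ) =
        chartMonomial k B c ((fun v => (e v : ℤ)) + -δ) := by
      rw [chartMonomial, laurentMonomial_add, laurentMonomial_natCast, MvPolynomial.monomial_eq,
        map_mul, Finsupp.prod_fintype _ _ (by simp), map_prod, mul_assoc]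
      · simp only [map_pow]
        rfl
      · exact fun v => (hu v).imp_right fun hv => by simp [hδ0 v hv]
    rw [this]
    exact monomial _ _ fun v hv => by simp [hδ0 v hv]
  | add p q hp hq =>
    rw [map_add, add_mul]
    exact add _ _ hp hq

variable (k a ω B) in
/-- The coaction on the coordinate ring of a chart. -/
noncomputable def chartAct : B →+* AddMonoidAlgebra B (Fin 2 → ℤ) :=
  IsLocalization.Away.lift (chartVar k n m r s)
    (isUnit_coaction_chartVar (a := a) (ω := ω) (φ := algebraMap (CoxRing k n m) B)
      (IsLocalization.Away.algebraMap_isUnit (chartVar k n m r s)))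

lemma chartAct_algebraMap (p) : chartAct k a ω B r s (algebraMap (CoxRing k n m) B p) =
    coaction a ω (algebraMap (CoxRing k n m) B) p := IsLocalization.Away.lift_eq _ _ _

variable (k a ω B) in
/-- The inclusion of the invariants into the coordinate ring of a chart. -/
noncomputable def chartInvariants : coneAlgebra k (sigma n a ω r s) →+* B :=
  coxHom (algebraMap (CoxRing k n m) B) (coxCompatible_sigma
    (IsLocalization.Away.algebraMap_isUnit (chartVar k n m r s)))

lemma chartInvariants_single (u : dualMonoid (sigma n a ω r s)) (c : k) :
    chartInvariants k a ω B r s (AddMonoidAlgebra.single u c) =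
      chartMonomial k B c (expo n a ω u.1) := by
  rw [chartInvariants, coxHom_single]
  rfl

lemma chartAct_chartMonomial (c : k) {e : Fin (n + 1) ⊕ Fin (m + 1) → ℤ}
    (he : ∀ v ∈ gens n m r s, 0 ≤ e v) :
    chartAct k a ω B r s (chartMonomial k B c e) =
      AddMonoidAlgebra.single (weightOf a ω e) (chartMonomial k B c e) := by
  have hu : ∀ v, IsUnit (chartCoord k B v) ∨ 0 ≤ e v := fun v =>
    (isUnit_chartCoord_or r s v).imp_right (he v)
  rw [chartMonomial, map_mul, chartAct_algebraMap, coaction_C, map_laurentMonomial _ hu]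
  have : (fun v => chartAct k a ω B r s (chartCoord k B v)) = fun v =>
      torusUnit (AddMonoidAlgebra.of B (Fin 2 → ℤ)) (fun l => weights n a ω l v) *
        (AddMonoidAlgebra.singleZeroRingHom (chartCoord k B v) :
          AddMonoidAlgebra B (Fin 2 → ℤ)) := by
    funext v
    rw [chartCoord, chartAct_algebraMap, coaction_X_eq_torusUnit]
  rw [this, laurentMonomial_units_mul _ fun v => (hu v).imp_left fun h => h.map _,
    prod_torusUnit, torusUnit_of, ← map_laurentMonomial _ hu]
  change AddMonoidAlgebra.single 0 _ * (_ * AddMonoidAlgebra.single 0 _) = _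
  rw [AddMonoidAlgebra.single_mul_single, AddMonoidAlgebra.single_mul_single]
  simp

lemma expo_injective : Function.Injective (expo n a ω) := by
  intro u w huw
  funext l
  rcases l with i | j
  · rw [← expo_inr_succ (ω := ω) u, huw, expo_inr_succ]
  · rw [← expo_inl_succ (a := a) (ω := ω) u, huw, expo_inl_succ]

variable (k n m) in
/-- The inclusion of the Cox ring into the ring of Laurent polynomials. -/
noncomputable def toLaurent :
    CoxRing k n m →+* AddMonoidAlgebra k (Fin (n + 1) ⊕ Fin (m + 1) → ℤ) :=
  MvPolynomial.eval₂Hom AddMonoidAlgebra.singleZeroRingHom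
    fun v => (characterUnit k v : AddMonoidAlgebra k (Fin (n + 1) ⊕ Fin (m + 1) → ℤ))

lemma toLaurent_X (v) : toLaurent k n m (MvPolynomial.X v) = characterUnit k v :=
  MvPolynomial.eval₂Hom_X' _ _ v

lemma toLaurent_C (c : k) : toLaurent k n m (MvPolynomial.C c) = AddMonoidAlgebra.single 0 c :=
  MvPolynomial.eval₂Hom_C _ _ c

lemma coxHom_toLaurent {τ : Cone (Fin m ⊕ Fin n)} (h : CoxCompatible a ω τ (toLaurent k n m))
    (x : coneAlgebra k τ) :
    coxHom (toLaurent k n m) h x = AddMonoidAlgebra.mapDomain (fun u => expo n a ω u.1) x := by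
  induction x using AddMonoidAlgebra.induction_linear with
  | zero => rw [map_zero, AddMonoidAlgebra.mapDomain_zero]
  | add x y hx hy => rw [map_add, hx, hy, AddMonoidAlgebra.mapDomain_add]
  | single u c =>
    rw [coxHom_single]
    simp only [toLaurent_X, toLaurent_C]
    rw [laurentMonomial_characterUnit, AddMonoidAlgebra.single_mul_single,
      AddMonoidAlgebra.mapDomain_single, zero_add, mul_one]

lemma coxHom_toLaurent_injective {τ : Cone (Fin m ⊕ Fin n)}
    (h : CoxCompatible a ω τ (toLaurent k n m)) :
    Function.Injective (coxHom (toLaurent k n m) h) := by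
  intro x y hxy
  rw [coxHom_toLaurent, coxHom_toLaurent] at hxy
  exact AddMonoidAlgebra.mapDomain_injective
    (fun u w huw => Subtype.ext (expo_injective huw)) hxy

/-- After restriction to the big torus, distinct characters go to distinct Laurent monomials, so the
composite is injective. -/
lemma chartInvariants_injective : Function.Injective (chartInvariants k a ω B r s) := by
  have hφ : IsUnit (toLaurent k n m (chartVar k n m r s)) := by
    rw [chartVar, map_mul, toLaurent_X, toLaurent_X]
    exact (Units.isUnit _).mul (Units.isUnit _)
  obtain ⟨f, hf⟩ : ∃ f : B →+* AddMonoidAlgebra k (Fin (n + 1) ⊕ Fin (m + 1) → ℤ),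
      f.comp (algebraMap (CoxRing k n m) B) = toLaurent k n m :=
    ⟨IsLocalization.Away.lift (chartVar k n m r s) hφ, IsLocalization.Away.lift_comp _ hφ⟩
  have h : f.comp (chartInvariants k a ω B r s) =
      coxHom (toLaurent k n m) (coxCompatible_sigma hφ) := by
    rw [chartInvariants, comp_coxHom]
    exact coxHom_congr hf _ _
  have hinj : Function.Injective (f.comp (chartInvariants k a ω B r s)) := by
    rw [h]
    exact coxHom_toLaurent_injective _
  rw [RingHom.coe_comp] at hinj
  exact hinj.of_comp

lemma chartAct_comp_chartInvariants (ha0 : a 0 = 1) :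
    (chartAct k a ω B r s).comp (chartInvariants k a ω B r s) =
      (AddMonoidAlgebra.singleZeroRingHom : B →+* AddMonoidAlgebra B (Fin 2 → ℤ)).comp
        (chartInvariants k a ω B r s) := by
  rw [chartInvariants, comp_coxHom, comp_coxHom]
  symm
  apply coxHom_eq_of_torus ha0 (AddMonoidAlgebra.of B (Fin 2 → ℤ))
  · intro c
    rw [RingHom.comp_apply, RingHom.comp_apply, chartAct_algebraMap, coaction_C]
    rfl
  · intro v
    rw [RingHom.comp_apply, RingHom.comp_apply, chartAct_algebraMap, coaction_X_eq_torusUnit]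

lemma isGradedChart (ha0 : a 0 = 1) (hpos : ∀ i, 0 < a i) :
    IsGradedChart (chartInvariants k a ω B r s) (chartAct k a ω B r s) where
  injective := chartInvariants_injective r s
  act_apply x := by
    have h := congrArg (fun f => f x)
      (chartAct_comp_chartInvariants (k := k) (ω := ω) (B := B) r s ha0)
    rw [RingHom.comp_apply, RingHom.comp_apply] at h
    exact h
  coeff_zero_mem b := by
    refine chart_induction (k := k) r s
      (P := fun b => (chartAct k a ω B r s b).coeff 0 ∈ (chartInvariants k a ω B r s).range)
      (fun x y hx hy => ?_) (fun c e he => ?_) b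
    · rw [map_add, AddMonoidAlgebra.coeff_add, Finsupp.add_apply]
      exact add_mem hx hy
    · rw [chartAct_chartMonomial r s c he, AddMonoidAlgebra.coeff_single, Finsupp.single_apply]
      split_ifs with h
      -- A monomial of weight zero comes from a character `u`, and the sign conditions on its
      -- exponents say precisely that `u` lies in the dual of `σ_{rs}`.
      · obtain ⟨u, rfl⟩ := exists_expo_eq_of_weightOf_eq_zero ha0 h
        exact ⟨AddMonoidAlgebra.single ⟨u, mem_dualMonoid_sigma.2 he⟩ c,
          chartInvariants_single r s _ c⟩
      · exact zero_mem _
  act_coeff b χ := by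
    refine chart_induction (k := k) r s
      (P := fun b => chartAct k a ω B r s ((chartAct k a ω B r s b).coeff χ) =
        AddMonoidAlgebra.single χ ((chartAct k a ω B r s b).coeff χ))
      (fun x y hx hy => ?_) (fun c e he => ?_) b
    · rw [map_add, AddMonoidAlgebra.coeff_add, Finsupp.add_apply, map_add, hx, hy,
        AddMonoidAlgebra.single_add]
    · rw [chartAct_chartMonomial r s c he, AddMonoidAlgebra.coeff_single, Finsupp.single_apply]
      split_ifs with h
      · rw [chartAct_chartMonomial r s c he, h]
      · simp
  sum_coeff b := by
    refine chart_induction (k := k) r s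
      (P := fun b => ((chartAct k a ω B r s b).coeff.sum fun _ c => c) = b)
      (fun x y hx hy => ?_) (fun c e he => ?_) b
    · rw [map_add, AddMonoidAlgebra.coeff_add, Finsupp.sum_add_index' (by simp) (by simp), hx, hy]
    · rw [chartAct_chartMonomial r s c he, AddMonoidAlgebra.coeff_single,
        Finsupp.sum_single_index rfl]
  exists_unit χ := by
    -- A monomial in the invertible variables `x_s`, `y_r`, of weights `(1, 0)` and `(-ω_r, a_r)`.
    -- Solving for weight `-N χ` requires `a_r ∣ N χ 1`, hence the choice `N = a r`.
    let e : Fin (n + 1) ⊕ Fin (m + 1) → ℤ :=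
      Pi.single (Sum.inl s) (-(a r * χ 0) - ω r * χ 1) + Pi.single (Sum.inr r) (-χ 1)
    have he : ∀ v ∈ gens n m r s, e v = 0 := by
      intro v hv
      have h₁ : v ≠ Sum.inl s := fun h => hv (Or.inl h)
      have h₂ : v ≠ Sum.inr r := fun h => hv (Or.inr h)
      simp [e, h₁, h₂]
    have hw : weightOf a ω e = -(a r • χ) := by
      ext l
      fin_cases l
      · refine (weightOf_zero_apply _).trans ?_
        simp [e, Pi.single_apply]
      · refine (weightOf_one_apply _).trans ?_
        simp [e, Pi.single_apply]
    have h1 : chartMonomial k B 1 e = laurentMonomial (chartCoord k B) e := by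
      rw [chartMonomial, map_one, map_one, one_mul]
    have hinv : laurentMonomial (chartCoord k B) e * laurentMonomial (chartCoord k B) (-e) = 1 := by
      rw [← laurentMonomial_add, add_neg_cancel, laurentMonomial_zero]
      exact fun v => (isUnit_chartCoord_or r s v).imp_right fun hv => by simp [he v hv]
    refine ⟨a r, (hpos r).ne', Units.mkOfMulEqOne _ _ hinv, ?_⟩
    rw [Units.val_mkOfMulEqOne, ← h1, chartAct_chartMonomial r s 1 fun v hv => (he v hv).ge, hw]

end Chart

end WeightedBundle

/-! ### Geometric fibres are torus orbits. -/

namespace WeightedBundle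

/-- `Θ` factors through the image of `W` in `L`, and injectivity of `Q` extends it to all of `L`. It
is applied to lift ratios of coordinates to a torus element. -/
lemma exists_comp_eq_of_ker_le {H L Q : Type*} [AddCommGroup H] [AddCommGroup L] [AddCommGroup Q]
    (hQ : Module.Baer ℤ Q) (W : H →+ L) (Θ : H →+ Q) (h : W.ker ≤ Θ.ker) :
    ∃ T : L →+ Q, T.comp W = Θ := by
  obtain ⟨T, hT⟩ := hQ.extension_property_addMonoidHom (QuotientAddGroup.kerLift W)
    (QuotientAddGroup.kerLift_injective W) (QuotientAddGroup.lift W.ker Θ h)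
  refine ⟨T, AddMonoidHom.ext fun x => ?_⟩
  exact DFunLike.congr_fun hT (x : H ⧸ W.ker)

/-- Roots exist in `K`, so `Kˣ` is divisible, hence injective as an abelian group. -/
lemma baer_additive_units (K : Type*) [Field K] [IsAlgClosed K] :
    Module.Baer ℤ (Additive Kˣ) := by
  let _ : DivisibleBy (Additive Kˣ) ℕ := divisibleByOfSMulRightSurj _ _ fun {N} hN x => by
    have : NeZero N := ⟨hN⟩
    obtain ⟨y, hy⟩ := IsAlgClosed.exists_pow_nat_eq (x.toMul : K) (Nat.pos_of_ne_zero hN)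
    have hy0 : y ≠ 0 := by
      rintro rfl
      rw [zero_pow hN] at hy
      exact x.toMul.ne_zero hy.symm
    refine ⟨Additive.ofMul (Units.mk0 y hy0), ?_⟩
    apply Additive.toMul.injective
    apply Units.ext
    simpa using hy
  let _ : DivisibleBy (Additive Kˣ) ℤ := AddGroup.divisibleByIntOfDivisibleByNat _
  exact Module.Baer.of_divisible _

lemma laurentPow_ne_zero_iff {K : Type*} [Field K] {c : K} {z : ℤ} (h : IsUnit c ∨ 0 ≤ z) :
    laurentPow c z ≠ 0 ↔ c ≠ 0 ∨ z = 0 := by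
  by_cases hc : c = 0
  · subst hc
    have hz : 0 ≤ z := h.resolve_left not_isUnit_zero
    lift z to ℕ using hz
    rw [laurentPow_natCast]
    simp
  · obtain ⟨u, rfl⟩ : IsUnit c := isUnit_iff_ne_zero.2 hc
    rw [laurentPow_unit]
    exact iff_of_true (Units.ne_zero _) (Or.inl hc)

lemma laurentMonomial_ne_zero_iff {K ν : Type*} [Field K] [Fintype ν] {c : ν → K} {e : ν → ℤ}
    (h : ∀ v, IsUnit (c v) ∨ 0 ≤ e v) :
    laurentMonomial c e ≠ 0 ↔ ∀ v, c v ≠ 0 ∨ e v = 0 := by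
  rw [laurentMonomial, Finset.prod_ne_zero_iff]
  exact ⟨fun H v => (laurentPow_ne_zero_iff (h v)).1 (H v (Finset.mem_univ v)),
    fun H v _ => (laurentPow_ne_zero_iff (h v)).2 (H v)⟩

section Orbit

variable {k : Type*} [Field k] {n m : ℕ} {a ω : Fin (m + 1) → ℕ}
  {K : Type*} [Field K] {r : Fin (m + 1)} {s : Fin (n + 1)} {φ φ' : CoxRing k n m →+* K}

lemma exists_expo_pos_mul (ha0 : a 0 = 1) (hpos : ∀ i, 0 < a i) (r : Fin (m + 1))
    (s : Fin (n + 1)) (f : Fin (n + 1) ⊕ Fin (m + 1) → ℤ) :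
    ∃ u, ∀ v ∈ gens n m r s, ∃ c : ℤ, 0 < c ∧ expo n a ω u v = c * f v := by
  obtain ⟨u, hu, hu'⟩ := exists_expo_prescribed (n := n) (ω := ω) ha0 r s f
  refine ⟨u, ?_⟩
  rintro (j | i) hv
  · exact ⟨1, one_pos, by rw [hu j (by rintro rfl; simp [gens] at hv), one_mul]⟩
  · exact ⟨a r, by exact_mod_cast hpos r, hu' i (by rintro rfl; simp [gens] at hv)⟩

lemma laurentMonomial_eq_of_coxHom_eq {τ : Cone (Fin m ⊕ Fin n)} (h : CoxCompatible a ω τ φ)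
    (h' : CoxCompatible a ω τ φ') (e : coxHom φ h = coxHom φ' h')
    {u : Fin m ⊕ Fin n → ℤ} (hu : u ∈ dualMonoid τ) :
    laurentMonomial (fun v => φ (MvPolynomial.X v)) (expo n a ω u) =
      laurentMonomial (fun v => φ' (MvPolynomial.X v)) (expo n a ω u) := by
  have := DFunLike.congr_fun e (AddMonoidAlgebra.single ⟨u, hu⟩ 1)
  simpa only [coxHom_single, map_one, one_mul] using this

lemma eq_zero_iff_of_coxHom_eq (ha0 : a 0 = 1) (hpos : ∀ i, 0 < a i)
    (h : CoxCompatible a ω (sigma n a ω r s) φ) (h' : CoxCompatible a ω (sigma n a ω r s) φ')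
    (hφ : IsUnit (φ (chartVar k n m r s))) (hφ' : IsUnit (φ' (chartVar k n m r s)))
    (e : coxHom φ h = coxHom φ' h') (v) :
    φ (MvPolynomial.X v) = 0 ↔ φ' (MvPolynomial.X v) = 0 := by
  classical
  by_cases hv : v ∈ gens n m r s
  swap
  · have h₁ := ((isUnit_or_mem_gens hφ v).resolve_right hv).ne_zero
    have h₂ := ((isUnit_or_mem_gens hφ' v).resolve_right hv).ne_zero
    simp [h₁, h₂]
  -- Among the generators of `σ_{rs}`, this character is positive on the ray `v` and zero on the
  -- others. Its monomial therefore vanishes exactly where the variable `v` does.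
  obtain ⟨u, hu⟩ := exists_expo_pos_mul (n := n) (ω := ω) ha0 hpos r s (Pi.single v 1)
  have hmem : u ∈ dualMonoid (sigma n a ω r s) := mem_dualMonoid_sigma.2 fun w hw => by
    obtain ⟨c, hc, hcw⟩ := hu w hw
    rw [hcw, Pi.single_apply]
    split_ifs <;> simp [hc.le]
  have key : ∀ ψ : CoxRing k n m →+* K, CoxCompatible a ω (sigma n a ω r s) ψ →
      IsUnit (ψ (chartVar k n m r s)) →
      (laurentMonomial (fun v => ψ (MvPolynomial.X v)) (expo n a ω u) ≠ 0 ↔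
        ψ (MvPolynomial.X v) ≠ 0) := by
    intro ψ hψ hψ'
    rw [laurentMonomial_ne_zero_iff (hψ.expo hmem)]
    constructor
    · intro H
      refine (H v).resolve_right ?_
      obtain ⟨c, hc, hcv⟩ := hu v hv
      rw [hcv, Pi.single_eq_same, mul_one]
      exact hc.ne'
    · intro H w
      by_cases hwv : w = v
      · exact Or.inl (hwv ▸ H)
      rcases isUnit_or_mem_gens hψ' w with hw | hw
      · exact Or.inl hw.ne_zero
      · obtain ⟨c, hc, hcw⟩ := hu w hw
        exact Or.inr (by rw [hcw, Pi.single_eq_of_ne hwv, mul_zero])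
  have h₁ := key φ h hφ
  have h₂ := key φ' h' hφ'
  rw [laurentMonomial_eq_of_coxHom_eq h h' e hmem, h₂] at h₁
  exact not_iff_not.1 h₁.symm

/-- The geometric points in a fibre of the quotient map form one orbit. -/
lemma exists_torus_of_coxHom_eq [IsAlgClosed K] (ha0 : a 0 = 1) (hpos : ∀ i, 0 < a i)
    (h : CoxCompatible a ω (sigma n a ω r s) φ) (h' : CoxCompatible a ω (sigma n a ω r s) φ')
    (hφ : IsUnit (φ (chartVar k n m r s))) (hφ' : IsUnit (φ' (chartVar k n m r s)))
    (e : coxHom φ h = coxHom φ' h') :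
    ∃ ψ : TorusTimesAffine k 2 (Fin (n + 1) ⊕ Fin (m + 1)) →+* K,
      ψ.comp (prHom k 2 _) = φ ∧ ψ.comp (actHom k (weights n a ω)).toRingHom = φ' := by
  classical
  have hzero := eq_zero_iff_of_coxHom_eq ha0 hpos h h' hφ hφ' e
  let θ : Fin (n + 1) ⊕ Fin (m + 1) → Kˣ := fun v =>
    if hv : φ (MvPolynomial.X v) = 0 then 1 else
      Units.mk0 (φ' (MvPolynomial.X v) / φ (MvPolynomial.X v))
        (div_ne_zero (fun hv' => hv ((hzero v).2 hv')) hv)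
  have hθ : ∀ v, φ' (MvPolynomial.X v) = θ v * φ (MvPolynomial.X v) := by
    intro v
    by_cases hv : φ (MvPolynomial.X v) = 0
    · rw [hv, (hzero v).1 hv, mul_zero]
    · simp only [θ, dif_neg hv, Units.val_mk0]
      rw [div_mul_cancel₀ _ hv]
  -- Only the non-vanishing coordinates constrain the torus element, so the ratio has to be matched
  -- only on exponents supported there.
  let H : AddSubgroup (Fin (n + 1) ⊕ Fin (m + 1) → ℤ) :=
    { carrier := {e | ∀ v, φ (MvPolynomial.X v) = 0 → e v = 0}
      zero_mem' := fun _ _ => rfl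
      add_mem' := fun {e f} he hf v hv => by
        rw [Pi.add_apply, he v hv, hf v hv, add_zero]
      neg_mem' := fun {e} he v hv => by rw [Pi.neg_apply, he v hv, neg_zero] }
  let Θ : (Fin (n + 1) ⊕ Fin (m + 1) → ℤ) →+ Additive Kˣ :=
    ∑ v, (zmultiplesHom (Additive Kˣ) (Additive.ofMul (θ v))).comp
      (Pi.evalAddMonoidHom (fun _ => ℤ) v)
  have hΘ : ∀ e, Θ e = Additive.ofMul (∏ v, θ v ^ e v) := by
    intro e
    simp [Θ, AddMonoidHom.finsetSum_apply, ofMul_prod]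
  let W : (Fin (n + 1) ⊕ Fin (m + 1) → ℤ) →+ (Fin 2 → ℤ) :=
    ∑ v, (zmultiplesHom (Fin 2 → ℤ) (fun l => weights n a ω l v)).comp
      (Pi.evalAddMonoidHom (fun _ => ℤ) v)
  have hW : ∀ e, W e = weightOf a ω e := by
    intro e
    simp [W, AddMonoidHom.finsetSum_apply, weightOf]
  have hsupp : ∀ u ∈ dualMonoid (sigma n a ω r s), expo n a ω u ∈ H → Θ (expo n a ω u) = 0 := by
    intro u hu huH
    have h₁ := laurentMonomial_eq_of_coxHom_eq h h' e hu
    simp only [hθ] at h₁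
    rw [laurentMonomial_units_mul _ (h.expo hu)] at h₁
    have h₂ := (laurentMonomial_ne_zero_iff (h.expo hu)).2 fun v => by
      by_cases hv : φ (MvPolynomial.X v) = 0
      · exact Or.inr (huH v hv)
      · exact Or.inl hv
    have h₃ : ((∏ v, θ v ^ expo n a ω u v : Kˣ) : K) = 1 :=
      mul_right_cancel₀ h₂ (h₁.symm.trans (one_mul _).symm)
    rw [hΘ, Units.ext (h₃.trans Units.val_one.symm)]
    rfl
  -- A weight-zero exponent in `H` comes from a character `w` that may lie outside the dual cone,
  -- where the hypothesis says nothing. Adding a large multiple of a dual character `u`, zero on the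
  -- vanishing coordinates and positive on the other generators, moves it into the dual cone; `Θ`
  -- kills both `w + N • u` and `u`, hence `w`.
  have hker : (W.comp H.subtype).ker ≤ (Θ.comp H.subtype).ker := by
    rintro ⟨x, hx⟩ hxW
    obtain ⟨w, rfl⟩ := exists_expo_eq_of_weightOf_eq_zero (ω := ω) ha0
      ((hW x).symm.trans (AddMonoidHom.mem_ker.1 hxW))
    obtain ⟨u, hu⟩ := exists_expo_pos_mul (n := n) (ω := ω) ha0 hpos r s
      (fun v => if φ (MvPolynomial.X v) = 0 then 0 else 1)
    have huH : expo n a ω u ∈ H := by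
      intro v hv
      have hvg := (isUnit_or_mem_gens hφ v).resolve_left (by rw [hv]; exact not_isUnit_zero)
      obtain ⟨c, -, hc⟩ := hu v hvg
      rw [hc, if_pos hv, mul_zero]
    have hmem : u ∈ dualMonoid (sigma n a ω r s) := mem_dualMonoid_sigma.2 fun v hv => by
      obtain ⟨c, hc, hcv⟩ := hu v hv
      rw [hcv]
      split_ifs <;> simp [hc.le]
    let N : ℕ := (∑ v, |expo n a ω w v|).toNat
    have hN : ∀ v, -(N : ℤ) ≤ expo n a ω w v := by
      intro v
      have h₁ : |expo n a ω w v| ≤ ∑ v, |expo n a ω w v| :=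
        Finset.single_le_sum (f := fun v => |expo n a ω w v|) (fun _ _ => abs_nonneg _)
          (Finset.mem_univ v)
      have h₂ := neg_abs_le (expo n a ω w v)
      have h₃ := Int.self_le_toNat (∑ v, |expo n a ω w v|)
      omega
    have hsum : expo n a ω (w + N • u) = expo n a ω w + N • expo n a ω u := by
      ext v
      rw [expo_add, Pi.add_apply]
      congr 1
      simp [expo, Finset.mul_sum, mul_add, mul_assoc]
    have hmem' : w + N • u ∈ dualMonoid (sigma n a ω r s) := mem_dualMonoid_sigma.2 fun v hv => by
      rw [hsum, Pi.add_apply, Pi.smul_apply, nsmul_eq_mul]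
      obtain ⟨c, hc, hcv⟩ := hu v hv
      by_cases hv0 : φ (MvPolynomial.X v) = 0
      · rw [hcv, if_pos hv0, hx v hv0]
        simp
      · rw [hcv, if_neg hv0, mul_one]
        have := hN v
        nlinarith [(Nat.cast_nonneg N : (0 : ℤ) ≤ N)]
    have h₁ := hsupp _ hmem' (by rw [hsum]; exact add_mem hx (nsmul_mem huH N))
    rw [hsum, map_add, map_nsmul, hsupp u hmem huH, smul_zero, add_zero] at h₁
    exact h₁
  obtain ⟨T, hT⟩ := exists_comp_eq_of_ker_le (baer_additive_units K) _ _ hker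
  have hTX : ∀ v, φ (MvPolynomial.X v) ≠ 0 →
      T (fun l => weights n a ω l v) = Additive.ofMul (θ v) := by
    intro v hv
    have hvH : Pi.single v (1 : ℤ) ∈ H := by
      intro w hw
      exact Pi.single_eq_of_ne (by rintro rfl; exact hv hw) _
    have h₁ : T (W (Pi.single v 1)) = Θ (Pi.single v 1) :=
      DFunLike.congr_fun hT ⟨Pi.single v 1, hvH⟩
    rw [hW, hΘ] at h₁
    have h₂ : weightOf a ω (Pi.single v 1) = fun l => weights n a ω l v := by
      rw [weightOf, Finset.sum_eq_single v]
      · simp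
      · intro w _ hw
        rw [Pi.single_eq_of_ne hw, zero_smul]
      · simp
    have h₃ : ∏ w, θ w ^ (Pi.single v (1 : ℤ) : Fin (n + 1) ⊕ Fin (m + 1) → ℤ) w = θ v := by
      rw [Finset.prod_eq_single v]
      · simp
      · intro w _ hw
        rw [Pi.single_eq_of_ne hw, zpow_zero]
      · simp
    rw [h₂, h₃] at h₁
    exact h₁
  let ψ : TorusTimesAffine k 2 (Fin (n + 1) ⊕ Fin (m + 1)) →+* K :=
    AddMonoidAlgebra.liftNCRingHom φ ((Units.coeHom K).comp T.toMultiplicativeLeft)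
      fun _ _ => mul_comm _ _
  have hψ : ∀ χ p, ψ (AddMonoidAlgebra.single χ p) = φ p * ((T χ).toMul : Kˣ) := fun χ p =>
    AddMonoidAlgebra.liftNCRingHom_single _ _ _ _ _
  refine ⟨ψ, RingHom.ext fun p => ?_, MvPolynomial.ringHom_ext (fun c => ?_) fun v => ?_⟩
  · refine (hψ 0 p).trans ?_
    rw [map_zero, toMul_zero, Units.val_one, mul_one]
  · have h₁ := DFunLike.congr_fun (coxHom_comp_algebraMap φ h) c
    rw [e, coxHom_comp_algebraMap] at h₁
    have h₂ : actHom k (weights n a ω) (MvPolynomial.C c) =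
        AddMonoidAlgebra.single 0 (MvPolynomial.C c) := by
      rw [actHom, MvPolynomial.aeval_C]
      rfl
    refine (congrArg ψ h₂).trans ((hψ _ _).trans ?_)
    rw [map_zero, toMul_zero, Units.val_one, mul_one]
    exact h₁.symm
  · have h₂ : actHom k (weights n a ω) (MvPolynomial.X v) =
        AddMonoidAlgebra.single (fun l => weights n a ω l v) (MvPolynomial.X v) := by
      rw [actHom, MvPolynomial.aeval_X]
    refine (congrArg ψ h₂).trans ((hψ _ _).trans ?_)
    rw [hθ v]
    by_cases hv : φ (MvPolynomial.X v) = 0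
    · rw [hv, zero_mul, mul_zero]
    · rw [hTX v hv, toMul_ofMul, mul_comm]

end Orbit

end WeightedBundle

/-! ### Charts of `T(Σ)` and its points in Cox coordinates. -/

namespace WeightedBundle

/-- Morphisms of schemes agree if they agree on points with values in rings. -/
lemma hom_ext_of_Spec {P Y : Scheme.{u}} {f g : P ⟶ Y}
    (h : ∀ (C : Type u) [CommRing C] (x : Spec (.of C) ⟶ P), x ≫ f = x ≫ g) : f = g :=
  Scheme.Cover.hom_ext P.affineCover _ _ fun i => h _ (P.affineCover.f i)

lemma hom_ext_of_span {C : Type u} [CommRing C] {Y : Scheme.{u}} {f g : Spec (.of C) ⟶ Y}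
    {ι : Type*} (c : ι → C) (hc : Ideal.span (Set.range c) = ⊤)
    (h : ∀ i, Spec.map (CommRingCat.ofHom (algebraMap C (Localization.Away (c i)))) ≫ f =
      Spec.map (CommRingCat.ofHom (algebraMap C (Localization.Away (c i)))) ≫ g) : f = g :=
  Scheme.Cover.hom_ext (Scheme.affineOpenCoverOfSpanRangeEqTop (R := .of C) c hc).openCover _ _ h

lemma exists_ringHom {A C : Type u} [CommRing A] [CommRing C] (x : Spec (.of C) ⟶ Spec (.of A)) :
    ∃ φ : A →+* C, x = Spec.map (CommRingCat.ofHom φ) :=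
  ⟨(Spec.preimage x).hom, (Spec.map_preimage x).symm⟩

lemma SpecMap_ofHom_injective {A C : Type u} [CommRing A] [CommRing C] {φ ψ : A →+* C}
    (h : Spec.map (CommRingCat.ofHom φ) = Spec.map (CommRingCat.ofHom ψ)) : φ = ψ :=
  congrArg CommRingCat.Hom.hom (Spec.map_injective h)

lemma SpecMap_ofHom_comp {A B C : Type u} [CommRing A] [CommRing B] [CommRing C] (φ : A →+* B)
    (ψ : B →+* C) : Spec.map (CommRingCat.ofHom (ψ.comp φ)) =
      Spec.map (CommRingCat.ofHom ψ) ≫ Spec.map (CommRingCat.ofHom φ) := by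
  rw [CommRingCat.ofHom_comp, Spec.map_comp]

section ToricCharts

variable {k : Type u} [Field k] {ι : Type} [Fintype ι] {F : Set (Cone ι)}

variable (k) in
/-- The inclusion of the affine chart `U_σ` into `T(Σ)`. -/
noncomputable def toricChart (hF : IsFan F) {σ : Cone ι} (hσ : σ ∈ F) :
    Spec (.of (coneAlgebra k σ)) ⟶ (toricVariety k hF).left :=
  haveI := hF.hasColimit k
  colimit.ι (toricDiagram k F) ⟨σ, hσ⟩

lemma isOpenImmersion_toricChart (hF : IsFan F) {σ : Cone ι} (hσ : σ ∈ F) :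
    IsOpenImmersion (toricChart k hF hσ) := by
  have : ∀ {i j : F} (f : i ⟶ j), IsOpenImmersion ((toricDiagram k F).map f) :=
    fun f => hF.isOpenImmersion k f
  have := hF.isLocallyDirected k
  exact inferInstanceAs (IsOpenImmersion (colimit.ι (toricDiagram k F) ⟨σ, hσ⟩))

lemma SpecMap_coneAlgebraMap_toricChart (hF : IsFan F) {τ σ : Cone ι} (hτ : τ ∈ F) (hσ : σ ∈ F)
    (h : τ ≤ σ) :
    Spec.map (CommRingCat.ofHom (coneAlgebraMap k h).toRingHom) ≫ toricChart k hF hσ =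
      toricChart k hF hτ :=
  haveI := hF.hasColimit k
  colimit.w (toricDiagram k F) (homOfLE h : (⟨τ, hτ⟩ : F) ⟶ ⟨σ, hσ⟩)

lemma toricChart_hom (hF : IsFan F) {σ : Cone ι} (hσ : σ ∈ F) :
    toricChart k hF hσ ≫ (toricVariety k hF).hom =
      Spec.map (CommRingCat.ofHom (algebraMap k (coneAlgebra k σ))) :=
  haveI := hF.hasColimit k
  colimit.ι_desc (toricCocone k F) ⟨σ, hσ⟩

lemma exists_toricChart_eq (hF : IsFan F) (y : (toricVariety k hF).left) :
    ∃ (σ : Cone ι) (hσ : σ ∈ F) (z : Spec (.of (coneAlgebra k σ))), toricChart k hF hσ z = y := by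
  have : ∀ {i j : F} (f : i ⟶ j), IsOpenImmersion ((toricDiagram k F).map f) :=
    fun f => hF.isOpenImmersion k f
  have := hF.isLocallyDirected k
  obtain ⟨⟨σ, hσ⟩, z, hz⟩ := Scheme.IsLocallyDirected.ι_jointly_surjective (toricDiagram k F) y
  exact ⟨σ, hσ, z, hz⟩

/-- The intersection of two affine charts is the chart of the common face. -/
lemma notMem_of_toricChart_eq (hF : IsFan F) {σ σ' : Cone ι} (hσ : σ ∈ F) (hσ' : σ' ∈ F)
    {z : Spec (.of (coneAlgebra k σ))} {z' : Spec (.of (coneAlgebra k σ'))}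
    (h : toricChart k hF hσ z = toricChart k hF hσ' z') {u : ι → ℤ} (hu : u ∈ dualMonoid σ)
    (hface : ∀ v, v ∈ σ ⊓ σ' ↔ v ∈ σ ∧ pairing u v = 0) :
    AddMonoidAlgebra.single (⟨u, hu⟩ : dualMonoid σ) (1 : k) ∉ PrimeSpectrum.asIdeal z := by
  have : ∀ {i j : F} (f : i ⟶ j), IsOpenImmersion ((toricDiagram k F).map f) :=
    fun f => hF.isOpenImmersion k f
  have := hF.isLocallyDirected k
  -- Points of two charts are identified only through a chart `U_τ` with `τ ⊆ σ ∩ σ'`. There `u`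
  -- vanishes on `τ`, so `χ^u` is invertible.
  obtain ⟨τ, f, g, t, rfl, -⟩ := (Scheme.IsLocallyDirected.ι_eq_ι_iff (toricDiagram k F)
    (i := ⟨σ, hσ⟩) (j := ⟨σ', hσ'⟩) (xi := z) (xj := z')).1 h
  have hle : τ.1 ≤ σ ⊓ σ' := le_inf (leOfHom f) (leOfHom g)
  have hunit : IsUnit (coneAlgebraMap k (leOfHom f)
      (AddMonoidAlgebra.single (⟨u, hu⟩ : dualMonoid σ) (1 : k))) := by
    rw [coneAlgebraMap_single]
    have hnu : -u ∈ dualMonoid τ.1 := fun v hv => by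
      rw [pairing_neg, ((hface v).1 (hle hv)).2, neg_zero]
    refine IsUnit.of_mul_eq_one (AddMonoidAlgebra.single (⟨-u, hnu⟩ : dualMonoid τ.1) (1 : k)) ?_
    rw [AddMonoidAlgebra.single_mul_single, one_mul, AddMonoidAlgebra.one_def]
    congr 1
    exact Subtype.ext (add_neg_cancel u)
  exact fun hmem => (PrimeSpectrum.isPrime t).ne_top (Ideal.eq_top_of_isUnit_mem _ hmem hunit)

end ToricCharts

section CoxPoints

variable {k : Type u} [Field k] {n m : ℕ} {a ω : Fin (m + 1) → ℕ}
  {C D : Type u} [CommRing C] [CommRing D]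

lemma sigma_mem_bundleFan (r : Fin (m + 1)) (s : Fin (n + 1)) :
    sigma n a ω r s ∈ bundleFan n a ω :=
  ⟨r, s, 0, zero_mem _, fun v => by simp [pairing]⟩

/-- The point of `T(Σ)` with Cox coordinates `φ`. -/
noncomputable def coxPoint (hF : IsFan (bundleFan n a ω)) (φ : CoxRing k n m →+* C)
    (r : Fin (m + 1)) (s : Fin (n + 1)) (h : IsUnit (φ (chartVar k n m r s))) :
    Spec (.of C) ⟶ (toricVariety k hF).left :=
  Spec.map (CommRingCat.ofHom (coxHom φ (coxCompatible_sigma h))) ≫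
    toricChart k hF (sigma_mem_bundleFan r s)

lemma coxPoint_congr (hF : IsFan (bundleFan n a ω)) {φ ψ : CoxRing k n m →+* C} (e : φ = ψ)
    {r s} (h : IsUnit (φ (chartVar k n m r s))) (h' : IsUnit (ψ (chartVar k n m r s))) :
    coxPoint hF φ r s h = coxPoint hF ψ r s h' := by
  subst e
  rfl

lemma coxPoint_eq_of_compatible (hF : IsFan (bundleFan n a ω)) {φ : CoxRing k n m →+* C} {r s}
    (h : IsUnit (φ (chartVar k n m r s))) {τ : Cone (Fin m ⊕ Fin n)} (hτ : τ ∈ bundleFan n a ω)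
    (hφ : CoxCompatible a ω τ φ) (hle : τ ≤ sigma n a ω r s) :
    coxPoint hF φ r s h = Spec.map (CommRingCat.ofHom (coxHom φ hφ)) ≫ toricChart k hF hτ := by
  rw [coxPoint, ← SpecMap_coneAlgebraMap_toricChart hF hτ (sigma_mem_bundleFan r s) hle,
    ← Category.assoc, ← SpecMap_ofHom_comp, coxHom_comp_coneAlgebraMap]

/-- Both points factor through the chart of `σ_{rs} ∩ σ_{r's'}`: a variable that is not a unit has
its ray in both cones. -/
lemma coxPoint_eq (hF : IsFan (bundleFan n a ω)) {φ : CoxRing k n m →+* C} {r s r' s'}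
    (h : IsUnit (φ (chartVar k n m r s))) (h' : IsUnit (φ (chartVar k n m r' s'))) :
    coxPoint hF φ r s h = coxPoint hF φ r' s' h' := by
  have hτ : sigma n a ω r s ⊓ sigma n a ω r' s' ∈ bundleFan n a ω :=
    hF.face_mem _ (sigma_mem_bundleFan r s) _
      (hF.inter_face _ (sigma_mem_bundleFan r s) _ (sigma_mem_bundleFan r' s')).1
  have hφ : CoxCompatible a ω (sigma n a ω r s ⊓ sigma n a ω r' s') φ := fun v => by
    rcases coxCompatible_sigma (a := a) (ω := ω) h v with hv | hv
    · exact Or.inl hv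
    · exact (coxCompatible_sigma (a := a) (ω := ω) h' v).imp_right fun hv' => ⟨hv, hv'⟩
  rw [coxPoint_eq_of_compatible hF h hτ hφ inf_le_left,
    coxPoint_eq_of_compatible hF h' hτ hφ inf_le_right]

lemma SpecMap_coxPoint (hF : IsFan (bundleFan n a ω)) (φ : CoxRing k n m →+* C) (f : C →+* D)
    {r s} (h : IsUnit (φ (chartVar k n m r s))) :
    Spec.map (CommRingCat.ofHom f) ≫ coxPoint hF φ r s h =
      coxPoint hF (f.comp φ) r s (h.map f) := by
  rw [coxPoint, ← Category.assoc, ← SpecMap_ofHom_comp, comp_coxHom]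
  rfl

lemma coxPoint_hom (hF : IsFan (bundleFan n a ω)) (φ : CoxRing k n m →+* C) {r s}
    (h : IsUnit (φ (chartVar k n m r s))) :
    coxPoint hF φ r s h ≫ (toricVariety k hF).hom =
      Spec.map (CommRingCat.ofHom (φ.comp MvPolynomial.C)) := by
  rw [coxPoint, Category.assoc, toricChart_hom, ← SpecMap_ofHom_comp, coxHom_comp_algebraMap]

lemma coxHom_eq_of_coxPoint_eq (hF : IsFan (bundleFan n a ω)) {φ ψ : CoxRing k n m →+* C} {r s}
    (h : IsUnit (φ (chartVar k n m r s))) (h' : IsUnit (ψ (chartVar k n m r s)))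
    (e : coxPoint hF φ r s h = coxPoint hF ψ r s h') :
    coxHom (a := a) (ω := ω) φ (coxCompatible_sigma h) = coxHom ψ (coxCompatible_sigma h') := by
  have := isOpenImmersion_toricChart (k := k) hF (sigma_mem_bundleFan r s)
  exact SpecMap_ofHom_injective ((cancel_mono _).1 e)

/-- A point with values in a field whose image lies in a chart has coordinates in the
corresponding chart of the Cox space. -/
lemma ne_zero_of_coxPoint_mem (ha0 : a 0 = 1) (hpos : ∀ i, 0 < a i)
    (hF : IsFan (bundleFan n a ω)) {K : Type u} [Field K] {φ : CoxRing k n m →+* K} {r s r' s'}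
    (h : IsUnit (φ (chartVar k n m r s))) (x : Spec (.of K))
    (hx : coxPoint hF φ r s h x ∈ Set.range (toricChart k hF (sigma_mem_bundleFan r' s'))) :
    φ (chartVar k n m r' s') ≠ 0 := by
  obtain ⟨z', hz'⟩ := hx
  obtain ⟨u, hu, hface⟩ :=
    (hF.inter_face _ (sigma_mem_bundleFan r s) _ (sigma_mem_bundleFan r' s')).1
  have hmem := notMem_of_toricChart_eq hF (sigma_mem_bundleFan r s) (sigma_mem_bundleFan r' s')
    (z := Spec.map (CommRingCat.ofHom (coxHom φ (coxCompatible_sigma h))) x) hz'.symm hu hface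
  have hmem' : coxHom φ (coxCompatible_sigma h)
      (AddMonoidAlgebra.single (⟨u, hu⟩ : dualMonoid (sigma n a ω r s)) (1 : k)) ≠ 0 := by
    intro h0
    apply hmem
    change coxHom φ (coxCompatible_sigma h) _ ∈ PrimeSpectrum.asIdeal x
    rw [h0]
    exact zero_mem _
  rw [coxHom_single, map_one, map_one, one_mul,
    laurentMonomial_ne_zero_iff ((coxCompatible_sigma h).expo hu)] at hmem'
  -- If the variable `v` vanished, its ray would lie in `σ_{rs}` and be killed by `u`, hence lie in
  -- the common face and in `σ_{r's'}`; by uniqueness of coefficients it would then be one of the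
  -- generators of `σ_{r's'}`.
  have key : ∀ v, v ∉ gens n m r' s' → φ (MvPolynomial.X v) ≠ 0 := by
    intro v hv
    rcases isUnit_or_mem_gens h v with hvu | hvs
    · exact hvu.ne_zero
    refine (hmem' v).resolve_right fun hv0 => hv ?_
    have h₁ : latticeVec (ray n a ω v) ∈ sigma n a ω r s ⊓ sigma n a ω r' s' := by
      rw [hface, pairing_ray]
      refine ⟨?_, by exact_mod_cast hv0⟩
      rw [sigma_eq_rayCone]
      exact latticeVec_ray_mem hvs
    have h₂ : latticeVec (ray n a ω v) ∈ sigma n a ω r' s' := h₁.2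
    rw [sigma_eq_rayCone] at h₂
    exact mem_of_latticeVec_ray_mem ha0 hpos (isAdmissible_gens r s) (isAdmissible_gens r' s')
      hvs h₂
  rw [chartVar, map_mul]
  exact mul_ne_zero (key _ (by simp [gens])) (key _ (by simp [gens]))

end CoxPoints

end WeightedBundle

/-! ### The Cox space, its charts and the glued morphism to `T(Σ)`. -/

namespace WeightedBundle

section CoxSpace

variable {k : Type u} [Field k] {n m : ℕ} {a ω : Fin (m + 1) → ℕ}
  {C D : Type u} [CommRing C] [CommRing D]

variable (k n m) in
/-- The space `𝔸^{n+m+2} ∖ V(I)`. -/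
noncomputable abbrev coxSpace : Scheme.{u} := (complement (irrelevantIdeal k n m)).toScheme

lemma range_SpecMap_subset {φ : CoxRing k n m →+* C} {r s}
    (h : IsUnit (φ (chartVar k n m r s))) :
    Set.range (Spec.map (CommRingCat.ofHom φ)) ⊆
      Set.range (complement (irrelevantIdeal k n m)).ι := by
  rintro _ ⟨z, rfl⟩
  rw [Scheme.Opens.range_ι]
  have key : φ (chartVar k n m r s) ∉ PrimeSpectrum.asIdeal z := fun hz =>
    (PrimeSpectrum.isPrime z).ne_top (Ideal.eq_top_of_isUnit_mem _ hz h)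
  rw [chartVar, map_mul] at key
  exact (mem_complement_irrelevantIdeal (Spec.map (CommRingCat.ofHom φ) z)).2
    ⟨⟨s, fun hz => key (Ideal.mul_mem_right _ _ hz)⟩, r, fun hz => key (Ideal.mul_mem_left _ _ hz)⟩

/-- The point of the Cox space with coordinates `φ`. -/
noncomputable def spacePoint (φ : CoxRing k n m →+* C) {r s}
    (h : IsUnit (φ (chartVar k n m r s))) : Spec (.of C) ⟶ coxSpace k n m :=
  IsOpenImmersion.lift (complement (irrelevantIdeal k n m)).ι (Spec.map (CommRingCat.ofHom φ))
    (range_SpecMap_subset h)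

lemma spacePoint_ι (φ : CoxRing k n m →+* C) {r s} (h : IsUnit (φ (chartVar k n m r s))) :
    spacePoint φ h ≫ (complement (irrelevantIdeal k n m)).ι = Spec.map (CommRingCat.ofHom φ) :=
  IsOpenImmersion.lift_fac _ _ _

lemma eq_spacePoint {φ : CoxRing k n m →+* C} {r s} (h : IsUnit (φ (chartVar k n m r s)))
    {x : Spec (.of C) ⟶ coxSpace k n m}
    (hx : x ≫ (complement (irrelevantIdeal k n m)).ι = Spec.map (CommRingCat.ofHom φ)) :
    x = spacePoint φ h := by
  rw [← cancel_mono (complement (irrelevantIdeal k n m)).ι, hx, spacePoint_ι]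

lemma SpecMap_spacePoint (φ : CoxRing k n m →+* C) (f : C →+* D) {r s}
    (h : IsUnit (φ (chartVar k n m r s))) :
    Spec.map (CommRingCat.ofHom f) ≫ spacePoint φ h = spacePoint (f.comp φ) (h.map f) :=
  eq_spacePoint _ (by rw [Category.assoc, spacePoint_ι, SpecMap_ofHom_comp])

lemma exists_chartVar_notMem (x : coxSpace k n m) :
    ∃ r s, chartVar k n m r s ∉
      PrimeSpectrum.asIdeal ((complement (irrelevantIdeal k n m)).ι x) := by
  obtain ⟨⟨s, hs⟩, r, hr⟩ := (mem_complement_irrelevantIdeal x.1).1 x.2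
  exact ⟨r, s, fun h => ((PrimeSpectrum.isPrime x.1).mem_or_mem h).elim hs hr⟩

lemma exists_eq_spacePoint {K : Type u} [Field K] (x : Spec (.of K) ⟶ coxSpace k n m) :
    ∃ (φ : CoxRing k n m →+* K) (r : _) (s : _) (h : IsUnit (φ (chartVar k n m r s))),
      x = spacePoint φ h := by
  obtain ⟨φ, hφ⟩ := exists_ringHom (x ≫ (complement (irrelevantIdeal k n m)).ι)
  let p : Spec (.of K) := (⊥ : PrimeSpectrum K)
  obtain ⟨r, s, hrs⟩ := exists_chartVar_notMem (x p)
  rw [← Scheme.Hom.comp_apply, hφ] at hrs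
  have h : IsUnit (φ (chartVar k n m r s)) := by
    rw [isUnit_iff_ne_zero]
    intro h0
    exact hrs (by change φ _ ∈ PrimeSpectrum.asIdeal p; rw [h0]; exact zero_mem _)
  exact ⟨φ, r, s, h, eq_spacePoint h hφ⟩

variable (k n m) in
/-- The coordinate ring of the chart `x_s y_r ≠ 0` of the Cox space. -/
abbrev chartRing (r : Fin (m + 1)) (s : Fin (n + 1)) : Type u :=
  Localization.Away (chartVar k n m r s)

lemma isUnit_algebraMap_chartVar (r : Fin (m + 1)) (s : Fin (n + 1)) (B : Type u) [CommRing B]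
    [Algebra (CoxRing k n m) B] [IsLocalization.Away (chartVar k n m r s) B] :
    IsUnit (algebraMap (CoxRing k n m) B (chartVar k n m r s)) :=
  IsLocalization.Away.algebraMap_isUnit (chartVar k n m r s)

variable (k n m) in
/-- The inclusion of the chart `x_s y_r ≠ 0`. -/
noncomputable def spaceChart (r : Fin (m + 1)) (s : Fin (n + 1)) :
    Spec (.of (chartRing k n m r s)) ⟶ coxSpace k n m :=
  spacePoint (algebraMap (CoxRing k n m) (chartRing k n m r s)) (isUnit_algebraMap_chartVar r s _)

instance isOpenImmersion_spaceChart (r : Fin (m + 1)) (s : Fin (n + 1)) :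
    IsOpenImmersion (spaceChart k n m r s) := by
  have : IsOpenImmersion (spaceChart k n m r s ≫ (complement (irrelevantIdeal k n m)).ι) := by
    rw [spaceChart, spacePoint_ι]
    exact IsOpenImmersion.of_isLocalization (chartVar k n m r s)
  exact IsOpenImmersion.of_comp _ (complement (irrelevantIdeal k n m)).ι

lemma mem_range_spaceChart {r s} {x : coxSpace k n m}
    (hx : chartVar k n m r s ∉
      PrimeSpectrum.asIdeal ((complement (irrelevantIdeal k n m)).ι x)) :
    x ∈ Set.range (spaceChart k n m r s) := by
  have h := PrimeSpectrum.localization_away_comap_range (chartRing k n m r s) (chartVar k n m r s)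
  obtain ⟨z, hz⟩ := h.ge hx
  let z' : Spec (.of (chartRing k n m r s)) := z
  refine ⟨z', (complement (irrelevantIdeal k n m)).ι.isOpenEmbedding.injective ?_⟩
  rw [← Scheme.Hom.comp_apply, spaceChart, spacePoint_ι]
  exact hz

lemma exists_spaceChart_eq (x : coxSpace k n m) :
    ∃ r s z, spaceChart k n m r s z = x := by
  obtain ⟨r, s, h⟩ := exists_chartVar_notMem x
  exact ⟨r, s, mem_range_spaceChart h⟩

lemma exists_spacePoint_eq_comp_spaceChart (φ : CoxRing k n m →+* C) {r s}
    (h : IsUnit (φ (chartVar k n m r s))) :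
    ∃ f : chartRing k n m r s →+* C, f.comp (algebraMap (CoxRing k n m) _) = φ ∧
      spacePoint φ h = Spec.map (CommRingCat.ofHom f) ≫ spaceChart k n m r s := by
  have hf := IsLocalization.Away.lift_comp (S := chartRing k n m r s) (chartVar k n m r s) h
  refine ⟨IsLocalization.Away.lift (S := chartRing k n m r s) (chartVar k n m r s) h, hf, ?_⟩
  symm
  apply eq_spacePoint
  rw [Category.assoc, spaceChart, spacePoint_ι, ← SpecMap_ofHom_comp, hf]

variable (k n m) in
/-- The open cover of the Cox space by the charts `x_s y_r ≠ 0`. -/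
noncomputable def spaceCover : (coxSpace k n m).OpenCover :=
  Scheme.Cover.mkOfCovers (Fin (m + 1) × Fin (n + 1))
    (fun i => Spec (.of (chartRing k n m i.1 i.2))) (fun i => spaceChart k n m i.1 i.2)
    (fun x => by
      obtain ⟨r, s, z, hz⟩ := exists_spaceChart_eq x
      exact ⟨(r, s), z, hz⟩)
    fun i => isOpenImmersion_spaceChart i.1 i.2

/-- The gluing condition, tested on ring-valued points of the overlap: both charts then induce the
same homomorphism out of the Cox ring, and `coxPoint` does not depend on the chosen chart. -/
lemma comp_coxPoint_eq (hF : IsFan (bundleFan n a ω)) {r s r' s'} {P : Scheme.{u}}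
    (p : P ⟶ Spec (.of (chartRing k n m r s))) (p' : P ⟶ Spec (.of (chartRing k n m r' s')))
    (e : p ≫ spaceChart k n m r s = p' ≫ spaceChart k n m r' s') :
    p ≫ coxPoint hF (algebraMap (CoxRing k n m) (chartRing k n m r s)) r s
        (isUnit_algebraMap_chartVar r s _) =
      p' ≫ coxPoint hF (algebraMap (CoxRing k n m) (chartRing k n m r' s')) r' s'
        (isUnit_algebraMap_chartVar r' s' _) :=
  hom_ext_of_Spec fun C _ x => by
    obtain ⟨f, hf⟩ := exists_ringHom (x ≫ p)
    obtain ⟨g, hg⟩ := exists_ringHom (x ≫ p')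
    have e : f.comp (algebraMap (CoxRing k n m) (chartRing k n m r s)) =
        g.comp (algebraMap (CoxRing k n m) (chartRing k n m r' s')) := by
      apply SpecMap_ofHom_injective
      rw [SpecMap_ofHom_comp _ f, SpecMap_ofHom_comp _ g,
        ← spacePoint_ι _ (isUnit_algebraMap_chartVar r s (chartRing k n m r s)),
        ← spacePoint_ι _ (isUnit_algebraMap_chartVar r' s' (chartRing k n m r' s')), ← hf, ← hg]
      change (x ≫ p) ≫ spaceChart k n m r s ≫ _ = (x ≫ p') ≫ spaceChart k n m r' s' ≫ _
      rw [Category.assoc, Category.assoc, reassoc_of% e]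
    have hu : IsUnit ((f.comp (algebraMap (CoxRing k n m) (chartRing k n m r s)))
        (chartVar k n m r' s')) := by
      rw [e]
      exact (isUnit_algebraMap_chartVar r' s' _).map g
    rw [← Category.assoc, ← Category.assoc, hf, hg, SpecMap_coxPoint, SpecMap_coxPoint,
      coxPoint_eq hF _ hu]
    exact coxPoint_congr hF e _ _

/-- The morphism from the Cox space to `T(Σ)`. -/
noncomputable def coxMap (hF : IsFan (bundleFan n a ω)) :
    coxSpace k n m ⟶ (toricVariety k hF).left :=
  Scheme.Cover.glueMorphisms (spaceCover k n m)
    (fun i => coxPoint hF (algebraMap (CoxRing k n m) (chartRing k n m i.1 i.2)) i.1 i.2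
      (isUnit_algebraMap_chartVar i.1 i.2 _))
    fun _ _ => comp_coxPoint_eq hF _ _ pullback.condition

lemma spaceChart_coxMap (hF : IsFan (bundleFan n a ω)) (r : Fin (m + 1)) (s : Fin (n + 1)) :
    spaceChart k n m r s ≫ coxMap hF =
      coxPoint hF (algebraMap (CoxRing k n m) (chartRing k n m r s)) r s
        (isUnit_algebraMap_chartVar r s _) :=
  Scheme.Cover.ι_glueMorphisms (spaceCover k n m) _ _ (r, s)

lemma spaceChart_coxMap' (hF : IsFan (bundleFan n a ω)) (r : Fin (m + 1)) (s : Fin (n + 1)) :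
    spaceChart k n m r s ≫ coxMap hF =
      Spec.map (CommRingCat.ofHom (chartInvariants k a ω (chartRing k n m r s) r s)) ≫
        toricChart k hF (sigma_mem_bundleFan r s) :=
  spaceChart_coxMap hF r s

lemma spacePoint_coxMap (hF : IsFan (bundleFan n a ω)) (φ : CoxRing k n m →+* C) {r s}
    (h : IsUnit (φ (chartVar k n m r s))) : spacePoint φ h ≫ coxMap hF = coxPoint hF φ r s h := by
  obtain ⟨f, hf, e⟩ := exists_spacePoint_eq_comp_spaceChart φ h
  rw [e, Category.assoc, spaceChart_coxMap, SpecMap_coxPoint]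
  exact coxPoint_congr hF hf _ _

lemma coxMap_hom (hF : IsFan (bundleFan n a ω)) :
    coxMap hF ≫ (toricVariety k hF).hom = (complementOver (irrelevantIdeal k n m)).hom :=
  Scheme.Cover.hom_ext (spaceCover k n m) _ _ fun i => by
    change spaceChart k n m i.1 i.2 ≫ _ = spaceChart k n m i.1 i.2 ≫
      (complement (irrelevantIdeal k n m)).ι ≫ Spec.map _
    rw [← Category.assoc, spaceChart_coxMap, coxPoint_hom, ← Category.assoc, spaceChart,
      spacePoint_ι, SpecMap_ofHom_comp]
    rfl

/-- The morphism from the Cox space to `T(Σ)`, over `k`. -/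
noncomputable def coxMapOver (hF : IsFan (bundleFan n a ω)) :
    complementOver (irrelevantIdeal k n m) ⟶ toricVariety k hF :=
  Over.homMk (coxMap hF) (coxMap_hom hF)

/-- The preimage of an affine chart of `T(Σ)` is the corresponding chart of the Cox space. -/
lemma mem_range_spaceChart_of_coxMap_mem (ha0 : a 0 = 1) (hpos : ∀ i, 0 < a i)
    (hF : IsFan (bundleFan n a ω)) {r s} {x : coxSpace k n m}
    (hx : coxMap hF x ∈ Set.range (toricChart k hF (sigma_mem_bundleFan r s))) :
    x ∈ Set.range (spaceChart k n m r s) := by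
  -- Passing to the residue field of `x` turns the point into Cox coordinates in a field, to which
  -- `ne_zero_of_coxPoint_mem` applies.
  let p : Spec ((coxSpace k n m).residueField x) :=
    (⊥ : PrimeSpectrum ((coxSpace k n m).residueField x))
  have hp : (coxSpace k n m).fromSpecResidueField x p = x :=
    Scheme.fromSpecResidueField_apply _ _
  obtain ⟨φ, r', s', h, e⟩ := exists_eq_spacePoint
    (K := (coxSpace k n m).residueField x) ((coxSpace k n m).fromSpecResidueField x)
  have hp' : spacePoint φ h p = x := by rw [← e, hp]
  rw [← hp', ← Scheme.Hom.comp_apply, spacePoint_coxMap] at hx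
  have h0 := ne_zero_of_coxPoint_mem ha0 hpos hF h p hx
  have hι : (complement (irrelevantIdeal k n m)).ι x = Spec.map (CommRingCat.ofHom φ) p := by
    rw [← spacePoint_ι φ h, Scheme.Hom.comp_apply, hp']
  apply mem_range_spaceChart
  rw [hι]
  intro hmem
  exact h0 hmem

end CoxSpace

end WeightedBundle

/-! ### The torus action, and `coxMap` as a geometric quotient. -/

namespace WeightedBundle

section Action

variable {k : Type u} [Field k] {n m : ℕ} {a ω : Fin (m + 1) → ℕ} {C : Type u} [CommRing C]

variable (k n m) in
/-- The space `𝔾_m^2 × (𝔸^{n+m+2} ∖ V(I))`. -/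
noncomputable abbrev actionSpace : Scheme.{u} :=
  (affinePr k 2 (Fin (n + 1) ⊕ Fin (m + 1)) ⁻¹ᵁ complement (irrelevantIdeal k n m)).toScheme

lemma complementPr_ι : complementPr 2 (irrelevantIdeal k n m) ≫
    (complement (irrelevantIdeal k n m)).ι =
      (affinePr k 2 _ ⁻¹ᵁ complement (irrelevantIdeal k n m)).ι ≫ affinePr k 2 _ :=
  morphismRestrict_ι _ _

lemma complementAct_ι : complementAct (isStable k n a ω) ≫
    (complement (irrelevantIdeal k n m)).ι =
      (affinePr k 2 _ ⁻¹ᵁ complement (irrelevantIdeal k n m)).ι ≫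
        affineAct k (weights n a ω) :=
  Scheme.Hom.resLE_comp_ι _ _

/-- The torus part of a point of `𝔾_m^2 × 𝔸^ν`. -/
noncomputable def torusPart (ψ : TorusTimesAffine k 2 (Fin (n + 1) ⊕ Fin (m + 1)) →+* C) :
    Multiplicative (Fin 2 → ℤ) →* C :=
  ψ.toMonoidHom.comp (AddMonoidAlgebra.of _ _)

lemma actHom_C (c : k) : actHom k (weights n a ω) (MvPolynomial.C c) =
    prHom k 2 (Fin (n + 1) ⊕ Fin (m + 1)) (MvPolynomial.C c) := by
  rw [actHom, MvPolynomial.aeval_C]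
  rfl

lemma map_actHom_X (ψ : TorusTimesAffine k 2 (Fin (n + 1) ⊕ Fin (m + 1)) →+* C) (v) :
    ψ (actHom k (weights n a ω) (MvPolynomial.X v)) =
      torusUnit (torusPart ψ) (fun l => weights n a ω l v) *
        ψ (prHom k 2 _ (MvPolynomial.X v)) := by
  have h : torusUnit (torusPart ψ) (fun l => weights n a ω l v) =
      ψ (AddMonoidAlgebra.single (fun l => weights n a ω l v) 1) := rfl
  have h' : prHom k 2 (Fin (n + 1) ⊕ Fin (m + 1)) (MvPolynomial.X v) =
      AddMonoidAlgebra.single 0 (MvPolynomial.X v) := rfl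
  rw [h, h', ← map_mul, AddMonoidAlgebra.single_mul_single, add_zero, one_mul, actHom,
    MvPolynomial.aeval_X]

lemma isUnit_actHom_chartVar {ψ : TorusTimesAffine k 2 (Fin (n + 1) ⊕ Fin (m + 1)) →+* C} {r s}
    (h : IsUnit (ψ.comp (prHom k 2 _) (chartVar k n m r s))) :
    IsUnit (ψ.comp (actHom k (weights n a ω)).toRingHom (chartVar k n m r s)) := by
  rw [chartVar, map_mul] at h
  have key : ∀ v, IsUnit (ψ.comp (prHom k 2 _) (MvPolynomial.X v)) →
      IsUnit (ψ.comp (actHom k (weights n a ω)).toRingHom (MvPolynomial.X v)) := by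
    intro v hv
    have := (Units.isUnit (torusUnit (torusPart ψ) (fun l => weights n a ω l v))).mul hv
    exact (map_actHom_X (a := a) (ω := ω) ψ v).symm ▸ this
  rw [chartVar, map_mul]
  exact (key _ (isUnit_of_mul_isUnit_left h)).mul (key _ (isUnit_of_mul_isUnit_right h))

lemma coxHom_prHom_eq_actHom (ha0 : a 0 = 1)
    (ψ : TorusTimesAffine k 2 (Fin (n + 1) ⊕ Fin (m + 1)) →+* C) {τ : Cone (Fin m ⊕ Fin n)}
    (h : CoxCompatible a ω τ (ψ.comp (prHom k 2 _)))
    (h' : CoxCompatible a ω τ (ψ.comp (actHom k (weights n a ω)).toRingHom)) :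
    coxHom (ψ.comp (prHom k 2 _)) h = coxHom (ψ.comp (actHom k (weights n a ω)).toRingHom) h' :=
  coxHom_eq_of_torus ha0 (torusPart ψ) (fun c => congrArg ψ (actHom_C c)) (map_actHom_X ψ) h h'

lemma comp_complementPr_ι {x : Spec (.of C) ⟶ actionSpace k n m}
    {ψ : TorusTimesAffine k 2 (Fin (n + 1) ⊕ Fin (m + 1)) →+* C}
    (hx : x ≫ (affinePr k 2 _ ⁻¹ᵁ complement (irrelevantIdeal k n m)).ι =
      Spec.map (CommRingCat.ofHom ψ)) :
    (x ≫ complementPr 2 (irrelevantIdeal k n m)) ≫ (complement (irrelevantIdeal k n m)).ι =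
      Spec.map (CommRingCat.ofHom (ψ.comp (prHom k 2 _))) := by
  rw [Category.assoc, complementPr_ι, ← Category.assoc, hx, affinePr, ← SpecMap_ofHom_comp]

lemma comp_complementAct_ι {x : Spec (.of C) ⟶ actionSpace k n m}
    {ψ : TorusTimesAffine k 2 (Fin (n + 1) ⊕ Fin (m + 1)) →+* C}
    (hx : x ≫ (affinePr k 2 _ ⁻¹ᵁ complement (irrelevantIdeal k n m)).ι =
      Spec.map (CommRingCat.ofHom ψ)) :
    (x ≫ complementAct (isStable k n a ω)) ≫ (complement (irrelevantIdeal k n m)).ι =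
      Spec.map (CommRingCat.ofHom (ψ.comp (actHom k (weights n a ω)).toRingHom)) := by
  rw [Category.assoc, complementAct_ι, ← Category.assoc, hx, affineAct, ← SpecMap_ofHom_comp]

lemma exists_actionPoint (ψ : TorusTimesAffine k 2 (Fin (n + 1) ⊕ Fin (m + 1)) →+* C) {r s}
    (h : IsUnit (ψ.comp (prHom k 2 _) (chartVar k n m r s))) :
    ∃ x : Spec (.of C) ⟶ actionSpace k n m,
      x ≫ (affinePr k 2 _ ⁻¹ᵁ complement (irrelevantIdeal k n m)).ι =
        Spec.map (CommRingCat.ofHom ψ) := by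
  refine ⟨IsOpenImmersion.lift _ (Spec.map (CommRingCat.ofHom ψ)) ?_,
    IsOpenImmersion.lift_fac _ _ _⟩
  rintro _ ⟨z, rfl⟩
  rw [Scheme.Opens.range_ι]
  have := range_SpecMap_subset h ⟨z, rfl⟩
  rw [Scheme.Opens.range_ι, SpecMap_ofHom_comp] at this
  exact this

/-- `coxMap` is constant on orbits. -/
lemma complementPr_coxMap (ha0 : a 0 = 1) (hF : IsFan (bundleFan n a ω)) :
    complementPr 2 (irrelevantIdeal k n m) ≫ coxMap hF =
      complementAct (isStable k n a ω) ≫ coxMap hF :=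
  hom_ext_of_Spec fun C _ x => by
    obtain ⟨ψ, hψ⟩ := exists_ringHom
      (x ≫ (affinePr k 2 _ ⁻¹ᵁ complement (irrelevantIdeal k n m)).ι)
    -- A ring-valued point need not lie in one chart. The values of the `x_s y_r` generate the unit
    -- ideal of `C`, since otherwise a maximal ideal would give a point of `V(I)`; after localizing
    -- at one of them, the point lies in a single chart.
    refine hom_ext_of_span
      (fun i : Fin (m + 1) × Fin (n + 1) => ψ.comp (prHom k 2 _) (chartVar k n m i.1 i.2)) ?_ ?_
    · by_contra hne
      obtain ⟨M, hM, hle⟩ := Ideal.exists_le_maximal _ hne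
      let z : Spec (.of C) := (⟨M, hM.isPrime⟩ : PrimeSpectrum C)
      obtain ⟨r, s, hrs⟩ := exists_chartVar_notMem
        ((x ≫ complementPr 2 (irrelevantIdeal k n m)) z)
      rw [← Scheme.Hom.comp_apply, comp_complementPr_ι hψ] at hrs
      exact hrs (hle (Ideal.subset_span ⟨(r, s), rfl⟩))
    · intro i
      let c : C := ψ.comp (prHom k 2 _) (chartVar k n m i.1 i.2)
      let g : C →+* Localization.Away c := algebraMap C (Localization.Away c)
      have hc : IsUnit (((g.comp ψ).comp (prHom k 2 _)) (chartVar k n m i.1 i.2)) :=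
        IsLocalization.Away.algebraMap_isUnit c
      have hy : (Spec.map (CommRingCat.ofHom g) ≫ x) ≫
          (affinePr k 2 _ ⁻¹ᵁ complement (irrelevantIdeal k n m)).ι =
            Spec.map (CommRingCat.ofHom (g.comp ψ)) := by
        rw [Category.assoc, hψ, SpecMap_ofHom_comp ψ g]
      have h₁ := eq_spacePoint hc (comp_complementPr_ι hy)
      have h₂ := eq_spacePoint (isUnit_actHom_chartVar hc)
        (comp_complementAct_ι (a := a) (ω := ω) hy)
      have h₃ := coxHom_prHom_eq_actHom ha0 (g.comp ψ)
        (coxCompatible_sigma (a := a) (ω := ω) hc)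
        (coxCompatible_sigma (isUnit_actHom_chartVar hc))
      have h₄ : ∀ f : actionSpace k n m ⟶ coxSpace k n m,
          Spec.map (CommRingCat.ofHom g) ≫ x ≫ f ≫ coxMap hF =
            ((Spec.map (CommRingCat.ofHom g) ≫ x) ≫ f) ≫ coxMap hF := fun f => by
        simp only [Category.assoc]
      refine (h₄ _).trans (Eq.trans ?_ (h₄ _).symm)
      rw [h₁, h₂, spacePoint_coxMap, spacePoint_coxMap, coxPoint, coxPoint, h₃]

/-- Geometric points with the same image under `coxMap` lie in one orbit. -/
lemma exists_actionPoint_of_coxMap_eq (ha0 : a 0 = 1) (hpos : ∀ i, 0 < a i)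
    (hF : IsFan (bundleFan n a ω)) {K : Type u} [Field K] [IsAlgClosed K]
    {x y : Spec (.of K) ⟶ coxSpace k n m} (e : x ≫ coxMap hF = y ≫ coxMap hF) :
    ∃ g : Spec (.of K) ⟶ actionSpace k n m,
      g ≫ complementPr 2 (irrelevantIdeal k n m) = x ∧
        g ≫ complementAct (isStable k n a ω) = y := by
  obtain ⟨φ, r, s, h, rfl⟩ := exists_eq_spacePoint x
  obtain ⟨φ', r', s', h', rfl⟩ := exists_eq_spacePoint y
  rw [spacePoint_coxMap, spacePoint_coxMap] at e
  let p : Spec (.of K) := (⊥ : PrimeSpectrum K)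
  -- The second point maps into the chart of the first, so it has coordinates there too and both can
  -- be compared in `k[S_{σ_rs}]`.
  have h₁ : φ' (chartVar k n m r s) ≠ 0 := by
    refine ne_zero_of_coxPoint_mem ha0 hpos hF h' p ?_
    rw [← e, coxPoint, Scheme.Hom.comp_apply]
    exact Set.mem_range_self _
  rw [coxPoint_eq hF h' h₁.isUnit] at e
  obtain ⟨ψ, h₂, h₃⟩ := exists_torus_of_coxHom_eq ha0 hpos (coxCompatible_sigma h)
    (coxCompatible_sigma h₁.isUnit) h h₁.isUnit (coxHom_eq_of_coxPoint_eq hF h h₁.isUnit e)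
  obtain ⟨g, hg⟩ := exists_actionPoint ψ (r := r) (s := s) (by rw [h₂]; exact h)
  refine ⟨g, eq_spacePoint h ?_, eq_spacePoint h' ?_⟩
  · rw [comp_complementPr_ι hg, h₂]
  · rw [comp_complementAct_ι hg, h₃]

/-- Every `U_τ` maps into some `U_{σ_rs}`, over which `coxMap` is the spectrum of an inclusion of
invariants. -/
lemma coxMap_surjective (ha0 : a 0 = 1) (hpos : ∀ i, 0 < a i) (hF : IsFan (bundleFan n a ω)) :
    Function.Surjective (coxMap (k := k) hF) := by
  intro y
  obtain ⟨τ, hτ, z, rfl⟩ := exists_toricChart_eq hF y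
  obtain ⟨r, s, u, hu, hface⟩ := id hτ
  have hle : τ ≤ sigma n a ω r s := fun v hv => ((hface v).1 hv).1
  obtain ⟨w, hw⟩ := (isGradedChart (k := k) (ω := ω) (B := chartRing k n m r s) r s
    ha0 hpos).comap_surjective
    (Spec.map (CommRingCat.ofHom (coneAlgebraMap k hle).toRingHom) z)
  let w' : Spec (.of (chartRing k n m r s)) := w
  refine ⟨spaceChart k n m r s w', ?_⟩
  rw [← Scheme.Hom.comp_apply, spaceChart_coxMap', Scheme.Hom.comp_apply,
    ← SpecMap_coneAlgebraMap_toricChart hF hτ (sigma_mem_bundleFan r s) hle, Scheme.Hom.comp_apply]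
  exact congrArg _ hw

lemma isOpenMap_coxMap (ha0 : a 0 = 1) (hpos : ∀ i, 0 < a i) (hF : IsFan (bundleFan n a ω)) :
    IsOpenMap (coxMap (k := k) hF) := by
  intro U hU
  have h₁ : ∀ r s, IsOpenMap (spaceChart k n m r s ≫ coxMap hF) := by
    intro r s
    have := isOpenImmersion_toricChart (k := k) hF (sigma_mem_bundleFan r s)
    rw [spaceChart_coxMap', Scheme.Hom.comp_base, TopCat.coe_comp]
    exact (toricChart k hF (sigma_mem_bundleFan r s)).isOpenEmbedding.isOpenMap.comp
      (isGradedChart (k := k) (ω := ω) (B := chartRing k n m r s) r s ha0 hpos).isOpenMap_comap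
  have h₂ : coxMap hF '' U = ⋃ r, ⋃ s, (spaceChart k n m r s ≫ coxMap hF) ''
      (spaceChart k n m r s ⁻¹' U) := by
    ext y
    simp only [Set.mem_iUnion]
    constructor
    · rintro ⟨x, hx, rfl⟩
      obtain ⟨r, s, z, rfl⟩ := exists_spaceChart_eq x
      exact ⟨r, s, z, hx, Scheme.Hom.comp_apply _ _ _⟩
    · rintro ⟨r, s, z, hz, rfl⟩
      exact ⟨_, hz, (Scheme.Hom.comp_apply _ _ _).symm⟩
  rw [h₂]
  exact isOpen_iUnion fun r => isOpen_iUnion fun s =>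
    h₁ r s _ (hU.preimage (spaceChart k n m r s).continuous)

variable (k) in
/-- The basic open subset `D(f)` of an affine chart of `T(Σ)`. -/
noncomputable def basicChart (hF : IsFan (bundleFan n a ω)) {r s}
    (f : coneAlgebra k (sigma n a ω r s)) :
    Spec (.of (Localization.Away f)) ⟶ (toricVariety k hF).left :=
  Spec.map (CommRingCat.ofHom (algebraMap _ (Localization.Away f))) ≫
    toricChart k hF (sigma_mem_bundleFan r s)

lemma isOpenImmersion_basicChart (hF : IsFan (bundleFan n a ω)) {r s}
    (f : coneAlgebra k (sigma n a ω r s)) : IsOpenImmersion (basicChart k hF f) := by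
  have := isOpenImmersion_toricChart (k := k) hF (sigma_mem_bundleFan r s)
  have : IsOpenImmersion (Spec.map (CommRingCat.ofHom (algebraMap _ (Localization.Away f)))) :=
    IsOpenImmersion.of_isLocalization f
  rw [basicChart]
  infer_instance

/-- The sets `D(f)` in the maximal charts form a basis of `T(Σ)`, as
`sectionsAreInvariants_of_basis` requires. -/
lemma exists_basicChart (hF : IsFan (bundleFan n a ω)) {V : (toricVariety k hF).left.Opens}
    {y : (toricVariety k hF).left} (hy : y ∈ V) :
    ∃ r s, ∃ f : coneAlgebra k (sigma n a ω r s),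
      y ∈ Set.range (basicChart k hF f) ∧ Set.range (basicChart k hF f) ⊆ V := by
  obtain ⟨τ, hτ, z, rfl⟩ := exists_toricChart_eq hF y
  obtain ⟨r, s, u, hu, hface⟩ := id hτ
  have hle : τ ≤ sigma n a ω r s := fun v hv => ((hface v).1 hv).1
  rw [← SpecMap_coneAlgebraMap_toricChart hF hτ (sigma_mem_bundleFan r s) hle,
    Scheme.Hom.comp_apply] at hy ⊢
  set w := Spec.map (CommRingCat.ofHom (coneAlgebraMap k hle).toRingHom) z
  have hrange : ∀ f : coneAlgebra k (sigma n a ω r s),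
      Set.range (basicChart k hF f) = toricChart k hF (sigma_mem_bundleFan r s) ''
        (PrimeSpectrum.basicOpen f : Set (PrimeSpectrum (coneAlgebra k (sigma n a ω r s)))) := by
    intro f
    rw [← PrimeSpectrum.localization_away_comap_range (Localization.Away f) f]
    exact Set.range_comp (toricChart k hF (sigma_mem_bundleFan r s))
      (Spec.map (CommRingCat.ofHom (algebraMap _ (Localization.Away f))))
  have hopen : IsOpen (toricChart k hF (sigma_mem_bundleFan r s) ⁻¹' (V : Set _)) :=
    V.isOpen.preimage (toricChart k hF (sigma_mem_bundleFan r s)).continuous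
  obtain ⟨_, ⟨f, rfl⟩, hf, hfV⟩ :=
    PrimeSpectrum.isTopologicalBasis_basic_opens.exists_subset_of_mem_open (a := w) hy hopen
  refine ⟨r, s, f, ?_, ?_⟩
  · rw [hrange]
    exact ⟨w, hf, rfl⟩
  · rw [hrange]
    exact Set.image_subset_iff.2 hfV

lemma sectionsAreInvariants_coxMap (ha0 : a 0 = 1) (hpos : ∀ i, 0 < a i)
    (hF : IsFan (bundleFan n a ω)) {r s} (f : coneAlgebra k (sigma n a ω r s))
    [IsOpenImmersion (basicChart k hF f)] (B' : Type u) [CommRing B']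
    [Algebra (chartRing k n m r s) B']
    [IsLocalization.Away (chartInvariants k a ω (chartRing k n m r s) r s f) B'] :
    SectionsAreInvariants (complementPr 2 (irrelevantIdeal k n m))
      (complementAct (isStable k n a ω)) (coxMap hF) (basicChart k hF f).opensRange := by
  let i := chartInvariants k a ω (chartRing k n m r s) r s
  have hi := isGradedChart (k := k) (ω := ω) (B := chartRing k n m r s) r s ha0 hpos
  let b : chartRing k n m r s →+* B' := algebraMap _ B'
  let φ : CoxRing k n m →+* B' := b.comp (algebraMap (CoxRing k n m) (chartRing k n m r s))
  let i' : Localization.Away f →+* B' := IsLocalization.Away.map _ _ i f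
  have hi' : ∀ x, i' (algebraMap _ _ x) = b (i x) := fun x => IsLocalization.map_eq _ x
  obtain ⟨act', hact'⟩ := hi.exists_act_localization f B'
  -- This defines the test morphism `J` from `𝔾_m² × Spec B'` to the action space; composed with the
  -- projection and the action, it is given on rings by `p` and `act'`.
  let ψ : TorusTimesAffine k 2 (Fin (n + 1) ⊕ Fin (m + 1)) →+*
      AddMonoidAlgebra B' (Fin 2 → ℤ) := AddMonoidAlgebra.mapRingHom _ φ
  let p : B' →+* AddMonoidAlgebra B' (Fin 2 → ℤ) := AddMonoidAlgebra.singleZeroRingHom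
  have hψp : ψ.comp (prHom k 2 _) = p.comp φ := by
    refine RingHom.ext fun x => ?_
    exact AddMonoidAlgebra.mapRingHom_single _ _ _
  have hψa : ψ.comp (actHom k (weights n a ω)).toRingHom = act'.comp φ := by
    have h : ψ.comp (actHom k (weights n a ω)).toRingHom =
        (AddMonoidAlgebra.mapRingHom (Fin 2 → ℤ) b).comp
          (coaction a ω (algebraMap (CoxRing k n m) (chartRing k n m r s))) := by
      rw [coaction, ← RingHom.comp_assoc, ← AddMonoidAlgebra.mapRingHom_comp]
    rw [h]
    refine RingHom.ext fun x => ?_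
    rw [RingHom.comp_apply, ← chartAct_algebraMap r s]
    exact (hact' _).symm
  have hφ : IsUnit (φ (chartVar k n m r s)) := (isUnit_algebraMap_chartVar r s _).map b
  have hj : Spec.map (CommRingCat.ofHom b) ≫ spaceChart k n m r s = spacePoint φ hφ :=
    SpecMap_spacePoint _ _ _
  have : IsOpenImmersion (Spec.map (CommRingCat.ofHom b)) := IsOpenImmersion.of_isLocalization (i f)
  obtain ⟨J, hJ⟩ := exists_actionPoint ψ (r := r) (s := s) (by rw [hψp]; exact hφ.map p)
  have hJp := eq_spacePoint (hφ.map p) (by rw [comp_complementPr_ι hJ, hψp])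
  have hJa := eq_spacePoint (hφ.map act')
    (by rw [comp_complementAct_ι (a := a) (ω := ω) hJ, hψa])
  refine sectionsAreInvariants_of_chart (basicChart k hF f)
    (Spec.map (CommRingCat.ofHom b) ≫ spaceChart k n m r s) i' ?_ ?_ ?_ p act' J ?_ ?_ ?_
  · exact IsLocalization.map_injective_of_injective _ _ _ hi.injective
  · have e : b.comp i = i'.comp (algebraMap _ (Localization.Away f)) :=
      RingHom.ext fun x => (hi' x).symm
    rw [Category.assoc, spaceChart_coxMap', basicChart, ← Category.assoc, ← Category.assoc,
      ← SpecMap_ofHom_comp, ← SpecMap_ofHom_comp, e]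
  -- A point over `D(f)` lies in the chart `x_s y_r ≠ 0`, and injectivity of `toricChart` then
  -- places it in the locus where `i f` is invertible, which is `Spec B'`.
  · rintro x ⟨z, hz⟩
    obtain ⟨w, rfl⟩ := mem_range_spaceChart_of_coxMap_mem ha0 hpos hF (r := r) (s := s) (x := x)
      ⟨Spec.map (CommRingCat.ofHom (algebraMap _ (Localization.Away f))) z, by
        rw [← hz, basicChart, Scheme.Hom.comp_apply]⟩
    rw [← Scheme.Hom.comp_apply, spaceChart_coxMap', basicChart, Scheme.Hom.comp_apply,
      Scheme.Hom.comp_apply] at hz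
    have := isOpenImmersion_toricChart (k := k) hF (sigma_mem_bundleFan r s)
    have hz' := (toricChart k hF (sigma_mem_bundleFan r s)).isOpenEmbedding.injective hz
    have hw : w ∈ (PrimeSpectrum.basicOpen (i f) : Set (PrimeSpectrum (chartRing k n m r s))) := by
      have h := (PrimeSpectrum.localization_away_comap_range (Localization.Away f) f).le ⟨z, rfl⟩
      have h' : PrimeSpectrum.comap (algebraMap _ (Localization.Away f)) z =
        PrimeSpectrum.comap i w := hz'
      rw [h'] at h
      exact h
    rw [← PrimeSpectrum.localization_away_comap_range B' (i f)] at hw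
    obtain ⟨w', rfl⟩ := hw
    exact ⟨w', Scheme.Hom.comp_apply _ _ _⟩
  · rw [hJp, hj, SpecMap_spacePoint]
  · rw [hJa, hj, SpecMap_spacePoint]
  · intro x hx
    exact hi.exists_of_localization f hi' hact' hx.symm

/-- `coxMap` is a geometric quotient. -/
lemma isGeometricQuotient_coxMap (ha0 : a 0 = 1) (hpos : ∀ i, 0 < a i)
    (hF : IsFan (bundleFan n a ω)) :
    IsGeometricQuotient (complementPr 2 (irrelevantIdeal k n m))
      (complementAct (isStable k n a ω)) (coxMap hF) where
  invariant := complementPr_coxMap ha0 hF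
  isQuotientMap := (isOpenMap_coxMap ha0 hpos hF).isQuotientMap (coxMap hF).continuous
    (coxMap_surjective ha0 hpos hF)
  orbit _ _ _ _ _ e := exists_actionPoint_of_coxMap_eq ha0 hpos hF e
  functions := sectionsAreInvariants_of_basis fun V y hy => by
    obtain ⟨r, s, f, hyf, hfV⟩ := exists_basicChart hF hy
    have := isOpenImmersion_basicChart hF f
    exact ⟨(basicChart k hF f).opensRange, hfV, hyf, sectionsAreInvariants_coxMap ha0 hpos hF f
      (Localization.Away (chartInvariants k a ω (chartRing k n m r s) r s f))⟩

end Action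

end WeightedBundle

theorem theorem3p2 {k : Type u} [Field k] [CharZero k] (n m : ℕ) (a ω : Fin (m + 1) → ℕ)
    (ha0 : a 0 = 1) (ha : IsWellFormed a) :
    ∃ hF : IsFan (bundleFan n a ω),
      -- the maximal cones of `Σ` are the cones `σ_{rs}`
      (∀ σ, Maximal (· ∈ bundleFan n a ω) σ ↔ ∃ r s, σ = sigma n a ω r s) ∧
      -- the primitive ray generators of `Σ` are the `α_j` and the `β_i`
      (n ≠ 0 → {v | IsPrimitive v ∧ coneOf {v} ∈ bundleFan n a ω} =
        Set.range (alpha n a ω) ∪ Set.range (beta n a)) ∧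
      -- `T(Σ)` is the quotient, and any variety that is the quotient is isomorphic to `T(Σ)`
      ∃ q : complementOver (irrelevantIdeal k n m) ⟶ toricVariety k hF,
        IsQuotientVariety (isStable k n a ω) (toricVariety k hF) q ∧
        ∀ (X : Over (Spec (.of k))) (π : complementOver (irrelevantIdeal k n m) ⟶ X),
          IsQuotientVariety (isStable k n a ω) X π →
            ∃ e : X ≅ toricVariety k hF, π ≫ e.hom = q := by
  have hF : IsFan (bundleFan n a ω) := isFan_bundleFan ha0 ha.1
  have hq : IsQuotientVariety (isStable k n a ω) (toricVariety k hF) (coxMapOver hF) :=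
    isGeometricQuotient_coxMap ha0 ha.1 hF
  exact ⟨hF, maximal_bundleFan_iff ha0 ha.1, fun hn => rays_bundleFan hn ha0 ha, coxMapOver hF, hq,
    fun X π hπ => exists_iso_of_isGeometricQuotient hπ hq⟩
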